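/- Let $n\in\mathbb N$, $p>1$, $q>0$, $L\in\mathbb R$, and let $\Omega\subset\mathbb R^n$ be a bounded strictly convex domain of class $C^{2,\beta}$ for some $0<\beta<1$ (that is, $\Omega$ is nonempty, open, bounded and convex, its boundary is of class $C^{2,\beta}$ and all principal curvatures of $\partial\Omega$ are positive). Then there is a constant $C=C(n,p,q,L,\Omega)$ with the following property. Let $f\in C^{1,\gamma}(\overline\Omega\times\mathbb R)$ for some $0<\gamma<1$ (Hölder continuity being local) with $f_z(x,z)\le 0$ and $|f(x,z)|+|D_xf(x,z)|\le L$ for all $(x,z)$, and let $\phi\in C^2(\partial\Omega)$ with $\|\phi\|_{C^2(\partial\Omega)}\le L$, where $\|\phi\|_{C^2(\partial\Omega)}$ is the infimum of $\sup_{\overline\Omega}|\Phi|+\sup_{\overline\Omega}|D\Phi|+\sup_{\overline\Omega}|D^2\Phi|$ over all $C^2$ extensions $\Phi$ of $\phi$. Let $0<\varepsilon\le 1$, put $v=\sqrt{\varepsilon^2+|Du|^2}$, and let $u$ be a solution, of the parabolic Hölder class $C^{2,\sigma}(\overline\Omega\times[0,\infty))$ for some $0<\sigma<1$ (Hölder bounds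 being required on $\overline\Omega\times[0,T]$ for each finite $T$), of $$ \begin{cases} u_t=\operatorname{div}(v^{p-2}Du)+f(x,u) & \text{in }\Omega\times[0,\infty),\\ u(x,0)=u_{0,\varepsilon}(x) & \text{in }\Omega,\\ u_\nu=-\phi(x)\,v^{1-q} & \text{on }\partial\Omega\times[0,\infty), \end{cases} $$ where $\nu$ is the inward unit normal. Then for every $T\ge 0$ $$ \sup_{\overline\Omega\times[0,T]}|Du|\le C(n,p,q,L,\Omega)\,\Bigl(1+\sup_{\Omega}|Du_{0,\varepsilon}|\Bigr). $$ In particular the bound does not depend on $T$ or on the $C^0$ norm of $u$, and it depends on $\varepsilon$ at most through $\sup_\Omega|Du_{0,\varepsilon}|$. -/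

import Mathlib

open Set

open scoped ENNReal

noncomputable section

/-- `g ∈ C^{k,β}(S)`: `g` is `k` times continuously differentiable on `S` (up to the part of the
boundary contained in `S`) and its `k`-th derivative is `β`-Hölder on every compact subset of `S`. -/
def IsCkHolderOn {F : Type*} [NormedAddCommGroup F] [NormedSpace ℝ F]
    (k : ℕ) (β : ℝ) (g : F → ℝ) (S : Set F) : Prop :=
  ContDiffOn ℝ k g S ∧
    ∀ K ⊆ S, IsCompact K → ∃ M : ℝ, ∀ x ∈ K, ∀ y ∈ K,
      ‖iteratedFDerivWithin ℝ k g S x - iteratedFDerivWithin ℝ k g S y‖ ≤ M * ‖x - y‖ ^ β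

/-- `ρ` is a `C¹` defining function of `Ω` in the open set `U`: inside `U` the set `Ω` is
`{ρ < 0}`, and the gradient of `ρ` does not vanish (so that `∂Ω ∩ U = {ρ = 0}`). -/
structure IsLocalDefiningFunction {n : ℕ} (Ω U : Set (EuclideanSpace ℝ (Fin n)))
    (ρ : EuclideanSpace ℝ (Fin n) → ℝ) : Prop where
  isOpen : IsOpen U
  contDiffOn : ContDiffOn ℝ 1 ρ U
  gradient_ne_zero : ∀ y ∈ U, gradient ρ y ≠ 0
  inter_eq : Ω ∩ U = {y ∈ U | ρ y < 0}

/-- `ν` is the inward unit normal `-Dρ / |Dρ|` to `∂Ω` at `x`. -/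
def IsInwardUnitNormal {n : ℕ} (Ω : Set (EuclideanSpace ℝ (Fin n)))
    (x ν : EuclideanSpace ℝ (Fin n)) : Prop :=
  ∃ U ρ, IsLocalDefiningFunction Ω U ρ ∧ x ∈ U ∧ ν = -(‖gradient ρ x‖⁻¹ • gradient ρ x)

/-- The second fundamental form of the level set of `ρ` through `x`, with respect to the normal
`-Dρ / |Dρ|`, evaluated on the pair `(τ, τ)` for a vector `τ` tangent to the level set.
Spheres have positive second fundamental form as boundaries of balls. -/
def secondFundamentalForm {n : ℕ} (ρ : EuclideanSpace ℝ (Fin n) → ℝ)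
    (x τ : EuclideanSpace ℝ (Fin n)) : ℝ :=
  fderiv ℝ (fderiv ℝ ρ) x τ τ / ‖gradient ρ x‖

/-- `Ω` is a bounded strictly convex domain of class `C^{2,β}`: it is nonempty, open, bounded and
convex, its boundary is locally the zero set of a `C^{2,β}` function with nonvanishing gradient
(`Ω` lying on one side), and all principal curvatures of the boundary are positive. -/
structure IsStrictlyConvexDomain {n : ℕ} (β : ℝ) (Ω : Set (EuclideanSpace ℝ (Fin n))) : Prop where
  isOpen : IsOpen Ω
  nonempty : Ω.Nonempty
  isBounded : Bornology.IsBounded Ω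
  convex : Convex ℝ Ω
  boundary : ∀ x ∈ frontier Ω, ∃ U ρ, IsLocalDefiningFunction Ω U ρ ∧ x ∈ U ∧
    IsCkHolderOn 2 β ρ U ∧
    ∀ τ, τ ≠ 0 → inner ℝ (gradient ρ x) τ = 0 → 0 < secondFundamentalForm ρ x τ

/-- The norm of `C²(∂Ω)`: the infimum of the `C²(closure Ω)` norms of the `C²` extensions of `φ`
from `∂Ω`. It is `⊤` if and only if `φ` has no such extension with finite norm; in particular
for a bounded domain of class `C²` a finite value means `φ ∈ C²(∂Ω)`. -/
def boundaryC2Norm {n : ℕ} (Ω : Set (EuclideanSpace ℝ (Fin n)))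
    (φ : EuclideanSpace ℝ (Fin n) → ℝ) : ℝ≥0∞ :=
  ⨅ (Φ : EuclideanSpace ℝ (Fin n) → ℝ) (_ : ContDiff ℝ 2 Φ) (_ : EqOn Φ φ (frontier Ω)),
    (⨆ x ∈ closure Ω, ‖Φ x‖ₑ) + (⨆ x ∈ closure Ω, ‖fderiv ℝ Φ x‖ₑ) +
      (⨆ x ∈ closure Ω, ‖iteratedFDeriv ℝ 2 Φ x‖ₑ)

/-- The conditions on the source term: `f ∈ C^{1,β}(closure Ω × ℝ)` for some `0 < β < 1`,
`f_z ≤ 0` and `|f| + |D_x f| ≤ L`. (By continuity, inequalities on `Ω × ℝ` extend to the closure.) -/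
structure IsAdmissibleSource {n : ℕ} (Ω : Set (EuclideanSpace ℝ (Fin n))) (L : ℝ)
    (f : EuclideanSpace ℝ (Fin n) → ℝ → ℝ) : Prop where
  regular : ∃ β ∈ Ioo (0 : ℝ) 1,
    IsCkHolderOn 1 β (fun w : EuclideanSpace ℝ (Fin n) × ℝ => f w.1 w.2) (closure Ω ×ˢ univ)
  deriv_nonpos : ∀ x ∈ Ω, ∀ z, deriv (f x) z ≤ 0
  bound : ∀ x ∈ Ω, ∀ z, |f x z| + ‖gradient (fun y => f y z) x‖ ≤ L

/-- The spatial gradient `Du(x,t)`, for `x` in the closure of `Ω`. -/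
def spatialGradient {n : ℕ} (Ω : Set (EuclideanSpace ℝ (Fin n)))
    (u : EuclideanSpace ℝ (Fin n) → ℝ → ℝ) (x : EuclideanSpace ℝ (Fin n)) (t : ℝ) :
    EuclideanSpace ℝ (Fin n) :=
  gradientWithin (fun y => u y t) (closure Ω) x

/-- The spatial Hessian `D²u(x,t)`, for `x` in the closure of `Ω`. -/
def spatialHessian {n : ℕ} (Ω : Set (EuclideanSpace ℝ (Fin n)))
    (u : EuclideanSpace ℝ (Fin n) → ℝ → ℝ) (x : EuclideanSpace ℝ (Fin n)) (t : ℝ) :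
    EuclideanSpace ℝ (Fin n) →L[ℝ] EuclideanSpace ℝ (Fin n) →L[ℝ] ℝ :=
  fderivWithin ℝ (fderivWithin ℝ (fun y => u y t) (closure Ω)) (closure Ω) x

/-- The time derivative `u_t(x,t)` for `t ≥ 0` (one-sided at `t = 0`). -/
def timeDeriv {n : ℕ} (u : EuclideanSpace ℝ (Fin n) → ℝ → ℝ)
    (x : EuclideanSpace ℝ (Fin n)) (t : ℝ) : ℝ :=
  derivWithin (u x) (Ici 0) t

/-- The parabolic class `C^{2,σ}(closure Ω × [0,∞))`: `u`, `Du`, `D²u`, `u_t` exist and are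
continuous up to the boundary and up to `t = 0`, and on every `closure Ω × [0,T]` the functions
`D²u`, `u_t` are Hölder with exponent `σ` in `x` and `σ/2` in `t`. -/
structure IsParabolicC2Holder {n : ℕ} (σ : ℝ) (Ω : Set (EuclideanSpace ℝ (Fin n)))
    (u : EuclideanSpace ℝ (Fin n) → ℝ → ℝ) : Prop where
  contDiffOn_space : ∀ t, 0 ≤ t → ContDiffOn ℝ 2 (fun x => u x t) (closure Ω)
  differentiableOn_time : ∀ x ∈ closure Ω, DifferentiableOn ℝ (u x) (Ici 0)
  continuousOn : ContinuousOn (fun w : EuclideanSpace ℝ (Fin n) × ℝ => u w.1 w.2)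
    (closure Ω ×ˢ Ici 0)
  continuousOn_gradient :
    ContinuousOn (fun w : EuclideanSpace ℝ (Fin n) × ℝ => spatialGradient Ω u w.1 w.2)
      (closure Ω ×ˢ Ici 0)
  holder_hessian : ∀ T : ℝ, ∃ M : ℝ, ∀ x ∈ closure Ω, ∀ y ∈ closure Ω,
    ∀ t ∈ Icc 0 T, ∀ s ∈ Icc 0 T,
      ‖spatialHessian Ω u x t - spatialHessian Ω u y s‖ ≤
        M * (‖x - y‖ ^ σ + |t - s| ^ (σ / 2))
  holder_time : ∀ T : ℝ, ∃ M : ℝ, ∀ x ∈ closure Ω, ∀ y ∈ closure Ω,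
    ∀ t ∈ Icc 0 T, ∀ s ∈ Icc 0 T,
      |timeDeriv u x t - timeDeriv u y s| ≤ M * (‖x - y‖ ^ σ + |t - s| ^ (σ / 2))

/-- The regularized norm `v(ξ) = √(ε² + |ξ|²)`. -/
def regNorm {n : ℕ} (ε : ℝ) (ξ : EuclideanSpace ℝ (Fin n)) : ℝ :=
  √(ε ^ 2 + ‖ξ‖ ^ 2)

/-- The divergence of a vector field on `ℝⁿ`. -/
def divergence {n : ℕ} (X : EuclideanSpace ℝ (Fin n) → EuclideanSpace ℝ (Fin n))
    (x : EuclideanSpace ℝ (Fin n)) : ℝ :=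
  ∑ i, fderiv ℝ X x (EuclideanSpace.single i 1) i

/-- `u` is a (classical, `C^{2,σ}` for some `0 < σ < 1`) solution of the regularized problem
`u_t = div (v^{p-2} Du) + f(x,u)` in `Ω × [0,∞)`, `u(x,0) = u₀(x)` in `Ω`,
`u_ν = -φ(x) v^{1-q}` on `∂Ω × [0,∞)`, where `v = √(ε² + |Du|²)`. -/
structure IsRegularizedSolution {n : ℕ} (Ω : Set (EuclideanSpace ℝ (Fin n))) (p q ε : ℝ)
    (f : EuclideanSpace ℝ (Fin n) → ℝ → ℝ) (φ u₀ : EuclideanSpace ℝ (Fin n) → ℝ)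
    (u : EuclideanSpace ℝ (Fin n) → ℝ → ℝ) : Prop where
  regular : ∃ σ ∈ Ioo (0 : ℝ) 1, IsParabolicC2Holder σ Ω u
  equation : ∀ x ∈ Ω, ∀ t, 0 ≤ t →
    timeDeriv u x t =
      divergence (fun y =>
        regNorm ε (spatialGradient Ω u y t) ^ (p - 2) • spatialGradient Ω u y t) x + f x (u x t)
  initial : ∀ x ∈ Ω, u x 0 = u₀ x
  boundary : ∀ x ∈ frontier Ω, ∀ ν, IsInwardUnitNormal Ω x ν → ∀ t, 0 ≤ t →
    inner ℝ (spatialGradient Ω u x t) ν = -φ x * regNorm ε (spatialGradient Ω u x t) ^ (1 - q)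

end

noncomputable section

open Filter Topology
open scoped NNReal RealInnerProductSpace

/-! ### Inward normals of convex domains. -/

section Geometry

/-! The gradient bound is a maximum principle for a function of two points. Put s = |y - x|, e = (y
- x)/s, τ = m^(-q), let D bound the diameter, and compare u(y,t) - u(x,t) with m ψ, where ψ = μ (s -
s²/(4D)) - τ ⟨W(z), y - x⟩ + τ |z - (x+y)/2|². Here W is a Lipschitz field equal to φν on the
boundary, and μ is fixed by (ε/m)² + μ² + τ²|W(z)|² = 1. Since ψ ≤ 2s when z is the midpoint, the
comparison bounds |Du| by 2m.

W is only Lipschitz, so it is evaluated at an independent point z over which one also maximises: ψ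
is then smooth in (x, y) off the diagonal for fixed z, and the quadratic penalty keeps z within O(s)
of the midpoint (`norm_sub_midpoint_le`).

If the comparison fails, subtract a small multiple of t and take a maximum over a compact set. It is
off the diagonal, where ψ ≥ 0, and at positive time, since ψ ≥ s/4 and m ≥ 4K. Two cases remain.

An endpoint on the boundary: after division by m the condition reads ⟨P, ν⟩ = -τφ v^(1-q). The W
term supplies exactly the normal component -τφ, and the normalisation of μ makes v = 1 up to O(⟨e,
ν⟩ + δ), where δ is the excess of ⟨P, ν⟩ over -τφ. Strict convexity gives ⟨e, ν⟩ ≥ c s, and this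
forces δ ≥ ⟨e, ν⟩/8, while the condition says δ = O(τ(⟨e, ν⟩ + δ)). For small τ this is absurd
(`exists_oblique_ne`).

Both points interior: the concave term -s²/(4D), seen through a reflection coupling of the two
Hessians, makes the difference of the rescaled elliptic terms at most a fixed -c₀, uniformly in s
(`exists_flux_sub_le`). Undoing the scaling multiplies this by m^(p-1), which beats the oscillation
2L of the source.

No threshold on m involves u, ε or T, except that m must dominate K. -/

theorem HasDerivAt.eventually_lt_of_neg {g : ℝ → ℝ} {a : ℝ} (hg : HasDerivAt g a 0) (ha : a < 0) :
    ∀ᶠ t in 𝓝[>] (0 : ℝ), g t < g 0 := by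
  have h1 : Tendsto (slope g 0) (𝓝[>] 0) (𝓝 a) :=
    hg.tendsto_slope.mono_left (nhdsWithin_mono _ fun t ht => ne_of_gt ht)
  filter_upwards [h1.eventually (gt_mem_nhds ha), self_mem_nhdsWithin] with t ht ht0
  have ht0' : (0 : ℝ) < t := ht0
  rw [slope_def_field, sub_zero, div_neg_iff] at ht
  rcases ht with h | h
  · linarith [h.2]
  · linarith [h.1]

variable {n : ℕ} {Ω U : Set (EuclideanSpace ℝ (Fin n))} {ρ : EuclideanSpace ℝ (Fin n) → ℝ}
  {x y ν ν' h : EuclideanSpace ℝ (Fin n)}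

theorem IsLocalDefiningFunction.hasGradientAt (hρ : IsLocalDefiningFunction Ω U ρ) (hx : x ∈ U) :
    HasGradientAt ρ (gradient ρ x) x :=
  ((hρ.contDiffOn.contDiffAt (hρ.isOpen.mem_nhds hx)).differentiableAt
    (by norm_num)).hasGradientAt

theorem IsLocalDefiningFunction.hasDerivAt_line (hρ : IsLocalDefiningFunction Ω U ρ) (hx : x ∈ U)
    (h : EuclideanSpace ℝ (Fin n)) :
    HasDerivAt (fun t : ℝ => ρ (x + t • h)) ⟪gradient ρ x, h⟫ 0 := by
  have h1 : HasDerivAt (fun t : ℝ => x + t • h) h 0 := by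
    simpa using ((hasDerivAt_id (0 : ℝ)).smul_const h).const_add x
  have h2 : HasFDerivAt ρ (InnerProductSpace.toDual ℝ _ (gradient ρ x)) (x + (0 : ℝ) • h) := by
    simpa using (hρ.hasGradientAt hx).hasFDerivAt
  have h3 := h2.comp_hasDerivAt (0 : ℝ) h1
  rw [InnerProductSpace.toDual_apply_apply] at h3
  exact h3

theorem IsLocalDefiningFunction.nonpos_of_mem_closure (hρ : IsLocalDefiningFunction Ω U ρ)
    (hxU : x ∈ U) (hx : x ∈ closure Ω) : ρ x ≤ 0 := by
  have h1 : x ∈ closure (Ω ∩ U) := by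
    rw [inter_comm]
    exact hρ.isOpen.inter_closure ⟨hxU, hx⟩
  rw [hρ.inter_eq] at h1
  have hc : ContinuousAt ρ x :=
    (hρ.contDiffOn.contDiffAt (hρ.isOpen.mem_nhds hxU)).continuousAt
  rw [mem_closure_iff_frequently] at h1
  by_contra! hpos
  obtain ⟨y, hy, hy'⟩ := (h1.and_eventually (hc.eventually (lt_mem_nhds hpos))).exists
  linarith [hy.2]

theorem IsLocalDefiningFunction.eq_zero_of_mem_frontier (hρ : IsLocalDefiningFunction Ω U ρ)
    (hΩ : IsOpen Ω) (hxU : x ∈ U) (hx : x ∈ frontier Ω) : ρ x = 0 := by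
  refine le_antisymm (hρ.nonpos_of_mem_closure hxU hx.1) ?_
  by_contra! hneg
  have : x ∈ Ω ∩ U := by rw [hρ.inter_eq]; exact ⟨hxU, hneg⟩
  exact hx.2 (by rw [hΩ.interior_eq]; exact this.1)

theorem IsLocalDefiningFunction.eventually_mem_nhdsGT (hρ : IsLocalDefiningFunction Ω U ρ)
    (hxU : x ∈ U) (h : EuclideanSpace ℝ (Fin n)) : ∀ᶠ t in 𝓝[>] (0 : ℝ), x + t • h ∈ U := by
  have hc : ContinuousAt (fun t : ℝ => x + t • h) 0 := by fun_prop
  exact (hc.eventually (by simpa using hρ.isOpen.mem_nhds hxU)).filter_mono nhdsWithin_le_nhds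

theorem IsLocalDefiningFunction.eventually_mem_of_inner_neg (hρ : IsLocalDefiningFunction Ω U ρ)
    (hΩ : IsOpen Ω) (hxU : x ∈ U) (hx : x ∈ frontier Ω) (hh : ⟪gradient ρ x, h⟫ < 0) :
    ∀ᶠ t in 𝓝[>] (0 : ℝ), x + t • h ∈ Ω := by
  filter_upwards [(hρ.hasDerivAt_line hxU h).eventually_lt_of_neg hh,
    hρ.eventually_mem_nhdsGT hxU h] with t ht htU
  have : x + t • h ∈ Ω ∩ U := by
    rw [hρ.inter_eq]
    refine ⟨htU, ?_⟩
    simpa [hρ.eq_zero_of_mem_frontier hΩ hxU hx] using ht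
  exact this.1

/-- If some y in Ω violated this, ρ would increase initially along the segment from x to y, although
convexity keeps that segment inside Ω, where ρ < 0. -/
theorem IsLocalDefiningFunction.inner_gradient_nonpos (hρ : IsLocalDefiningFunction Ω U ρ)
    (hΩ : IsOpen Ω) (hc : Convex ℝ Ω) (hxU : x ∈ U) (hx : x ∈ frontier Ω) (hy : y ∈ closure Ω) :
    ⟪gradient ρ x, y - x⟫ ≤ 0 := by
  have key : ∀ y ∈ Ω, ⟪gradient ρ x, y - x⟫ ≤ 0 := by
    intro y hy
    by_contra! hpos
    have hd := (hρ.hasDerivAt_line hxU (y - x)).neg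
    have h1 := hd.eventually_lt_of_neg (by linarith)
    have h2 : ∀ᶠ t in 𝓝[>] (0 : ℝ), t < 1 :=
      (gt_mem_nhds (zero_lt_one' ℝ)).filter_mono nhdsWithin_le_nhds
    obtain ⟨t, ht, htU, ht1, ht0⟩ := (h1.and ((hρ.eventually_mem_nhdsGT hxU (y - x)).and
      (h2.and self_mem_nhdsWithin))).exists
    have ht0' : (0 : ℝ) < t := ht0
    have h3 : x + t • (y - x) ∈ interior Ω :=
      hc.openSegment_closure_interior_subset_interior hx.1 (by rwa [hΩ.interior_eq])
        ⟨1 - t, t, by linarith, ht0', by ring, by module⟩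
    rw [hΩ.interior_eq] at h3
    have h4 : x + t • (y - x) ∈ Ω ∩ U := ⟨h3, htU⟩
    rw [hρ.inter_eq] at h4
    have h5 := h4.2
    simp only [Pi.neg_apply, zero_smul, add_zero, hρ.eq_zero_of_mem_frontier hΩ hxU hx] at ht
    linarith
  have hcl : IsClosed {y : EuclideanSpace ℝ (Fin n) | ⟪gradient ρ x, y - x⟫ ≤ 0} :=
    isClosed_le (by fun_prop) continuous_const
  exact closure_minimal (fun z hz => key z hz) hcl hy

theorem IsLocalDefiningFunction.isInwardUnitNormal (hρ : IsLocalDefiningFunction Ω U ρ)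
    (hxU : x ∈ U) : IsInwardUnitNormal Ω x (-(‖gradient ρ x‖⁻¹ • gradient ρ x)) :=
  ⟨U, ρ, hρ, hxU, rfl⟩

theorem IsInwardUnitNormal.norm_eq_one (hν : IsInwardUnitNormal Ω x ν) : ‖ν‖ = 1 := by
  obtain ⟨U, ρ, hρ, hxU, rfl⟩ := hν
  have h0 : ‖gradient ρ x‖ ≠ 0 := norm_ne_zero_iff.2 (hρ.gradient_ne_zero x hxU)
  rw [norm_neg, norm_smul, norm_inv, norm_norm, inv_mul_cancel₀ h0]

theorem IsInwardUnitNormal.inner_nonneg (hν : IsInwardUnitNormal Ω x ν)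
    (hΩ : IsOpen Ω) (hc : Convex ℝ Ω) (hx : x ∈ frontier Ω) (hy : y ∈ closure Ω) :
    0 ≤ ⟪ν, y - x⟫ := by
  obtain ⟨U, ρ, hρ, hxU, rfl⟩ := hν
  have := hρ.inner_gradient_nonpos hΩ hc hxU hx hy
  rw [inner_neg_left, real_inner_smul_left, neg_nonneg]
  exact mul_nonpos_of_nonneg_of_nonpos (by positivity) this

/-- The inward normal cone of `Ω` at a regular boundary point is the ray spanned by the normal. -/
theorem IsInwardUnitNormal.eq_smul_of_forall_inner_nonneg (hν : IsInwardUnitNormal Ω x ν)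
    (hΩ : IsOpen Ω) (hx : x ∈ frontier Ω) {ζ : EuclideanSpace ℝ (Fin n)}
    (hζ : ∀ y ∈ closure Ω, 0 ≤ ⟪ζ, y - x⟫) : ∃ r : ℝ, 0 ≤ r ∧ ζ = r • ν := by
  have hn := hν.norm_eq_one
  have hnn : ⟪ν, ν⟫ = (1 : ℝ) := by rw [real_inner_self_eq_norm_sq, hn]; norm_num
  -- Every direction in the open half-space of ν enters Ω.
  have key : ∀ h, 0 < ⟪ν, h⟫ → 0 ≤ ⟪ζ, h⟫ := by
    intro h hh
    obtain ⟨U, ρ, hρ, hxU, rfl⟩ := hν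
    have h0 : 0 < ‖gradient ρ x‖ := norm_pos_iff.2 (hρ.gradient_ne_zero x hxU)
    rw [inner_neg_left, real_inner_smul_left] at hh
    have h1 : ⟪gradient ρ x, h⟫ < 0 := by
      by_contra! h2
      have := mul_nonneg (inv_nonneg.2 h0.le) h2
      linarith
    obtain ⟨t, ht, ht0⟩ :=
      ((hρ.eventually_mem_of_inner_neg hΩ hxU hx h1).and self_mem_nhdsWithin).exists
    have h3 := hζ _ (subset_closure ht)
    rw [add_sub_cancel_left, real_inner_smul_right] at h3
    exact nonneg_of_mul_nonneg_right h3 ht0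
  have h1 : 0 ≤ ⟪ζ, ν⟫ := key ν (by rw [hnn]; norm_num)
  refine ⟨⟪ζ, ν⟫, h1, ?_⟩
  set τ := ζ - (⟪ζ, ν⟫ : ℝ) • ν with hτ
  have h2 : ⟪ν, τ⟫ = (0 : ℝ) := by
    rw [hτ, inner_sub_right, real_inner_smul_right, hnn, real_inner_comm]; ring
  have h3 : ⟪ζ, τ⟫ = ‖τ‖ ^ 2 := by
    have : ζ = τ + (⟪ζ, ν⟫ : ℝ) • ν := by rw [hτ]; abel
    nth_rewrite 1 [this]
    rw [inner_add_left, real_inner_smul_left, h2, real_inner_self_eq_norm_sq]; ring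
  -- The directions kτ + ν stay in the half-space for every k; a very negative k forces the
  -- tangential part τ of ζ to vanish.
  have h4 : ∀ k : ℝ, 0 ≤ k * ‖τ‖ ^ 2 + ⟪ζ, ν⟫ := by
    intro k
    have := key (k • τ + ν) (by
      rw [inner_add_right, real_inner_smul_right, h2, hnn]; norm_num)
    rwa [inner_add_right, real_inner_smul_right, h3] at this
  by_contra hne
  have h5 : 0 < ‖τ‖ ^ 2 := by
    have : τ ≠ 0 := fun h0 => hne (by rw [hτ, sub_eq_zero] at h0; exact h0)
    positivity
  have h6 := h4 (-(⟪ζ, ν⟫ + 1) / ‖τ‖ ^ 2)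
  rw [div_mul_cancel₀ _ h5.ne'] at h6
  linarith

/-- By convexity each normal lies in the normal cone, which is a ray spanned by the other. Hence the
normal does not depend on the defining function. -/
theorem IsInwardUnitNormal.unique (hν : IsInwardUnitNormal Ω x ν) (hν' : IsInwardUnitNormal Ω x ν')
    (hΩ : IsOpen Ω) (hc : Convex ℝ Ω) (hx : x ∈ frontier Ω) : ν = ν' := by
  obtain ⟨r, hr, hrν⟩ := hν'.eq_smul_of_forall_inner_nonneg hΩ hx
    (fun y hy => hν.inner_nonneg hΩ hc hx hy)
  have h1 := hν.norm_eq_one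
  rw [hrν, norm_smul, hν'.norm_eq_one, mul_one, Real.norm_of_nonneg hr] at h1
  rw [hrν, h1, one_smul]

end Geometry

/-! ### Quantitative strict convexity and a Lipschitz normal field. -/

section StrictConvexity

/-- A quadratic form which is positive on the kernel of a linear form becomes uniformly positive
after adding a large multiple of the square of the linear form. -/
theorem exists_quadratic_lower_bound {E : Type*} [NormedAddCommGroup E] [NormedSpace ℝ E]
    [FiniteDimensional ℝ E] (B : E →L[ℝ] E →L[ℝ] ℝ) (G : E →L[ℝ] ℝ)
    (hB : ∀ τ, τ ≠ 0 → G τ = 0 → 0 < B τ τ) :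
    ∃ c K : ℝ, 0 < c ∧ 0 ≤ K ∧ ∀ d, c * ‖d‖ ^ 2 ≤ B d d + K * G d ^ 2 := by
  have hS : IsCompact (Metric.sphere (0 : E) 1) := isCompact_sphere 0 1
  have hcont : ∀ K : ℝ, Continuous fun d : E => B d d + K * G d ^ 2 := fun K => by fun_prop
  -- These open sets increase with k and cover the unit sphere, so by compactness one of them
  -- contains it.
  obtain ⟨k, hk⟩ := hS.elim_directed_cover (fun k : ℕ => {d : E | 0 < B d d + k * G d ^ 2})
    (fun k => isOpen_lt continuous_const (hcont k)) (by
      intro d hd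
      rw [mem_iUnion]
      have hd0 : d ≠ 0 := by
        rintro rfl
        simp at hd
      by_cases hG : G d = 0
      · exact ⟨0, by simpa using hB d hd0 hG⟩
      · have hG2 : 0 < G d ^ 2 := by positivity
        obtain ⟨k, hk⟩ := exists_nat_gt (-(B d d) / G d ^ 2)
        refine ⟨k, ?_⟩
        rw [div_lt_iff₀ hG2] at hk
        simp only [mem_ofPred_eq]
        linarith) (by
      refine directed_of_isDirected_le fun i j hij d hd => ?_
      simp only [mem_ofPred_eq] at hd ⊢
      have : (i : ℝ) ≤ j := by exact_mod_cast hij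
      nlinarith [sq_nonneg (G d)])
  have hmin : ∃ c : ℝ, 0 < c ∧ ∀ d ∈ Metric.sphere (0 : E) 1, c ≤ B d d + k * G d ^ 2 := by
    rcases (Metric.sphere (0 : E) 1).eq_empty_or_nonempty with he | hne
    · exact ⟨1, one_pos, by simp [he]⟩
    · obtain ⟨d, hd, hdm⟩ := hS.exists_isMinOn hne (hcont k).continuousOn
      exact ⟨_, hk hd, fun d' hd' => hdm hd'⟩
  obtain ⟨c, hc, hcd⟩ := hmin
  refine ⟨c, k, hc, Nat.cast_nonneg _, fun d => ?_⟩
  by_cases hd : d = 0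
  · simp [hd]
  have hn : 0 < ‖d‖ := norm_pos_iff.2 hd
  have h1 := hcd (‖d‖⁻¹ • d) (by simp [norm_smul, hn.ne'])
  simp only [map_smul, smul_apply, smul_eq_mul] at h1
  have h2 := mul_le_mul_of_nonneg_left h1 (sq_nonneg ‖d‖)
  have h3 : ‖d‖ ^ 2 * (‖d‖⁻¹ * (‖d‖⁻¹ * B d d) + k * (‖d‖⁻¹ * G d) ^ 2)
      = B d d + k * G d ^ 2 := by
    field_simp
  linarith

theorem abs_taylor_two_le {g g' : ℝ → ℝ} {A b C : ℝ}
    (hg : ∀ s ∈ Icc (0 : ℝ) 1, HasDerivAt g (g' s) s)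
    (hC : ∀ s ∈ Icc (0 : ℝ) 1, |g' s - A - s * b| ≤ C) : |g 1 - g 0 - A - b / 2| ≤ C := by
  have hder : ∀ s ∈ Icc (0 : ℝ) 1, HasDerivWithinAt (fun s => g s - s * A - s ^ 2 * (b / 2))
      (g' s - A - s * b) (Icc 0 1) s := by
    intro s hs
    have e2 : HasDerivAt (fun s : ℝ => s * A) (1 * A) s := (hasDerivAt_id' s).mul_const A
    have e3 : HasDerivAt (fun s : ℝ => s ^ 2 * (b / 2)) (2 * s * (b / 2)) s := by
      simpa using (hasDerivAt_pow 2 s).mul_const (b / 2)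
    exact ((((hg s hs).sub e2).sub e3).congr_deriv (by ring)).hasDerivWithinAt
  have := norm_image_sub_le_of_norm_deriv_le_segment_01' hder
    (fun s hs => by rw [Real.norm_eq_abs]; exact hC s ⟨hs.1, hs.2.le⟩)
  rw [Real.norm_eq_abs] at this
  refine le_trans (le_of_eq ?_) this
  congr 1
  ring

/-- The Hessian is frozen at x₀ while both endpoints vary; strict differentiability of Dρ at x₀
makes the error uniform. -/
theorem ContDiffAt.eventually_taylor_two {E : Type*} [NormedAddCommGroup E] [NormedSpace ℝ E]
    {ρ : E → ℝ} {x₀ : E} (hρ : ContDiffAt ℝ 2 ρ x₀) {η : ℝ} (hη : 0 < η) :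
    ∃ r > 0, ∀ x ∈ Metric.ball x₀ r, ∀ y ∈ Metric.ball x₀ r,
      |ρ y - ρ x - fderiv ℝ ρ x (y - x)
        - fderiv ℝ (fderiv ℝ ρ) x₀ (y - x) (y - x) / 2| ≤ η * ‖y - x‖ ^ 2 := by
  have h1 : ContDiffAt ℝ 1 (fderiv ℝ ρ) x₀ := hρ.fderiv_right (by norm_num)
  have h2 : HasStrictFDerivAt (fderiv ℝ ρ) (fderiv ℝ (fderiv ℝ ρ) x₀) x₀ :=
    h1.hasStrictFDerivAt (by norm_num)
  generalize fderiv ℝ (fderiv ℝ ρ) x₀ = B at h2 ⊢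
  have h3 := h2.isLittleO.bound hη
  have h4 : ∀ᶠ x in 𝓝 x₀, ContDiffAt ℝ 2 ρ x := hρ.eventually (by norm_num)
  rw [nhds_prod_eq, eventually_prod_iff] at h3
  obtain ⟨pa, ha, pb, hb, h3⟩ := h3
  obtain ⟨r, hr, hrt⟩ := Metric.eventually_nhds_iff_ball.1 ((ha.and hb).and h4)
  refine ⟨r, hr, fun x hx y hy => ?_⟩
  obtain ⟨h, rfl⟩ : ∃ h, y = x + h := ⟨y - x, by abel⟩
  rw [add_sub_cancel_left]
  have hseg : ∀ s ∈ Icc (0 : ℝ) 1, x + s • h ∈ Metric.ball x₀ r := fun s hs => by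
    simpa using (convex_ball x₀ r).add_smul_sub_mem hx hy hs
  have hder : ∀ s ∈ Icc (0 : ℝ) 1, HasDerivAt (fun s : ℝ => ρ (x + s • h))
      (fderiv ℝ ρ (x + s • h) h) s := by
    intro s hs
    have hd : HasDerivAt (fun s : ℝ => x + s • h) h s := by
      simpa using ((hasDerivAt_id s).smul_const h).const_add x
    have hρs := ((hrt _ (hseg s hs)).2.differentiableAt (by norm_num)).hasFDerivAt
    exact hρs.comp_hasDerivAt s hd
  have hbd : ∀ s ∈ Icc (0 : ℝ) 1,
      |fderiv ℝ ρ (x + s • h) h - fderiv ℝ ρ x h - s * B h h| ≤ η * ‖h‖ ^ 2 := by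
    intro s hs
    have e := h3 (hrt _ (hseg s hs)).1.1 (hrt x hx).1.2
    rw [add_sub_cancel_left] at e
    have e1 := (fderiv ℝ ρ (x + s • h) - fderiv ℝ ρ x - B (s • h)).le_of_opNorm_le e h
    have e2 : (fderiv ℝ ρ (x + s • h) - fderiv ℝ ρ x - B (s • h)) h
        = fderiv ℝ ρ (x + s • h) h - fderiv ℝ ρ x h - s * B h h := by
      rw [map_smul]; rfl
    rw [e2, Real.norm_eq_abs, norm_smul, Real.norm_of_nonneg hs.1] at e1
    refine e1.trans ?_
    have : η * (s * ‖h‖) * ‖h‖ = s * (η * ‖h‖ ^ 2) := by ring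
    rw [this]
    exact mul_le_of_le_one_left (by positivity) hs.2
  simpa only [one_smul, zero_smul, add_zero] using abs_taylor_two_le hder hbd

variable {n : ℕ} {β : ℝ} {Ω : Set (EuclideanSpace ℝ (Fin n))}

theorem fderiv_apply_eq_inner_gradient {ρ : EuclideanSpace ℝ (Fin n) → ℝ}
    (x h : EuclideanSpace ℝ (Fin n)) : fderiv ℝ ρ x h = ⟪gradient ρ x, h⟫ := by
  rw [gradient, InnerProductSpace.toDual_symm_apply]

theorem norm_gradient_eq {ρ : EuclideanSpace ℝ (Fin n) → ℝ}
    (x : EuclideanSpace ℝ (Fin n)) : ‖gradient ρ x‖ = ‖fderiv ℝ ρ x‖ := by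
  rw [gradient, LinearIsometryEquiv.norm_map]

/-- Algebra for local strict convexity, with N = |h|, a = -Dρ(x)h, g = Dρ(x₀)h and b = D²ρ(x₀)(h,h).
On a small ball Ka ≤ 1/2, so the quadratic term K a² is absorbed by a itself. -/
theorem quadratic_absorption {c K C r N a δ g b : ℝ} (hK : 0 ≤ K) (hC : 0 < C)
    (hN : 0 ≤ N) (ha : 0 ≤ a) (hr : r * (4 * (K + 1) * C) ≤ 1) (hNr : N < 2 * r) (haC : a ≤ C * N)
    (hδ : K * δ ^ 2 ≤ c / 16) (hg : g ^ 2 ≤ 2 * a ^ 2 + 2 * (δ * N) ^ 2)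
    (hb : c * N ^ 2 ≤ b + K * g ^ 2) (hT : b / 2 ≤ a + c / 8 * N ^ 2) : c / 16 * N ^ 2 ≤ a := by
  have h1 : K * g ^ 2 ≤ K * (2 * a ^ 2 + 2 * (δ * N) ^ 2) := mul_le_mul_of_nonneg_left hg hK
  have h2 : K * δ ^ 2 * N ^ 2 ≤ c / 16 * N ^ 2 := mul_le_mul_of_nonneg_right hδ (sq_nonneg _)
  have h3 : K * a ≤ 1 / 2 := by
    have e1 : K * a ≤ K * (C * N) := mul_le_mul_of_nonneg_left haC hK
    have e2 : K * (C * N) ≤ K * (C * (2 * r)) := by gcongr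
    have e3 : 0 ≤ r * C := mul_nonneg (by linarith) hC.le
    have e4 : r * (4 * (K + 1) * C) = 2 * (K * (C * (2 * r))) + 4 * (r * C) := by ring
    linarith
  have h4 : K * a ^ 2 ≤ a / 2 := by
    have : K * a * a ≤ 1 / 2 * a := mul_le_mul_of_nonneg_right h3 ha
    linarith [show K * a ^ 2 = K * a * a by ring]
  have h5 : K * (2 * a ^ 2 + 2 * (δ * N) ^ 2) = 2 * (K * a ^ 2) + 2 * (K * δ ^ 2 * N ^ 2) := by ring
  have h6 : 0 ≤ N ^ 2 := sq_nonneg N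
  linarith

/-- Since ρ(y) ≤ 0 = ρ(x), Taylor expansion bounds -Dρ(x)h below by half the Hessian term, up to a
small error. The Hessian is positive only on tangent vectors; the normal component of h that spoils
this is controlled by -Dρ(x)h again. -/
theorem IsStrictlyConvexDomain.exists_local_inner_normal_ge (hΩ : IsStrictlyConvexDomain β Ω)
    {x₀ : EuclideanSpace ℝ (Fin n)} (hx₀ : x₀ ∈ frontier Ω) :
    ∃ r > 0, ∃ c > 0, ∀ x ∈ frontier Ω ∩ Metric.ball x₀ r, ∀ ν, IsInwardUnitNormal Ω x ν →
      ∀ y ∈ closure Ω ∩ Metric.ball x₀ r, c * ‖y - x‖ ^ 2 ≤ ⟪ν, y - x⟫ := by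
  obtain ⟨U, ρ, hρ, hxU, hC2, hpos⟩ := hΩ.boundary x₀ hx₀
  have hρ2 : ContDiffAt ℝ 2 ρ x₀ := hC2.1.contDiffAt (hρ.isOpen.mem_nhds hxU)
  have hg0 : 0 < ‖gradient ρ x₀‖ := norm_pos_iff.2 (hρ.gradient_ne_zero x₀ hxU)
  obtain ⟨c, K, hc, hK, hQ⟩ := exists_quadratic_lower_bound (fderiv ℝ (fderiv ℝ ρ) x₀)
    (fderiv ℝ ρ x₀) (fun τ hτ h0 => by
      have := hpos τ hτ (by rwa [fderiv_apply_eq_inner_gradient] at h0)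
      rw [secondFundamentalForm] at this
      exact (div_pos_iff_of_pos_right hg0).1 this)
  obtain ⟨r₁, hr₁, hT⟩ := hρ2.eventually_taylor_two (η := c / 8) (by positivity)
  set δ := min 1 (c / (16 * (K + 1))) with hδ
  have hδ0 : 0 < δ := by positivity
  have hδ1 : δ ≤ 1 := min_le_left _ _
  have hδ2 : K * δ ^ 2 ≤ c / 16 := by
    have h1 : δ * (16 * (K + 1)) ≤ c := by
      rw [← le_div_iff₀ (by positivity)]; exact min_le_right _ _
    nlinarith [mul_nonneg hK hδ0.le]
  have hcont : ContinuousAt (fderiv ℝ ρ) x₀ :=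
    (hρ2.fderiv_right (m := 1) (by norm_num)).continuousAt
  obtain ⟨r₂, hr₂, hG⟩ := Metric.mem_nhds_iff.1
    (hcont.preimage_mem_nhds (Metric.closedBall_mem_nhds _ hδ0))
  obtain ⟨r₃, hr₃, hU⟩ := Metric.mem_nhds_iff.1 (hρ.isOpen.mem_nhds hxU)
  set C := ‖fderiv ℝ ρ x₀‖ + 1 with hC
  have hC0 : 0 < C := by positivity
  set r := min (min r₁ r₂) (min r₃ (1 / (4 * (K + 1) * C))) with hr
  have hrpos : 0 < r := by positivity
  have hr1 : r ≤ r₁ := (min_le_left _ _).trans (min_le_left _ _)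
  have hr2 : r ≤ r₂ := (min_le_left _ _).trans (min_le_right _ _)
  have hr3 : r ≤ r₃ := (min_le_right _ _).trans (min_le_left _ _)
  have hr4 : r * (4 * (K + 1) * C) ≤ 1 := by
    rw [← le_div_iff₀ (by positivity)]
    exact (min_le_right _ _).trans (min_le_right _ _)
  refine ⟨r, hrpos, c / (16 * C), by positivity, ?_⟩
  rintro x ⟨hxf, hxb⟩ ν hν y ⟨hyc, hyb⟩
  have hxU' : x ∈ U := hU (Metric.ball_subset_ball hr3 hxb)
  have hyU' : y ∈ U := hU (Metric.ball_subset_ball hr3 hyb)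
  have hνeq := hν.unique (hρ.isInwardUnitNormal hxU') hΩ.isOpen hΩ.convex hxf
  have hgx : 0 < ‖gradient ρ x‖ := norm_pos_iff.2 (hρ.gradient_ne_zero x hxU')
  have hinner := hρ.inner_gradient_nonpos hΩ.isOpen hΩ.convex hxU' hxf hyc
  rw [hνeq, inner_neg_left, real_inner_smul_left]
  set h := y - x with hh
  have hn : ‖h‖ < 2 * r := by
    have h1 : dist y x ≤ dist y x₀ + dist x x₀ := dist_triangle_right _ _ _
    rw [dist_eq_norm] at h1
    linarith [Metric.mem_ball.1 hxb, Metric.mem_ball.1 hyb]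
  have hdG : ‖fderiv ℝ ρ x - fderiv ℝ ρ x₀‖ ≤ δ := by
    have := hG (Metric.ball_subset_ball hr2 hxb)
    rwa [mem_preimage, Metric.mem_closedBall, dist_eq_norm] at this
  have hGx : ‖fderiv ℝ ρ x‖ ≤ C := by
    have := norm_le_norm_add_norm_sub' (fderiv ℝ ρ x) (fderiv ℝ ρ x₀)
    linarith
  have hTxy := hT x (Metric.ball_subset_ball hr1 hxb) y (Metric.ball_subset_ball hr1 hyb)
  rw [hρ.eq_zero_of_mem_frontier hΩ.isOpen hxU' hxf, ← hh] at hTxy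
  have hy0 := hρ.nonpos_of_mem_closure hyU' hyc
  have hQh := hQ h
  set a := -fderiv ℝ ρ x h with ha
  have ha0 : 0 ≤ a := by rw [ha, fderiv_apply_eq_inner_gradient]; linarith
  have haC : a ≤ C * ‖h‖ := by
    have h1 := (fderiv ℝ ρ x).le_opNorm h
    rw [Real.norm_eq_abs] at h1
    have h2 := neg_le_abs (fderiv ℝ ρ x h)
    nlinarith [norm_nonneg h]
  have hGh : fderiv ℝ ρ x₀ h ^ 2 ≤ 2 * a ^ 2 + 2 * (δ * ‖h‖) ^ 2 := by
    have h1 := (fderiv ℝ ρ x - fderiv ℝ ρ x₀).le_opNorm h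
    rw [sub_apply, Real.norm_eq_abs] at h1
    have h2 : |fderiv ℝ ρ x h - fderiv ℝ ρ x₀ h| ≤ δ * ‖h‖ :=
      h1.trans (mul_le_mul_of_nonneg_right hdG (norm_nonneg h))
    have h3 := sq_le_sq' (by linarith [abs_le.1 h2]) (abs_le.1 h2).2
    have h4 : fderiv ℝ ρ x h = -a := by rw [ha]; ring
    rw [h4] at h3
    nlinarith [sq_nonneg (2 * a + fderiv ℝ ρ x₀ h)]
  have hfin : c / 16 * ‖h‖ ^ 2 ≤ a :=
    quadratic_absorption hK hC0 (norm_nonneg h) ha0 hr4 hn haC hδ2 hGh hQh (by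
      have hT2 := (abs_le.1 hTxy).1
      linarith)
  have e1 : -(‖gradient ρ x‖⁻¹ * ⟪gradient ρ x, h⟫) = a / ‖gradient ρ x‖ := by
    rw [ha, fderiv_apply_eq_inner_gradient]; ring
  rw [e1, le_div_iff₀ hgx, norm_gradient_eq]
  calc c / (16 * C) * ‖h‖ ^ 2 * ‖fderiv ℝ ρ x‖ ≤ c / (16 * C) * ‖h‖ ^ 2 * C := by gcongr
    _ = c / 16 * ‖h‖ ^ 2 := by field_simp
    _ ≤ a := hfin

theorem IsStrictlyConvexDomain.isCompact_closure (hΩ : IsStrictlyConvexDomain β Ω) :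
    IsCompact (closure Ω) := hΩ.isBounded.isCompact_closure

theorem IsStrictlyConvexDomain.isCompact_frontier (hΩ : IsStrictlyConvexDomain β Ω) :
    IsCompact (frontier Ω) :=
  hΩ.isCompact_closure.of_isClosed_subset isClosed_frontier frontier_subset_closure

/-- Quantitative strict convexity. -/
theorem IsStrictlyConvexDomain.exists_inner_normal_ge (hΩ : IsStrictlyConvexDomain β Ω) :
    ∃ c > 0, ∀ x ∈ frontier Ω, ∀ ν, IsInwardUnitNormal Ω x ν →
      ∀ y ∈ closure Ω, c * ‖y - x‖ ^ 2 ≤ ⟪ν, y - x⟫ := by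
  obtain ⟨D, hD0, hD⟩ : ∃ D > 0, ∀ x ∈ closure Ω, ∀ y ∈ closure Ω, ‖y - x‖ ≤ D := by
    obtain ⟨D, hD⟩ := Metric.isBounded_iff.1 hΩ.isCompact_closure.isBounded
    refine ⟨max D 1, by positivity, fun x hx y hy => ?_⟩
    rw [← dist_eq_norm]
    exact (hD hy hx).trans (le_max_left _ _)
  have hind : ∃ c > 0, ∀ x ∈ frontier Ω, x ∈ frontier Ω → ∀ ν, IsInwardUnitNormal Ω x ν →
      ∀ y ∈ closure Ω, c * ‖y - x‖ ^ 2 ≤ ⟪ν, y - x⟫ := by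
    refine hΩ.isCompact_frontier.induction_on (p := fun s => ∃ c > 0, ∀ x ∈ s, x ∈ frontier Ω →
      ∀ ν, IsInwardUnitNormal Ω x ν → ∀ y ∈ closure Ω, c * ‖y - x‖ ^ 2 ≤ ⟪ν, y - x⟫)
      ⟨1, one_pos, by simp⟩ ?_ ?_ ?_
    · rintro s t hst ⟨c, hc, h⟩
      exact ⟨c, hc, fun x hx => h x (hst hx)⟩
    · rintro s t ⟨c, hc, h⟩ ⟨c', hc', h'⟩
      refine ⟨min c c', by positivity, ?_⟩
      rintro x (hx | hx) hxf ν hν y hy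
      · exact le_trans (by gcongr; exact min_le_left _ _) (h x hx hxf ν hν y hy)
      · exact le_trans (by gcongr; exact min_le_right _ _) (h' x hx hxf ν hν y hy)
    · intro x₀ hx₀
      obtain ⟨r, hr, c, hc, hloc⟩ := hΩ.exists_local_inner_normal_ge hx₀
      refine ⟨Metric.ball x₀ (r / 2),
        mem_nhdsWithin_of_mem_nhds (Metric.ball_mem_nhds _ (by positivity)),
        c * min 1 (r / (4 * D)), by positivity, ?_⟩
      intro x hx hxf ν hν y hy
      -- A distant y is contracted towards x into the local ball. The right side scales by t and the
      -- left by t², which costs one factor t in the constant.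
      set t := min 1 (r / (4 * D)) with ht
      have ht0 : 0 < t := by positivity
      have ht1 : t ≤ 1 := min_le_left _ _
      have ht2 : t * (4 * D) ≤ r := by
        rw [← le_div_iff₀ (by positivity)]; exact min_le_right _ _
      have hh := hD x hxf.1 y hy
      have hmem : x + t • (y - x) ∈ closure Ω :=
        hΩ.convex.closure.add_smul_sub_mem hxf.1 hy ⟨ht0.le, ht1⟩
      have hball : x + t • (y - x) ∈ Metric.ball x₀ r := by
        rw [Metric.mem_ball]
        have h1 : dist (x + t • (y - x)) x ≤ r / 4 := by
          rw [dist_eq_norm, add_sub_cancel_left, norm_smul, Real.norm_of_nonneg ht0.le]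
          nlinarith
        have h2 := dist_triangle (x + t • (y - x)) x x₀
        linarith [Metric.mem_ball.1 hx]
      have key := hloc x ⟨hxf, Metric.ball_subset_ball (by linarith) hx⟩ ν hν _ ⟨hmem, hball⟩
      rw [add_sub_cancel_left, norm_smul, real_inner_smul_right, Real.norm_of_nonneg ht0.le] at key
      have : t * (c * t * ‖y - x‖ ^ 2) ≤ t * ⟪ν, y - x⟫ := by linarith
      exact le_of_mul_le_mul_left this ht0
  obtain ⟨c, hc, h⟩ := hind
  exact ⟨c, hc, fun x hx => h x hx hx⟩

/-- The inward unit normal of a strictly convex domain has a Lipschitz extension. -/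
theorem IsStrictlyConvexDomain.exists_lipschitz_normal (hΩ : IsStrictlyConvexDomain β Ω) :
    ∃ (K : ℝ≥0) (N : EuclideanSpace ℝ (Fin n) → EuclideanSpace ℝ (Fin n)),
      LipschitzWith K N ∧ ∀ x ∈ frontier Ω, IsInwardUnitNormal Ω x (N x) := by
  have hex : ∀ x : EuclideanSpace ℝ (Fin n), ∃ ν, x ∈ frontier Ω → IsInwardUnitNormal Ω x ν := by
    intro x
    by_cases hx : x ∈ frontier Ω
    · obtain ⟨U, ρ, hρ, hxU, -, -⟩ := hΩ.boundary x hx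
      exact ⟨_, fun _ => hρ.isInwardUnitNormal hxU⟩
    · exact ⟨0, fun h => absurd h hx⟩
  choose ν hν using hex
  -- By uniqueness the chosen normal coincides near x₀ with the C¹ field -Dρ/|Dρ| of a single
  -- defining function.
  have hloc : LocallyLipschitzOn (frontier Ω) ν := by
    intro x₀ hx₀
    obtain ⟨U, ρ, hρ, hxU, hC2, -⟩ := hΩ.boundary x₀ hx₀
    have hρ2 : ContDiffAt ℝ 2 ρ x₀ := hC2.1.contDiffAt (hρ.isOpen.mem_nhds hxU)
    have hf : ContDiffAt ℝ 1 (fderiv ℝ ρ) x₀ := hρ2.fderiv_right (by norm_num)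
    have hg : ContDiffAt ℝ 1 (gradient ρ) x₀ :=
      ((InnerProductSpace.toDual ℝ
        (EuclideanSpace ℝ (Fin n))).symm.contDiff.contDiffAt).comp x₀ hf
    have hg0 : gradient ρ x₀ ≠ 0 := hρ.gradient_ne_zero x₀ hxU
    have hN : ContDiffAt ℝ 1 (fun x => -(‖gradient ρ x‖⁻¹ • gradient ρ x)) x₀ :=
      (((hg.norm ℝ hg0).inv (norm_ne_zero_iff.2 hg0)).smul hg).neg
    obtain ⟨K, t, ht, hK⟩ := hN.exists_lipschitzOnWith
    refine ⟨K, frontier Ω ∩ (t ∩ U), inter_mem self_mem_nhdsWithin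
      (mem_nhdsWithin_of_mem_nhds (inter_mem ht (hρ.isOpen.mem_nhds hxU))), ?_⟩
    intro x hx y hy
    have e : ∀ z ∈ frontier Ω ∩ (t ∩ U), ν z = -(‖gradient ρ z‖⁻¹ • gradient ρ z) := fun z hz =>
      (hν z hz.1).unique (hρ.isInwardUnitNormal hz.2.2) hΩ.isOpen hΩ.convex hz.1
    rw [e x hx, e y hy]
    exact hK hx.2.1 hy.2.1
  obtain ⟨K, hK⟩ := hloc.exists_lipschitzOnWith_of_compact hΩ.isCompact_frontier
  obtain ⟨N, hN, hNe⟩ := hK.extend_finite_dimension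
  exact ⟨_, N, hN, fun x hx => hNe hx ▸ hν x hx⟩

end StrictConvexity

/-! ### Powers on the range of the rescaled v. -/

section PowerBounds

/-- The interval [1/5, 5] is where v lies after division by m; on it every power is Lipschitz and
bounded above and away from zero. -/
theorem exists_rpow_bounds (γ : ℝ) : ∃ C : ℝ, 1 ≤ C ∧ ∀ a ∈ Icc (1 / 5 : ℝ) 5,
    a ^ γ ≤ C ∧ 1 ≤ C * a ^ γ ∧ ∀ b ∈ Icc (1 / 5 : ℝ) 5, |a ^ γ - b ^ γ| ≤ C * |a - b| := by
  have hne : ∀ a ∈ Icc (1 / 5 : ℝ) 5, a ≠ 0 := fun a ha => by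
    have := ha.1
    positivity
  have hL : LocallyLipschitzOn (Icc (1 / 5 : ℝ) 5) (fun a : ℝ => a ^ γ) := fun a ha => by
    obtain ⟨K, t, ht, hK⟩ := (Real.contDiffAt_rpow_const_of_ne (p := γ) (n := 1)
      (hne a ha)).exists_lipschitzOnWith
    exact ⟨K, t, mem_nhdsWithin_of_mem_nhds ht, hK⟩
  obtain ⟨K, hK⟩ := hL.exists_lipschitzOnWith_of_compact isCompact_Icc
  have hc : ∀ γ : ℝ, ContinuousOn (fun a : ℝ => a ^ γ) (Icc (1 / 5 : ℝ) 5) := fun γ a ha =>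
    (Real.continuousAt_rpow_const a γ (Or.inl (hne a ha))).continuousWithinAt
  obtain ⟨C₁, h₁⟩ := isCompact_Icc.bddAbove_image (hc γ)
  obtain ⟨C₂, h₂⟩ := isCompact_Icc.bddAbove_image (hc (-γ))
  refine ⟨max (max 1 K) (max C₁ C₂), (le_max_left _ _).trans (le_max_left _ _), ?_⟩
  intro a ha
  have ha0 : 0 < a := lt_of_lt_of_le (by norm_num) ha.1
  refine ⟨(h₁ (mem_image_of_mem _ ha)).trans ((le_max_left _ _).trans (le_max_right _ _)), ?_, ?_⟩
  · have e : a ^ (-γ) ≤ max (max 1 (K : ℝ)) (max C₁ C₂) :=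
      (h₂ (mem_image_of_mem (fun a : ℝ => a ^ (-γ)) ha)).trans
        ((le_max_right _ _).trans (le_max_right _ _))
    have e1 : a ^ (-γ) * a ^ γ = 1 := by rw [← Real.rpow_add ha0]; simp
    have e2 := mul_le_mul_of_nonneg_right e (Real.rpow_nonneg ha0.le γ)
    rwa [e1] at e2
  · intro b hb
    have := hK.dist_le_mul a ha b hb
    rw [Real.dist_eq, Real.dist_eq] at this
    exact this.trans (mul_le_mul_of_nonneg_right
      ((le_max_right _ _).trans (le_max_left _ _)) (abs_nonneg _))

end PowerBounds

/-! ### Couplings of the Hessians at the two points. -/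

section Coupling

variable {n : ℕ}

local notation "𝔼" => EuclideanSpace ℝ (Fin n)

/-- The trace of a bilinear form on Euclidean space. -/
def bilinTrace (Y : EuclideanSpace ℝ (Fin n) →L[ℝ] EuclideanSpace ℝ (Fin n) →L[ℝ] ℝ) : ℝ :=
  ∑ i, Y (EuclideanSpace.single i 1) (EuclideanSpace.single i 1)

theorem sum_smul_single (x : 𝔼) : ∑ i, x i • (EuclideanSpace.single i (1 : ℝ) : 𝔼) = x := by
  ext j
  simp [Finset.sum_apply, Pi.single_apply]

theorem bilin_eq_sum (Y : 𝔼 →L[ℝ] 𝔼 →L[ℝ] ℝ) (x y : 𝔼) : Y x y =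
    ∑ i, ∑ j, x i * y j * Y (EuclideanSpace.single i 1) (EuclideanSpace.single j 1) := by
  conv_lhs => rw [← sum_smul_single x, ← sum_smul_single y]
  simp only [map_sum, sum_apply, map_smul, smul_apply, smul_eq_mul,
    Finset.mul_sum, mul_assoc]
  rw [Finset.sum_comm]
  refine Finset.sum_congr rfl fun i _ => Finset.sum_congr rfl fun j _ => ?_
  ring

theorem norm_sq_eq_sum_sq (x : 𝔼) : ‖x‖ ^ 2 = ∑ i, x i ^ 2 := EuclideanSpace.real_norm_sq_eq x

/-- The standard basis reflected in the hyperplane orthogonal to e is again orthonormal, and the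
trace does not depend on the orthonormal basis. -/
theorem sum_bilin_reflection (X : 𝔼 →L[ℝ] 𝔼 →L[ℝ] ℝ) {e : 𝔼} (he : ‖e‖ = 1) :
    ∑ i, X (EuclideanSpace.single i 1 - (2 * e i) • e) (EuclideanSpace.single i 1 - (2 * e i) • e)
      = bilinTrace X := by
  have h1 : ∑ i, e i * X (EuclideanSpace.single i 1) e = X e e := by
    have : ∑ i, e i * X (EuclideanSpace.single i 1) e
        = X (∑ i, e i • EuclideanSpace.single i (1 : ℝ)) e := by
      simp only [map_sum, sum_apply, map_smul, smul_apply, smul_eq_mul]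
    rw [this, sum_smul_single]
  have h2 : ∑ i, e i * X e (EuclideanSpace.single i 1) = X e e := by
    have : ∑ i, e i * X e (EuclideanSpace.single i 1)
        = X e (∑ i, e i • EuclideanSpace.single i (1 : ℝ)) := by
      simp only [map_sum, map_smul, smul_eq_mul]
    rw [this, sum_smul_single]
  have h3 : ∑ i, e i ^ 2 = 1 := by rw [← norm_sq_eq_sum_sq, he]; norm_num
  have h4 : ∀ i, X (EuclideanSpace.single i 1 - (2 * e i) • e)
      (EuclideanSpace.single i 1 - (2 * e i) • e) =
      X (EuclideanSpace.single i 1) (EuclideanSpace.single i 1)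
        - 2 * (e i * X (EuclideanSpace.single i 1) e)
        - 2 * (e i * X e (EuclideanSpace.single i 1)) + 4 * X e e * e i ^ 2 := by
    intro i
    simp only [map_sub, map_smul, sub_apply, smul_apply, smul_eq_mul]
    ring
  simp only [h4, Finset.sum_add_distrib, Finset.sum_sub_distrib, ← Finset.mul_sum, h1, h2, h3]
  rw [bilinTrace]
  ring

/-- Writes |F|² I - F ⊗ F as a sum of squares of vectors that are linear in F, so that it can be
coupled term by term without a matrix square root. -/
theorem sum_sum_bilin_cross (Y : 𝔼 →L[ℝ] 𝔼 →L[ℝ] ℝ) (F : 𝔼) :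
    ∑ i, ∑ j, Y (F i • EuclideanSpace.single j 1 - F j • EuclideanSpace.single i 1)
      (F i • EuclideanSpace.single j 1 - F j • EuclideanSpace.single i 1)
      = 2 * (‖F‖ ^ 2 * bilinTrace Y - Y F F) := by
  have h4 : ∀ i j, Y (F i • EuclideanSpace.single j 1 - F j • EuclideanSpace.single i 1)
      (F i • EuclideanSpace.single j 1 - F j • EuclideanSpace.single i 1) =
      F i ^ 2 * Y (EuclideanSpace.single j 1) (EuclideanSpace.single j 1)
      - F j * F i * Y (EuclideanSpace.single j 1) (EuclideanSpace.single i 1)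
      - F i * F j * Y (EuclideanSpace.single i 1) (EuclideanSpace.single j 1)
      + F j ^ 2 * Y (EuclideanSpace.single i 1) (EuclideanSpace.single i 1) := by
    intro i j
    simp only [map_sub, map_smul, sub_apply, smul_apply, smul_eq_mul]
    ring
  simp only [h4, Finset.sum_add_distrib, Finset.sum_sub_distrib]
  rw [← bilin_eq_sum Y F F, Finset.sum_comm (f := fun i j => F j * F i *
    Y (EuclideanSpace.single j 1) (EuclideanSpace.single i 1)), ← bilin_eq_sum Y F F,
    Finset.sum_comm (f := fun i j => F j ^ 2 *
    Y (EuclideanSpace.single i 1) (EuclideanSpace.single i 1))]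
  simp only [← Finset.mul_sum, ← Finset.sum_mul, ← norm_sq_eq_sum_sq]
  rw [bilinTrace]
  simp only [Finset.mul_sum]
  ring

variable {X Y : EuclideanSpace ℝ (Fin n) →L[ℝ] EuclideanSpace ℝ (Fin n) →L[ℝ] ℝ} {s τ μ D : ℝ}
  {e : EuclideanSpace ℝ (Fin n)}

/-- Synchronous coupling: both points move along the same basis vector, at speeds k' and k. -/
theorem trace_coupling_le {A B : ℝ}
    (H : ∀ ξ η : 𝔼, Y η η - X ξ ξ ≤ A * ‖η - ξ‖ ^ 2 + B * (‖ξ‖ ^ 2 + ‖η‖ ^ 2)) (k k' : ℝ) :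
    k ^ 2 * bilinTrace Y - k' ^ 2 * bilinTrace X
      ≤ n * (A * (k - k') ^ 2 + B * (k ^ 2 + k' ^ 2)) := by
  have h : ∀ i ∈ Finset.univ, k ^ 2 * Y (EuclideanSpace.single i 1) (EuclideanSpace.single i 1)
      - k' ^ 2 * X (EuclideanSpace.single i 1) (EuclideanSpace.single i 1)
      ≤ A * (k - k') ^ 2 + B * (k ^ 2 + k' ^ 2) := by
    intro i _
    have := H (k' • EuclideanSpace.single i 1) (k • EuclideanSpace.single i 1)
    rw [← sub_smul] at this
    simp only [map_smul, smul_apply, smul_eq_mul, norm_smul, Real.norm_eq_abs, sq_abs,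
      PiLp.norm_single, abs_one, mul_one] at this
    linarith
  have h2 := Finset.sum_le_sum h
  simp only [Finset.sum_sub_distrib, ← Finset.mul_sum, Finset.sum_const, Finset.card_univ,
    Fintype.card_fin, nsmul_eq_mul] at h2
  exact h2

theorem cross_coupling_le {A B : ℝ} (hA : 0 ≤ A) (hB : 0 ≤ B)
    (H : ∀ ξ η : 𝔼, Y η η - X ξ ξ ≤ A * ‖η - ξ‖ ^ 2 + B * (‖ξ‖ ^ 2 + ‖η‖ ^ 2)) (F F' : 𝔼) :
    (‖F‖ ^ 2 * bilinTrace Y - Y F F) - (‖F'‖ ^ 2 * bilinTrace X - X F' F')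
      ≤ 2 * n * (A * ‖F - F'‖ ^ 2 + B * (‖F‖ ^ 2 + ‖F'‖ ^ 2)) := by
  have hn : ∀ (G : 𝔼) (i j : Fin n), ‖(G i • EuclideanSpace.single j 1
      - G j • EuclideanSpace.single i 1 : 𝔼)‖ ^ 2 ≤ 2 * (G i ^ 2 + G j ^ 2) := by
    intro G i j
    have h1 := norm_sub_le (G i • EuclideanSpace.single j 1 : 𝔼) (G j • EuclideanSpace.single i 1)
    simp only [norm_smul, PiLp.norm_single, Real.norm_eq_abs, abs_one, mul_one] at h1
    have h2 := pow_le_pow_left₀ (norm_nonneg _) h1 2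
    nlinarith [sq_nonneg (|G i| - |G j|), sq_abs (G i), sq_abs (G j)]
  have hs : ∀ G : 𝔼, ∑ i, ∑ j, 2 * (G i ^ 2 + G j ^ 2) = 4 * n * ‖G‖ ^ 2 := by
    intro G
    simp only [← Finset.mul_sum, Finset.sum_add_distrib, Finset.sum_const, Finset.card_univ,
      Fintype.card_fin, nsmul_eq_mul, ← norm_sq_eq_sum_sq]
    ring
  have h : ∀ i ∈ Finset.univ, ∀ j ∈ Finset.univ,
      Y (F i • EuclideanSpace.single j 1 - F j • EuclideanSpace.single i 1)
        (F i • EuclideanSpace.single j 1 - F j • EuclideanSpace.single i 1)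
      - X (F' i • EuclideanSpace.single j 1 - F' j • EuclideanSpace.single i 1)
        (F' i • EuclideanSpace.single j 1 - F' j • EuclideanSpace.single i 1)
      ≤ A * (2 * ((F - F') i ^ 2 + (F - F') j ^ 2))
        + B * (2 * (F' i ^ 2 + F' j ^ 2)) + B * (2 * (F i ^ 2 + F j ^ 2)) := by
    intro i _ j _
    refine (H _ _).trans ?_
    have e1 : (F i • EuclideanSpace.single j 1 - F j • EuclideanSpace.single i 1
        - (F' i • EuclideanSpace.single j 1 - F' j • EuclideanSpace.single i 1) : 𝔼)
        = (F - F') i • EuclideanSpace.single j 1 - (F - F') j • EuclideanSpace.single i 1 := by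
      simp only [PiLp.sub_apply]
      module
    rw [e1, add_assoc, ← mul_add]
    exact add_le_add (mul_le_mul_of_nonneg_left (hn _ i j) hA)
      (mul_le_mul_of_nonneg_left (add_le_add (hn _ i j) (hn _ i j)) hB)
  have h2 := Finset.sum_le_sum fun i hi => Finset.sum_le_sum (h i hi)
  simp only [Finset.sum_sub_distrib, sum_sum_bilin_cross, Finset.sum_add_distrib] at h2
  have h4 : ∀ (c : ℝ) (G : 𝔼), ∑ i, ∑ j, c * (2 * (G i ^ 2 + G j ^ 2)) = c * (4 * n * ‖G‖ ^ 2) := by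
    intro c G
    rw [← hs]
    simp only [Finset.mul_sum]
  simp only [h4] at h2
  nlinarith

/-- The two points move along mirror images across the hyperplane orthogonal to e. The relative
motion orthogonal to e, the only one the singular term 1/s sees, is proportional to r - r', while
the motion along e meets the concavity of s - s²/(4D). Summing with Σ eᵢ² = 1 gives the gain
r²/(4D). -/
theorem reflection_coupling_le (he : ‖e‖ = 1) (hs : 0 < s) (hD : 0 < D) (hμ : μ ∈ Icc (1 / 2 : ℝ) 1)
    (hτ : 0 ≤ τ)
    (H : ∀ ξ η : 𝔼, Y η η - X ξ ξ ≤ μ * ((‖η - ξ‖ ^ 2 - ⟪e, η - ξ⟫ ^ 2) / s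
      - ‖η - ξ‖ ^ 2 / (2 * D)) + τ * ‖ξ + η‖ ^ 2 / 2) {r r' : ℝ} (hr : 0 ≤ r) (hr' : 0 ≤ r') :
    r ^ 2 * bilinTrace Y - r' ^ 2 * bilinTrace X
      ≤ n * ((r - r') ^ 2 / s + τ * (r ^ 2 + r' ^ 2)) - r ^ 2 / (4 * D) := by
  have h3 : ∑ i, e i ^ 2 = 1 := by rw [← norm_sq_eq_sum_sq, he]; norm_num
  have hin : ∀ i, ⟪e, EuclideanSpace.single i (1 : ℝ)⟫ = e i := fun i => by
    rw [EuclideanSpace.inner_single_right]; simp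
  have hee : ⟪e, e⟫ = (1 : ℝ) := by rw [real_inner_self_eq_norm_sq, he]; norm_num
  have h : ∀ i ∈ Finset.univ, r ^ 2 * Y (EuclideanSpace.single i 1) (EuclideanSpace.single i 1)
      - r' ^ 2 * X (EuclideanSpace.single i 1 - (2 * e i) • e)
          (EuclideanSpace.single i 1 - (2 * e i) • e)
      ≤ ((r - r') ^ 2 / s + τ * (r ^ 2 + r' ^ 2)) - r ^ 2 / (4 * D) * e i ^ 2 := by
    intro i _
    have h1 := H (r' • (EuclideanSpace.single i 1 - (2 * e i) • e)) (r • EuclideanSpace.single i 1)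
    set b : 𝔼 := EuclideanSpace.single i 1 with hb
    have hbb : ⟪b, b⟫ = (1 : ℝ) := by
      rw [real_inner_self_eq_norm_sq, hb, PiLp.norm_single]; norm_num
    have heb : ⟪e, b⟫ = e i := hin i
    have hbe : ⟪b, e⟫ = e i := by rw [real_inner_comm, heb]
    have n1 : ‖r • b - r' • (b - (2 * e i) • e)‖ ^ 2
        = (r - r') ^ 2 + 4 * r' * r * e i ^ 2 := by
      rw [← real_inner_self_eq_norm_sq]
      simp only [inner_sub_left, inner_sub_right, real_inner_smul_left, real_inner_smul_right,
        hbb, heb, hbe, hee]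
      ring
    have n2 : ⟪e, r • b - r' • (b - (2 * e i) • e)⟫ = (r + r') * e i := by
      simp only [inner_sub_right, real_inner_smul_right, heb, hee]
      ring
    have n3 : ‖r' • (b - (2 * e i) • e) + r • b‖ ^ 2
        = (r + r') ^ 2 - 4 * r' * r * e i ^ 2 := by
      rw [← real_inner_self_eq_norm_sq]
      simp only [inner_sub_left, inner_sub_right, inner_add_left, inner_add_right,
        real_inner_smul_left, real_inner_smul_right, hbb, heb, hbe, hee]
      ring
    rw [n1, n2, n3] at h1
    simp only [map_smul, smul_apply, smul_eq_mul] at h1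
    have he1 : e i ^ 2 ≤ 1 := by
      rw [← h3]
      exact Finset.single_le_sum (f := fun i => e i ^ 2) (fun i _ => sq_nonneg _)
        (Finset.mem_univ i)
    have he0 : 0 ≤ e i ^ 2 := sq_nonneg _
    have hrr : 0 ≤ r' * r := mul_nonneg hr' hr
    have b1 : μ * (((r - r') ^ 2 + 4 * r' * r * e i ^ 2 - ((r + r') * e i) ^ 2) / s)
        ≤ (r - r') ^ 2 / s := by
      rw [← mul_div_assoc]
      apply div_le_div_of_nonneg_right _ hs.le
      have : (r - r') ^ 2 + 4 * r' * r * e i ^ 2 - ((r + r') * e i) ^ 2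
        = (r - r') ^ 2 * (1 - e i ^ 2) := by ring
      rw [this]
      have e0 : 0 ≤ (r - r') ^ 2 * (1 - e i ^ 2) := mul_nonneg (sq_nonneg _) (by linarith)
      have e1 : (r - r') ^ 2 * (1 - e i ^ 2) ≤ (r - r') ^ 2 :=
        mul_le_of_le_one_right (sq_nonneg _) (by linarith)
      exact (mul_le_of_le_one_left e0 hμ.2).trans e1
    have b2 : r ^ 2 / (4 * D) * e i ^ 2
        ≤ μ * (((r - r') ^ 2 + 4 * r' * r * e i ^ 2) / (2 * D)) := by
      have e1 : r ^ 2 * e i ^ 2 ≤ (r - r') ^ 2 + 4 * r' * r * e i ^ 2 := by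
        nlinarith [mul_nonneg (sq_nonneg (r - r')) (sub_nonneg.2 he1),
          mul_nonneg hrr he0, mul_nonneg (sq_nonneg r') he0]
      have e2 : 0 ≤ r ^ 2 * e i ^ 2 := by positivity
      calc r ^ 2 / (4 * D) * e i ^ 2 = 1 / 2 * ((r ^ 2 * e i ^ 2) / (2 * D)) := by
            field_simp; ring
        _ ≤ μ * (((r - r') ^ 2 + 4 * r' * r * e i ^ 2) / (2 * D)) := by
            have := hμ.1
            gcongr
    have b3 : τ * ((r + r') ^ 2 - 4 * r' * r * e i ^ 2) / 2 ≤ τ * (r ^ 2 + r' ^ 2) := by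
      have : (r + r') ^ 2 - 4 * r' * r * e i ^ 2 ≤ 2 * (r ^ 2 + r' ^ 2) := by
        nlinarith [sq_nonneg (r - r'), mul_nonneg hrr he0]
      have := mul_le_mul_of_nonneg_left this hτ
      linarith
    rw [mul_sub] at h1
    linarith
  have h2 := Finset.sum_le_sum h
  simp only [Finset.sum_sub_distrib, ← Finset.mul_sum, Finset.sum_const, Finset.card_univ,
    Fintype.card_fin, nsmul_eq_mul, h3, sum_bilin_reflection X he] at h2
  rw [mul_one] at h2
  exact h2

end Coupling

/-! ### Strict decrease of the elliptic part at an interior maximum. -/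

section Ellipticity

variable {n : ℕ}

theorem abs_regNorm_sub_le (ε : ℝ) (P P' : EuclideanSpace ℝ (Fin n)) :
    |regNorm ε P - regNorm ε P'| ≤ ‖P - P'‖ := by
  have h := abs_norm_sub_norm_le (WithLp.toLp 2 (ε, P)) (WithLp.toLp 2 (ε, P'))
  have e : ∀ Q : EuclideanSpace ℝ (Fin n), ‖WithLp.toLp 2 (ε, Q)‖ = regNorm ε Q := fun Q => by
    rw [WithLp.prod_norm_eq_of_L2, regNorm]
    simp
  rw [e, e, ← WithLp.toLp_sub, WithLp.prod_norm_eq_of_L2] at h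
  simpa using h

theorem sq_regNorm (ε : ℝ) (P : EuclideanSpace ℝ (Fin n)) :
    regNorm ε P ^ 2 = ε ^ 2 + ‖P‖ ^ 2 := by
  rw [regNorm, Real.sq_sqrt (by positivity)]

theorem norm_le_regNorm (ε : ℝ) (P : EuclideanSpace ℝ (Fin n)) : ‖P‖ ≤ regNorm ε P :=
  Real.le_sqrt_of_sq_le (by nlinarith [sq_nonneg ε])

/-- The linearization of `div (v^{p-2} P)` contracted with the Hessian `Y`. -/
def flux (p ε : ℝ) (P : EuclideanSpace ℝ (Fin n))
    (Y : EuclideanSpace ℝ (Fin n) →L[ℝ] EuclideanSpace ℝ (Fin n) →L[ℝ] ℝ) : ℝ :=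
  regNorm ε P ^ (p - 2) * bilinTrace Y + (p - 2) * regNorm ε P ^ (p - 4) * Y P P

/-- Splitting of the principal part into a multiple of the trace and sums of squares. -/
theorem flux_eq {p ε : ℝ} {P : EuclideanSpace ℝ (Fin n)} (hv : 0 < regNorm ε P)
    (Y : EuclideanSpace ℝ (Fin n) →L[ℝ] EuclideanSpace ℝ (Fin n) →L[ℝ] ℝ) {κ : ℝ} :
    let g := regNorm ε P ^ ((p - 4) / 2)
    flux p ε P Y = κ * ((regNorm ε P ^ ((p - 2) / 2)) ^ 2 * bilinTrace Y)
      + (p - 1 - κ) * Y (g • P) (g • P)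
      + (1 - κ) * ((g * ε) ^ 2 * bilinTrace Y + (‖g • P‖ ^ 2 * bilinTrace Y - Y (g • P) (g • P))) := by
  intro g
  have e1 : regNorm ε P ^ (p - 4) = g ^ 2 := by
    rw [← Real.rpow_natCast, ← Real.rpow_mul hv.le]; congr 1; push_cast; ring
  have e2 : (regNorm ε P ^ ((p - 2) / 2)) ^ 2 = regNorm ε P ^ (p - 2) := by
    rw [← Real.rpow_natCast (regNorm ε P ^ ((p - 2) / 2)), ← Real.rpow_mul hv.le]
    congr 1; push_cast; ring
  have e3 : regNorm ε P ^ (p - 2) = g ^ 2 * (ε ^ 2 + ‖P‖ ^ 2) := by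
    rw [← e1, ← sq_regNorm, ← Real.rpow_natCast (regNorm ε P) 2, ← Real.rpow_add hv]
    congr 1; push_cast; ring
  have e4 : ‖g • P‖ ^ 2 = g ^ 2 * ‖P‖ ^ 2 := by
    rw [norm_smul, mul_pow, Real.norm_eq_abs, sq_abs]
  rw [flux, e1, e2, e3, e4]
  simp only [map_smul, smul_apply, smul_eq_mul]
  ring

/-- Discards the favourable terms; this cruder form serves the pieces of the flux that are not
coupled by reflection. -/
theorem coupling_rhs_le {s D μ τ : ℝ} {e : EuclideanSpace ℝ (Fin n)} (hs : 0 < s) (hD : 0 < D)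
    (hμ : μ ∈ Icc (1 / 2 : ℝ) 1) (hτ : 0 ≤ τ) (ξ η : EuclideanSpace ℝ (Fin n)) :
    μ * ((‖η - ξ‖ ^ 2 - ⟪e, η - ξ⟫ ^ 2) / s - ‖η - ξ‖ ^ 2 / (2 * D)) + τ * ‖ξ + η‖ ^ 2 / 2
      ≤ 1 / s * ‖η - ξ‖ ^ 2 + τ * (‖ξ‖ ^ 2 + ‖η‖ ^ 2) := by
  have e1 : μ * ((‖η - ξ‖ ^ 2 - ⟪e, η - ξ⟫ ^ 2) / s - ‖η - ξ‖ ^ 2 / (2 * D))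
      ≤ 1 / s * ‖η - ξ‖ ^ 2 := by
    have h1 : (‖η - ξ‖ ^ 2 - ⟪e, η - ξ⟫ ^ 2) / s - ‖η - ξ‖ ^ 2 / (2 * D)
        ≤ 1 / s * ‖η - ξ‖ ^ 2 := by
      have : 0 ≤ ⟪e, η - ξ⟫ ^ 2 / s := by positivity
      have : 0 ≤ ‖η - ξ‖ ^ 2 / (2 * D) := by positivity
      rw [sub_div, one_div_mul_eq_div]
      linarith
    have h0 : 0 ≤ 1 / s * ‖η - ξ‖ ^ 2 := by positivity
    calc _ ≤ μ * (1 / s * ‖η - ξ‖ ^ 2) := mul_le_mul_of_nonneg_left h1 (by linarith [hμ.1])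
      _ ≤ _ := mul_le_of_le_one_left h0 hμ.2
  have e2 : ‖ξ + η‖ ^ 2 ≤ 2 * (‖ξ‖ ^ 2 + ‖η‖ ^ 2) := by
    have := parallelogram_law_with_norm ℝ ξ η
    nlinarith [mul_self_nonneg ‖ξ - η‖]
  have e3 := mul_le_mul_of_nonneg_left e2 hτ
  linarith

/-- The matrix inequality at a two-point maximum forces a definite decrease of the flux. -/
def FluxDecrease (n : ℕ) (p D C₁ c τ : ℝ) : Prop :=
  ∀ (s μ ε : ℝ) (e P P' : EuclideanSpace ℝ (Fin n))
    (X Y : EuclideanSpace ℝ (Fin n) →L[ℝ] EuclideanSpace ℝ (Fin n) →L[ℝ] ℝ),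
    ‖e‖ = 1 → s ∈ Ioc 0 D → μ ∈ Icc (1 / 2 : ℝ) 1 → 0 ≤ ε →
    regNorm ε P ∈ Icc (1 / 5 : ℝ) 5 → regNorm ε P' ∈ Icc (1 / 5 : ℝ) 5 →
    ‖P - P'‖ ≤ C₁ * τ * s →
    (∀ ξ η, Y η η - X ξ ξ ≤ μ * ((‖η - ξ‖ ^ 2 - ⟪e, η - ξ⟫ ^ 2) / s
      - ‖η - ξ‖ ^ 2 / (2 * D)) + τ * ‖ξ + η‖ ^ 2 / 2) →
    flux p ε P Y - flux p ε P' X ≤ -c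

set_option maxHeartbeats 1000000 in
theorem exists_flux_sub_le (n : ℕ) {p D : ℝ} (hp : 1 < p) (hD : 0 < D) (C₁ : ℝ) :
    ∃ τ₀ > 0, ∃ c > 0, ∀ τ ∈ Ioc 0 τ₀, FluxDecrease n p D C₁ c τ := by
  obtain ⟨Cg, hCg1, hCg⟩ := exists_rpow_bounds ((p - 4) / 2)
  obtain ⟨Cr, hCr1, hCr⟩ := exists_rpow_bounds ((p - 2) / 2)
  -- The largest multiple of the trace that leaves all coefficients in the splitting of the flux
  -- nonnegative; it is positive because p > 1.
  set κ := min 1 (p - 1) with hκ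
  have hκ0 : 0 < κ := lt_min one_pos (by linarith)
  have hκ1 : 0 ≤ 1 - κ := by linarith [min_le_left 1 (p - 1)]
  have hκ2 : 0 ≤ p - 1 - κ := by linarith [min_le_right 1 (p - 1)]
  set C := 6 * Cg + Cr with hC
  have hC0 : 0 < C := by positivity
  set S := C ^ 2 * C₁ ^ 2 * D with hS
  set R := 2 * C ^ 2 with hR
  have hS0 : 0 ≤ S := by positivity
  have hR0 : 0 ≤ R := by positivity
  set A := κ * (n * (S + R)) + (p - 1 - κ) * (S + R)
    + (1 - κ) * (n * (S + R) + 2 * n * (S + R)) with hA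
  have hA0 : 0 ≤ A := by positivity
  -- Half of the reflection gain; the other half absorbs the total error τA.
  set c := κ * (1 / C ^ 2 / (4 * D)) / 2 with hc
  have hc0 : 0 < c := by positivity
  refine ⟨min 1 (c / (A + 1)), by positivity, c, hc0, ?_⟩
  rintro τ ⟨hτ0, hτ⟩ s μ ε e P P' X Y he ⟨hs0, hsD⟩ hμ hε hv hv' hPP H
  have hτ1 : τ ≤ 1 := hτ.trans (min_le_left _ _)
  have hτA : τ * A ≤ c := by
    have : τ * (A + 1) ≤ c := by
      rw [← le_div_iff₀ (by positivity)]; exact hτ.trans (min_le_right _ _)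
    linarith
  have hv0 : 0 < regNorm ε P := lt_of_lt_of_le (by norm_num) hv.1
  have hv0' : 0 < regNorm ε P' := lt_of_lt_of_le (by norm_num) hv'.1
  rw [flux_eq hv0 Y (κ := κ), flux_eq hv0' X (κ := κ)]
  set v := regNorm ε P with hvdef
  set v' := regNorm ε P' with hvdef'
  set r := v ^ ((p - 2) / 2) with hr
  set r' := v' ^ ((p - 2) / 2) with hr'
  set g := v ^ ((p - 4) / 2) with hg
  set g' := v' ^ ((p - 4) / 2) with hg'
  have hvv : |v - v'| ≤ ‖P - P'‖ := abs_regNorm_sub_le ε P P'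
  have hr0 : 0 ≤ r := Real.rpow_nonneg hv0.le _
  have hr0' : 0 ≤ r' := Real.rpow_nonneg hv0'.le _
  have hg0 : 0 ≤ g := Real.rpow_nonneg hv0.le _
  have hg0' : 0 ≤ g' := Real.rpow_nonneg hv0'.le _
  have hPv : ‖P‖ ≤ 5 := (norm_le_regNorm ε P).trans hv.2
  have hPv' : ‖P'‖ ≤ 5 := (norm_le_regNorm ε P').trans hv'.2
  have hεv : ε ≤ 5 := by
    refine le_trans ?_ hv.2
    exact Real.le_sqrt_of_sq_le (le_add_of_nonneg_right (sq_nonneg _))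
  -- As |P - P'| = O(τs), a squared difference of coefficients is O(τ²s²) and survives division by
  -- s.
  have hsmall : ∀ z : ℝ, |z| ≤ C * ‖P - P'‖ → z ^ 2 / s ≤ S * τ := by
    intro z hz
    have h1 : |z| ≤ C * (C₁ * τ * s) := hz.trans (by gcongr)
    have h2 : z ^ 2 ≤ (C * (C₁ * τ * s)) ^ 2 := by
      rw [← sq_abs]; exact pow_le_pow_left₀ (abs_nonneg _) h1 2
    rw [div_le_iff₀ hs0]
    calc z ^ 2 ≤ C ^ 2 * C₁ ^ 2 * (τ * τ) * (s * s) := h2.trans_eq (by ring)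
      _ ≤ C ^ 2 * C₁ ^ 2 * (1 * τ) * (D * s) := by gcongr
      _ = S * τ * s := by rw [hS]; ring
  have hsq : ∀ z : ℝ, |z| ≤ C → z ^ 2 ≤ C ^ 2 := fun z hz => by
    rw [← sq_abs]; exact pow_le_pow_left₀ (abs_nonneg _) hz 2
  have hdP := norm_nonneg (P - P')
  have b1 : |r - r'| ≤ C * ‖P - P'‖ := by
    refine ((hCr v hv).2.2 v' hv').trans ?_
    calc Cr * |v - v'| ≤ Cr * ‖P - P'‖ := by gcongr
      _ ≤ C * ‖P - P'‖ := by gcongr; linarith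
  have b2 : |g - g'| ≤ Cg * ‖P - P'‖ :=
    ((hCg v hv).2.2 v' hv').trans (by gcongr)
  have b3 : |g * ε - g' * ε| ≤ C * ‖P - P'‖ := by
    rw [← sub_mul, abs_mul, abs_of_nonneg hε]
    calc |g - g'| * ε ≤ (Cg * ‖P - P'‖) * 5 := by gcongr
      _ = (5 * Cg) * ‖P - P'‖ := by ring
      _ ≤ C * ‖P - P'‖ := by gcongr; linarith
  have b4 : ‖g • P - g' • P'‖ ≤ C * ‖P - P'‖ := by
    have e1 : g • P - g' • P' = g • (P - P') + (g - g') • P' := by module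
    rw [e1]
    refine (norm_add_le _ _).trans ?_
    rw [norm_smul, norm_smul, Real.norm_of_nonneg hg0, Real.norm_eq_abs]
    calc g * ‖P - P'‖ + |g - g'| * ‖P'‖ ≤ Cg * ‖P - P'‖ + (Cg * ‖P - P'‖) * 5 := by
          gcongr
          exact (hCg v hv).1
      _ = (6 * Cg) * ‖P - P'‖ := by ring
      _ ≤ C * ‖P - P'‖ := by gcongr; linarith
  have c1 : r ^ 2 + r' ^ 2 ≤ R := by
    have := hsq r (by rw [abs_of_nonneg hr0]; linarith [(hCr v hv).1])
    have := hsq r' (by rw [abs_of_nonneg hr0']; linarith [(hCr v' hv').1])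
    linarith
  have c3 : (g * ε) ^ 2 + (g' * ε) ^ 2 ≤ R := by
    have := hsq (g * ε) (by
      rw [abs_of_nonneg (by positivity)]
      have := mul_le_mul (hCg v hv).1 hεv hε (by positivity)
      linarith)
    have := hsq (g' * ε) (by
      rw [abs_of_nonneg (by positivity)]
      have := mul_le_mul (hCg v' hv').1 hεv hε (by positivity)
      linarith)
    linarith
  have c4 : ‖g' • P'‖ ^ 2 + ‖g • P‖ ^ 2 ≤ R := by
    have := hsq ‖g • P‖ (by
      rw [abs_of_nonneg (norm_nonneg _), norm_smul, Real.norm_of_nonneg hg0]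
      have := mul_le_mul (hCg v hv).1 hPv (norm_nonneg _) (by positivity)
      linarith)
    have := hsq ‖g' • P'‖ (by
      rw [abs_of_nonneg (norm_nonneg _), norm_smul, Real.norm_of_nonneg hg0']
      have := mul_le_mul (hCg v' hv').1 hPv' (norm_nonneg _) (by positivity)
      linarith)
    linarith
  have H' := fun ξ η => (H ξ η).trans (coupling_rhs_le hs0 hD hμ hτ0.le ξ η)
  have hs1 : 0 ≤ 1 / s := by positivity
  have t1 := reflection_coupling_le he hs0 hD hμ hτ0.le H hr0 hr0'
  have t2 := H' (g' • P') (g • P)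
  have t3 := trace_coupling_le H' (g * ε) (g' * ε)
  have t4 := cross_coupling_le hs1 hτ0.le H' (g • P) (g' • P')
  have d1 := hsmall _ b1
  have d3 := hsmall _ b3
  have d4 := hsmall ‖g • P - g' • P'‖ (by rwa [abs_of_nonneg (norm_nonneg _)])
  rw [one_div_mul_eq_div] at t2 t3 t4
  have hrlow : 1 / C ^ 2 / (4 * D) ≤ r ^ 2 / (4 * D) := by
    gcongr
    have h1 : 1 ≤ C * r := (hCr v hv).2.1.trans (by gcongr; linarith)
    rw [div_le_iff₀ (by positivity), mul_comm, ← mul_pow]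
    exact one_le_pow₀ h1
  have u1 : r ^ 2 * bilinTrace Y - r' ^ 2 * bilinTrace X
      ≤ n * (τ * (S + R)) - 1 / C ^ 2 / (4 * D) := by
    refine t1.trans (sub_le_sub ?_ hrlow)
    refine mul_le_mul_of_nonneg_left ?_ (Nat.cast_nonneg n)
    linarith [mul_le_mul_of_nonneg_left c1 hτ0.le]
  have u2 : Y (g • P) (g • P) - X (g' • P') (g' • P') ≤ τ * (S + R) := by
    linarith [mul_le_mul_of_nonneg_left c4 hτ0.le]
  have u3 : (g * ε) ^ 2 * bilinTrace Y - (g' * ε) ^ 2 * bilinTrace X ≤ n * (τ * (S + R)) := by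
    refine t3.trans (mul_le_mul_of_nonneg_left ?_ (Nat.cast_nonneg n))
    linarith [mul_le_mul_of_nonneg_left c3 hτ0.le]
  have u4 : ‖g • P‖ ^ 2 * bilinTrace Y - Y (g • P) (g • P)
      - (‖g' • P'‖ ^ 2 * bilinTrace X - X (g' • P') (g' • P')) ≤ 2 * n * (τ * (S + R)) := by
    refine t4.trans (mul_le_mul_of_nonneg_left ?_ (by positivity))
    linarith [mul_le_mul_of_nonneg_left c4 hτ0.le]
  have w1 := mul_le_mul_of_nonneg_left u1 hκ0.le
  have w2 := mul_le_mul_of_nonneg_left u2 hκ2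
  have w3 := mul_le_mul_of_nonneg_left (add_le_add u3 u4) hκ1
  have w4 : κ * (n * (τ * (S + R)) - 1 / C ^ 2 / (4 * D)) + (p - 1 - κ) * (τ * (S + R))
      + (1 - κ) * (n * (τ * (S + R)) + 2 * n * (τ * (S + R))) = τ * A - 2 * c := by
    rw [hA, hc]; ring
  linarith

end Ellipticity

/-! ### Incompatibility with the boundary condition. -/

section BoundaryEstimate

variable {n : ℕ}

/-- Bounds |b + tν|² from below, where N = |b| and w = ⟨b, ν⟩: both w and t are almost nonnegative,
so the cross term cannot cancel much. -/
theorem quadratic_lower_bound {N w t : ℝ} (hN : 6 / 25 ≤ N) (hw : w ≤ N) (hw' : -(1 / 100) ≤ w)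
    (ht : -(1 / 100) ≤ t) : 1 / 25 ≤ N ^ 2 + 2 * t * w + t ^ 2 := by
  rcases le_or_gt 0 w with h | h
  · have h1 : -(1 / 100) * w ≤ t * w := mul_le_mul_of_nonneg_right ht h
    have h2 : 6 / 25 * (6 / 25 - 1 / 50) ≤ N * (N - 1 / 50) := by gcongr
    linarith [sq_nonneg t]
  · have h1 : w ^ 2 ≤ 1 / 100 * (1 / 100) := by nlinarith
    have h2 : 6 / 25 * (6 / 25) ≤ N * N := by gcongr
    linarith [sq_nonneg (t + w)]

/-- At a vector `P` of the form below, `v` is comparable to `1`. -/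
theorem regNorm_mem_Icc_of_oblique {q ε a r τ φ Λ K : ℝ} {ν b P : EuclideanSpace ℝ (Fin n)}
    (hq : 0 < q) (hν : ‖ν‖ = 1) (hε : ε ^ 2 ≤ 1) (ha : a ∈ Icc (1 / 4 : ℝ) 1) (hr : 0 ≤ r)
    (hτ : 0 ≤ τ) (hK : 0 ≤ K) (hΛ : 0 ≤ Λ) (hφ : |φ| ≤ Λ)
    (hτK : τ * (K + Λ) ≤ 1 / 100) (hb : ‖b‖ ≤ a + τ * K) (hb' : a ≤ ‖b‖ + τ * K)
    (hbν : -(τ * K) ≤ ⟪b, ν⟫) (hP : P = b + (r - τ * φ) • ν)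
    (hbc : ⟪P, ν⟫ = -(τ * φ) * regNorm ε P ^ (1 - q)) :
    regNorm ε P ∈ Icc (1 / 5 : ℝ) 5 := by
  have hνν : ⟪ν, ν⟫ = (1 : ℝ) := by rw [real_inner_self_eq_norm_sq, hν]; norm_num
  have hτφ : |τ * φ| ≤ τ * Λ := by rw [abs_mul, abs_of_nonneg hτ]; gcongr
  rw [mul_add] at hτK
  have hτΛ : τ * Λ ≤ 1 / 100 := by linarith [mul_nonneg hτ hK]
  have hτK' : τ * K ≤ 1 / 100 := by linarith [mul_nonneg hτ hΛ]
  have hPsq : ‖P‖ ^ 2 = ‖b‖ ^ 2 + 2 * (r - τ * φ) * ⟪b, ν⟫ + (r - τ * φ) ^ 2 := by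
    rw [hP, norm_add_sq_real, real_inner_smul_right, norm_smul, hν, Real.norm_eq_abs, mul_one,
      sq_abs]
    ring
  have hPν : ⟪P, ν⟫ = ⟪b, ν⟫ + (r - τ * φ) := by
    rw [hP, inner_add_left, real_inner_smul_left, hνν, mul_one]
  have hv0 : 0 ≤ regNorm ε P := Real.sqrt_nonneg _
  have hvsq := sq_regNorm ε P
  constructor
  · by_contra! hlt
    have h1 : regNorm ε P ^ 2 < (1 / 5) ^ 2 := pow_lt_pow_left₀ hlt hv0 two_ne_zero
    have hφ2 := abs_le.1 hτφ
    have hw := abs_real_inner_le_norm b ν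
    rw [hν, mul_one] at hw
    have h2 := quadratic_lower_bound (N := ‖b‖) (w := ⟪b, ν⟫) (t := r - τ * φ)
      (by linarith [ha.1]) (le_trans (le_abs_self _) hw) (by linarith) (by linarith)
    have h3 := sq_nonneg ε
    linarith
  -- For v > 5 the condition makes the normal part of P at most v/100, because v^(1-q) ≤ v; the
  -- tangential part is at most 2, so v cannot be that large.
  · by_contra! hgt
    have hQ : |⟪P, ν⟫| ≤ regNorm ε P / 100 := by
      rw [hbc, abs_mul, abs_neg, abs_of_nonneg (Real.rpow_nonneg hv0 _)]
      have h1 : regNorm ε P ^ (1 - q) ≤ regNorm ε P := by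
        calc regNorm ε P ^ (1 - q) ≤ regNorm ε P ^ (1 : ℝ) :=
              Real.rpow_le_rpow_of_exponent_le (by linarith) (by linarith)
          _ = regNorm ε P := Real.rpow_one _
      calc |τ * φ| * regNorm ε P ^ (1 - q) ≤ (1 / 100) * regNorm ε P := by
            gcongr; exact hτφ.trans hτΛ
        _ = regNorm ε P / 100 := by ring
    have hQ2 : ⟪P, ν⟫ ^ 2 ≤ (regNorm ε P / 100) ^ 2 := by
      rw [← sq_abs]; exact pow_le_pow_left₀ (abs_nonneg _) hQ 2
    have h3 : ‖P‖ ^ 2 = ‖b‖ ^ 2 - ⟪b, ν⟫ ^ 2 + ⟪P, ν⟫ ^ 2 := by rw [hPν, hPsq]; ring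
    have h4 : ‖b‖ ^ 2 ≤ 2 ^ 2 := pow_le_pow_left₀ (norm_nonneg b) (by linarith [ha.2]) 2
    have h5 : 5 ^ 2 < regNorm ε P ^ 2 := pow_lt_pow_left₀ hgt (by norm_num) two_ne_zero
    have h6 := sq_nonneg (⟪b, ν⟫ : ℝ)
    linarith

/-- The oblique boundary condition fails at the gradients of the two-point test function. -/
def ObliqueIncompatible (n : ℕ) (q c D Λ C₁ C₂ τ : ℝ) : Prop :=
  ∀ (s μ ε r φ : ℝ) (ν e W W' k : EuclideanSpace ℝ (Fin n)),
    ‖ν‖ = 1 → ‖e‖ = 1 → s ∈ Ioc 0 D → c * s ≤ ⟪e, ν⟫ → μ ∈ Icc (1 / 2 : ℝ) 1 → 0 ≤ r →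
    ‖k‖ ≤ C₁ * s → ‖W - W'‖ ≤ C₂ * s → W' = φ • ν → |φ| ≤ Λ → ‖W‖ ≤ Λ →
    ε ^ 2 + μ ^ 2 + τ ^ 2 * ‖W‖ ^ 2 = 1 →
    ∀ P, P = (μ * (1 - s / (2 * D))) • e - τ • W - τ • k + r • ν →
      ⟪P, ν⟫ ≠ -(τ * φ) * regNorm ε P ^ (1 - q)

set_option maxHeartbeats 1000000 in
/-- Near a boundary point of a strictly convex domain, the oblique condition is incompatible with
the gradient of the two-point test function. -/
theorem exists_oblique_ne (n : ℕ) {q c D Λ C₁ C₂ : ℝ} (hq : 0 < q) (hc : 0 < c) (hD : 0 < D) (hΛ : 0 ≤ Λ)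
    (hC₁ : 0 ≤ C₁) (hC₂ : 0 ≤ C₂) :
    ∃ τ₀ > 0, ∀ τ ∈ Ioc 0 τ₀, ObliqueIncompatible n q c D Λ C₁ C₂ τ := by
  obtain ⟨Cq, hCq1, hCq⟩ := exists_rpow_bounds (1 - q)
  set C₃ := C₁ + C₂ with hC₃
  have hC₃0 : 0 ≤ C₃ := by positivity
  set K := C₃ * D with hK
  have hK0 : 0 ≤ K := by positivity
  set M₁ := (1 / D + 2 * C₃ + C₃ * K + 2 * Λ * C₂) / c + (1 + K) * (1 + C₃ / c) with hM₁
  have hM₁0 : 0 ≤ M₁ := by positivity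
  set M := Λ * Cq * (8 * M₁ + (5 + Λ)) with hM
  have hM0 : 0 ≤ M := by positivity
  set B := 2 * M + 100 * (K + Λ) + 8 * C₃ / c + 1 with hB
  have hB0 : 0 < B := by positivity
  refine ⟨1 / B, by positivity, ?_⟩
  rintro τ ⟨hτ0, hτ⟩ s μ ε r φ ν e W W' k hν he ⟨hs0, hsD⟩ hcs hμ hr hk hWW hW' hφ hW hε P hP hbc
  have hτB : τ * B ≤ 1 := by rwa [← le_div_iff₀ hB0]
  have hτM : τ * M ≤ 1 / 2 := by
    have : τ * (2 * M) ≤ τ * B := by gcongr; rw [hB]; linarith [show 0 ≤ 8 * C₃ / c by positivity]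
    linarith
  have hτK : τ * (K + Λ) ≤ 1 / 100 := by
    have : τ * (100 * (K + Λ)) ≤ τ * B := by
      gcongr; rw [hB]; linarith [show 0 ≤ 8 * C₃ / c by positivity]
    linarith
  have hτC : τ * (C₃ / c) ≤ 1 / 8 := by
    have : τ * (8 * C₃ / c) ≤ τ * B := by gcongr; rw [hB]; linarith [show 0 ≤ K by positivity]
    have e : τ * (8 * C₃ / c) = 8 * (τ * (C₃ / c)) := by ring
    linarith
  have hτ1 : τ ≤ 1 := by
    have : τ * 1 ≤ τ * B := by
      gcongr; rw [hB]; linarith [show 0 ≤ 8 * C₃ / c by positivity, show 0 ≤ K by positivity]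
    linarith
  have hνν : ⟪ν, ν⟫ = (1 : ℝ) := by rw [real_inner_self_eq_norm_sq, hν]; norm_num
  set o := 1 - s / (2 * D) with ho
  have hsD1 : s / D ≤ 1 := (div_le_one hD).2 hsD
  have hsD0 : 0 < s / D := by positivity
  have hsD2 : s / (2 * D) = s / D / 2 := by field_simp
  have ho1 : o ≤ 1 := by linarith
  have ho2 : 1 / 2 ≤ o := by linarith
  set a := μ * o with ha
  have ha1 : a ∈ Icc (1 / 4 : ℝ) 1 := by
    have h1 : (1 / 2 : ℝ) * (1 / 2) ≤ μ * o := mul_le_mul hμ.1 ho2 (by norm_num) (by linarith [hμ.1])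
    exact ⟨by linarith, mul_le_one₀ hμ.2 (by linarith) ho1⟩
  -- Splitting off W' = φν isolates the prescribed normal part -τφν of P; the remaining correction d
  -- is O(s).
  set d := W - W' + k with hd
  have hds : ‖d‖ ≤ C₃ * s := (norm_add_le _ _).trans (by linarith)
  have hdK : ‖d‖ ≤ K := hds.trans (by rw [hK]; gcongr)
  set b := a • e - τ • d with hb
  have hPb : P = b + (r - τ * φ) • ν := by
    rw [hP, hb, hd, hW']; module
  set η : ℝ := ⟪e, ν⟫ with hη
  have hη0 : 0 < η := lt_of_lt_of_le (by positivity) hcs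
  have hη1 : η ≤ 1 := by
    have := real_inner_le_norm e ν
    rwa [he, hν, one_mul] at this
  have hsη : s ≤ η / c := by rw [le_div_iff₀ hc]; linarith
  have hdν : |⟪d, ν⟫| ≤ ‖d‖ := by
    have := abs_real_inner_le_norm d ν
    rwa [hν, mul_one] at this
  have hbν : ⟪b, ν⟫ = a * η - τ * ⟪d, ν⟫ := by
    rw [hb, inner_sub_left, real_inner_smul_left, real_inner_smul_left]
  have hτd : ‖τ • d‖ ≤ τ * K := by rw [norm_smul, Real.norm_of_nonneg hτ0.le]; gcongr
  have hae : ‖a • e‖ = a := by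
    rw [norm_smul, he, mul_one, Real.norm_of_nonneg (by linarith [ha1.1])]
  have hτdη : τ * ‖d‖ ≤ η / 8 := by
    calc τ * ‖d‖ ≤ τ * (C₃ * (η / c)) := by gcongr; exact hds.trans (by gcongr)
      _ = τ * (C₃ / c) * η := by ring
      _ ≤ 1 / 8 * η := by gcongr
      _ = η / 8 := by ring
  have hτdν : |τ * ⟪d, ν⟫| ≤ τ * ‖d‖ := by rw [abs_mul, abs_of_pos hτ0]; gcongr
  have hτdν' := abs_le.1 hτdν
  have hεsq : ε ^ 2 ≤ 1 := by
    have : 0 ≤ τ ^ 2 * ‖W‖ ^ 2 := by positivity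
    linarith [sq_nonneg μ]
  have haη : η / 4 ≤ a * η := by
    have := mul_le_mul_of_nonneg_right ha1.1 hη0.le
    linarith
  have haη' : a * η ≤ η := mul_le_of_le_one_left hη0.le ha1.2
  have hv := regNorm_mem_Icc_of_oblique hq hν hεsq ha1 hr hτ0.le hK0 hΛ hφ hτK
    (by have := norm_sub_le (a • e) (τ • d); rw [hae] at this; linarith)
    (by
      have := norm_sub_norm_le (a • e) (τ • d)
      rw [hae] at this; linarith)
    (by
      have : τ * ‖d‖ ≤ τ * K := mul_le_mul_of_nonneg_left hdK hτ0.le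
      rw [hbν]; linarith) hPb hbc
  set v := regNorm ε P with hvdef
  set Q : ℝ := ⟪P, ν⟫ with hQ
  have hQb : Q = ⟪b, ν⟫ + (r - τ * φ) := by
    rw [hQ, hPb, inner_add_left, real_inner_smul_left, hνν, mul_one]
  -- The excess of the normal derivative over its value at v = 1. The nonnegative multiplier r only
  -- increases it, and τ|d| ≤ η/8 leaves at least η/8 of aη ≥ η/4.
  set δ := Q + τ * φ with hδ
  have hδlow : η / 8 ≤ δ := by rw [hδ, hQb, hbν]; linarith
  have hδ0 : 0 < δ := by linarith
  have hPsq : ‖P‖ ^ 2 = ‖b‖ ^ 2 - ⟪b, ν⟫ ^ 2 + Q ^ 2 := by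
    rw [hQb, hPb, norm_add_sq_real, real_inner_smul_right, norm_smul, hν, Real.norm_eq_abs,
      mul_one, sq_abs]
    ring
  have hbsq : ‖b‖ ^ 2 = a ^ 2 - 2 * a * τ * ⟪e, d⟫ + τ ^ 2 * ‖d‖ ^ 2 := by
    rw [hb, norm_sub_sq_real, hae, norm_smul, real_inner_smul_left, real_inner_smul_right,
      Real.norm_of_nonneg hτ0.le]
    ring
  have hvsq : v ^ 2 = ε ^ 2 + ‖P‖ ^ 2 := sq_regNorm ε P
  -- The normalisation of μ cancels the terms of order one; everything left is O(s), O(η) or O(δ),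
  -- and s ≤ η/c.
  have hexp : v ^ 2 - 1 = (a ^ 2 - μ ^ 2) - 2 * a * τ * ⟪e, d⟫ + τ ^ 2 * ‖d‖ ^ 2 - ⟪b, ν⟫ ^ 2
      + δ * (Q - τ * φ) + τ ^ 2 * (φ ^ 2 - ‖W‖ ^ 2) := by
    rw [hvsq, hPsq, hbsq, hδ]
    linear_combination hε
  have x1 : |a ^ 2 - μ ^ 2| ≤ s / D := by
    have : a ^ 2 - μ ^ 2 = -(μ ^ 2 * ((1 - o) * (1 + o))) := by rw [ha]; ring
    rw [this, abs_neg, abs_of_nonneg (by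
      have : 0 ≤ 1 - o := by linarith
      have : 0 ≤ 1 + o := by linarith
      positivity)]
    have h1 : μ ^ 2 ≤ 1 := pow_le_one₀ (by linarith [hμ.1]) hμ.2
    have h2 : (1 - o) * (1 + o) ≤ s / D := by
      have : (1 - o) * (1 + o) ≤ (1 - o) * 2 :=
        mul_le_mul_of_nonneg_left (by linarith) (by linarith)
      linarith
    have h3 : 0 ≤ (1 - o) * (1 + o) := mul_nonneg (by linarith) (by linarith)
    calc _ ≤ 1 * (s / D) := by gcongr
      _ = s / D := one_mul _
  have x2 : |2 * a * τ * ⟪e, d⟫| ≤ 2 * C₃ * s := by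
    have h1 : |⟪e, d⟫| ≤ C₃ * s := by
      have := abs_real_inner_le_norm e d
      rw [he, one_mul] at this
      exact this.trans hds
    have ha0 : 0 ≤ a := by linarith [ha1.1]
    rw [abs_mul, abs_of_nonneg (by positivity)]
    calc 2 * a * τ * |⟪e, d⟫| ≤ 2 * 1 * 1 * (C₃ * s) := by
          gcongr
          exact ha1.2
      _ = 2 * C₃ * s := by ring
  have x3 : |τ ^ 2 * ‖d‖ ^ 2| ≤ C₃ * K * s := by
    rw [abs_of_nonneg (by positivity)]
    calc τ ^ 2 * ‖d‖ ^ 2 ≤ 1 ^ 2 * (‖d‖ * ‖d‖) := by rw [sq ‖d‖]; gcongr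
      _ ≤ 1 ^ 2 * ((C₃ * s) * K) := by gcongr
      _ = C₃ * K * s := by ring
  have x4 : |⟪b, ν⟫ ^ 2| ≤ (1 + K) * (1 + C₃ / c) * η := by
    have h1 : |⟪b, ν⟫| ≤ (1 + C₃ / c) * η := by
      rw [hbν]
      have h2 : τ * ‖d‖ ≤ C₃ / c * η := by
        calc τ * ‖d‖ ≤ 1 * (C₃ * (η / c)) := by gcongr; exact hds.trans (by gcongr)
          _ = C₃ / c * η := by ring
      have h3 : a * η ≥ 0 := by linarith
      rw [abs_le]; constructor <;> linarith
    have h2 : |⟪b, ν⟫| ≤ 1 + K := by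
      rw [hbν]
      have h2 : τ * ‖d‖ ≤ K := by
        calc τ * ‖d‖ ≤ 1 * K := by gcongr
          _ = K := one_mul _
      have h3 : a * η ≥ 0 := by linarith
      rw [abs_le]; constructor <;> linarith
    rw [abs_of_nonneg (sq_nonneg _), ← sq_abs, sq]
    calc |⟪b, ν⟫| * |⟪b, ν⟫| ≤ (1 + K) * ((1 + C₃ / c) * η) := by gcongr
      _ = _ := by ring
  have hτφ : |τ * φ| ≤ Λ := by
    rw [abs_mul, abs_of_pos hτ0]
    calc τ * |φ| ≤ 1 * Λ := by gcongr
      _ = Λ := one_mul _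
  have hQ5 : |Q| ≤ 5 := by
    have h1 := abs_real_inner_le_norm P ν
    rw [hν, mul_one] at h1
    exact h1.trans ((norm_le_regNorm ε P).trans hv.2)
  have x5 : |δ * (Q - τ * φ)| ≤ (5 + Λ) * δ := by
    rw [abs_mul, abs_of_pos hδ0, mul_comm]
    have := abs_sub Q (τ * φ)
    gcongr
    linarith
  have x6 : |τ ^ 2 * (φ ^ 2 - ‖W‖ ^ 2)| ≤ 2 * Λ * C₂ * s := by
    have h1 : φ ^ 2 = ‖W'‖ ^ 2 := by rw [hW', norm_smul, hν, mul_one, Real.norm_eq_abs, sq_abs]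
    have h2 : ‖W'‖ ≤ Λ := by rwa [hW', norm_smul, hν, mul_one, Real.norm_eq_abs]
    have h3 : |‖W'‖ - ‖W‖| ≤ C₂ * s := by
      rw [abs_sub_comm]; exact (abs_norm_sub_norm_le W W').trans hWW
    rw [h1, abs_mul, abs_of_nonneg (sq_nonneg τ), sq_sub_sq, abs_mul,
      abs_of_nonneg (show 0 ≤ ‖W'‖ + ‖W‖ by positivity)]
    calc τ ^ 2 * ((‖W'‖ + ‖W‖) * |‖W'‖ - ‖W‖|) ≤ 1 ^ 2 * ((Λ + Λ) * (C₂ * s)) := by gcongr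
      _ = 2 * Λ * C₂ * s := by ring
  have hvbound : |v ^ 2 - 1| ≤ M₁ * η + (5 + Λ) * δ := by
    have h1 : |v ^ 2 - 1| ≤ s / D + 2 * C₃ * s + C₃ * K * s + (1 + K) * (1 + C₃ / c) * η
        + (5 + Λ) * δ + 2 * Λ * C₂ * s := by
      rw [hexp]
      rw [abs_le] at x1 x2 x3 x4 x5 x6 ⊢
      constructor <;> linarith
    have h2 : (1 / D + 2 * C₃ + C₃ * K + 2 * Λ * C₂) * s
        ≤ (1 / D + 2 * C₃ + C₃ * K + 2 * Λ * C₂) * (η / c) := by gcongr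
    have h3 : M₁ * η = (1 / D + 2 * C₃ + C₃ * K + 2 * Λ * C₂) * (η / c)
        + (1 + K) * (1 + C₃ / c) * η := by rw [hM₁]; ring
    have h4 : (1 / D + 2 * C₃ + C₃ * K + 2 * Λ * C₂) * s
        = s / D + 2 * C₃ * s + C₃ * K * s + 2 * Λ * C₂ * s := by ring
    linarith
  have hv0 : 0 ≤ v := by linarith [hv.1]
  have hv1 : |v - 1| ≤ |v ^ 2 - 1| := by
    have : v ^ 2 - 1 = (v - 1) * (v + 1) := by ring
    rw [this, abs_mul]
    exact le_mul_of_one_le_right (abs_nonneg _) (by rw [abs_of_nonneg] <;> linarith)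
  have hpow : |v ^ (1 - q) - 1| ≤ Cq * |v - 1| := by
    have := (hCq v hv).2.2 1 (by norm_num)
    rwa [Real.one_rpow] at this
  have hδeq : δ = -(τ * φ) * (v ^ (1 - q) - 1) := by rw [hδ, hbc]; ring
  -- The boundary condition bounds δ by τ times |v^(1-q) - 1|, hence by τ times a multiple of η + δ;
  -- with η ≤ 8δ the inequality closes on δ.
  have hfin : δ ≤ τ * M * δ := by
    calc δ ≤ |δ| := le_abs_self δ
      _ = τ * |φ| * |v ^ (1 - q) - 1| := by
          rw [hδeq, abs_mul, abs_neg, abs_mul, abs_of_pos hτ0]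
      _ ≤ τ * Λ * (Cq * (M₁ * (8 * δ) + (5 + Λ) * δ)) := by
          gcongr
          refine hpow.trans ?_
          gcongr
          refine (hv1.trans hvbound).trans ?_
          gcongr
          linarith
      _ = τ * M * δ := by rw [hM]; ring
  have : τ * M * δ ≤ 1 / 2 * δ := by gcongr
  linarith

end BoundaryEstimate

/-! ### Derivatives of the test function. -/

section Calculus

/-- With c > 0 the point 0 would also be a local minimum, so h would be locally constant and c = 0.
-/
theorem IsLocalMax.second_deriv_nonpos {h h' : ℝ → ℝ} {c : ℝ} (hmax : IsLocalMax h 0)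
    (hd : ∀ᶠ t in 𝓝 (0 : ℝ), HasDerivAt h (h' t) t) (h2 : HasDerivAt h' c 0) : c ≤ 0 := by
  by_contra! hc
  have hdd : deriv h =ᶠ[𝓝 0] h' := hd.mono fun t ht => ht.deriv
  have e2 : deriv (deriv h) 0 = c := by rw [hdd.deriv_eq, h2.deriv]
  have hmin := isLocalMin_of_deriv_deriv_pos (f := h) (x₀ := 0) (by rw [e2]; exact hc)
    hmax.deriv_eq_zero hd.self_of_nhds.continuousAt
  have hconst : h =ᶠ[𝓝 0] fun _ => h 0 := by
    filter_upwards [hmax, hmin] with t h1 h2 using le_antisymm h1 h2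
  have e3 : deriv h =ᶠ[𝓝 0] fun _ => 0 := by
    have := hconst.deriv
    simpa using this
  rw [e3.deriv_eq] at e2
  simp at e2
  linarith

variable {n : ℕ}

local notation "𝔼" => EuclideanSpace ℝ (Fin n)

theorem ContDiffAt.line_derivs {w : 𝔼 → ℝ} {y : 𝔼} (hw : ContDiffAt ℝ 2 w y) (η : 𝔼) :
    (∀ᶠ t in 𝓝 (0 : ℝ), HasDerivAt (fun t : ℝ => w (y + t • η)) (fderiv ℝ w (y + t • η) η) t) ∧
      HasDerivAt (fun t : ℝ => fderiv ℝ w (y + t • η) η) (fderiv ℝ (fderiv ℝ w) y η η) 0 := by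
  have hline : ∀ t : ℝ, HasDerivAt (fun t : ℝ => y + t • η) η t := fun t => by
    simpa using ((hasDerivAt_id t).smul_const η).const_add y
  constructor
  · have h1 : ∀ᶠ z in 𝓝 y, ContDiffAt ℝ 2 w z := hw.eventually (by norm_num)
    have hc : Tendsto (fun t : ℝ => y + t • η) (𝓝 0) (𝓝 y) := by
      have := (hline 0).continuousAt.tendsto
      simpa using this
    filter_upwards [hc.eventually h1] with t ht
    exact (ht.differentiableAt (by norm_num)).hasFDerivAt.comp_hasDerivAt t (hline t)
  · have h1 : HasFDerivAt (fderiv ℝ w) (fderiv ℝ (fderiv ℝ w) y) (y + (0 : ℝ) • η) := by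
      rw [zero_smul, add_zero]
      exact ((hw.fderiv_right (m := 1) (by norm_num)).differentiableAt (by norm_num)).hasFDerivAt
    have h2 := h1.comp_hasDerivAt (0 : ℝ) (hline 0)
    simpa using h2.clm_apply (hasDerivAt_const (0 : ℝ) η)

/-- The two-point test function. -/
def twoPoint (D τ μ : ℝ) (W w x y : EuclideanSpace ℝ (Fin n)) : ℝ :=
  μ * (‖y - x‖ - ‖y - x‖ ^ 2 / (4 * D)) - τ * ⟪W, y - x⟫
    + τ * ‖w - (1 / 2 : ℝ) • (x + y)‖ ^ 2

theorem HasFDerivAt.hasGradientAt_of_forall {w : 𝔼 → ℝ} {L : 𝔼 →L[ℝ] ℝ} {g y : 𝔼}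
    (h : HasFDerivAt w L y) (hL : ∀ v, L v = ⟪g, v⟫) : HasGradientAt w g y := by
  have e : L = InnerProductSpace.toDual ℝ 𝔼 g := by
    ext v
    rw [hL, InnerProductSpace.toDual_apply_apply]
  rw [e] at h
  exact h

theorem HasGradientAt.hasFDerivAt_innerSL {w : 𝔼 → ℝ} {g y : 𝔼} (h : HasGradientAt w g y) :
    HasFDerivAt w (innerSL ℝ g) y := h

theorem hasFDerivAt_norm_sub_sq (x y : 𝔼) :
    HasFDerivAt (fun y => ‖y - x‖ ^ 2) ((2 : ℝ) • innerSL ℝ (y - x)) y := by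
  have h : HasFDerivAt (fun y : 𝔼 => y - x) (ContinuousLinearMap.id ℝ 𝔼) y :=
    (hasFDerivAt_id y).sub_const x
  refine h.norm_sq.congr_fderiv ?_
  ext v
  simp [two_mul]

theorem hasGradientAt_norm_sub {x y : 𝔼} (hxy : x ≠ y) :
    HasGradientAt (fun y => ‖y - x‖) (‖y - x‖⁻¹ • (y - x)) y := by
  have hne : ‖y - x‖ ≠ 0 := norm_ne_zero_iff.2 (sub_ne_zero.2 hxy.symm)
  have h2 := (hasFDerivAt_norm_sub_sq x y).sqrt (by positivity)
  have e : (fun y => √(‖y - x‖ ^ 2)) = fun y => ‖y - x‖ := by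
    ext z; rw [Real.sqrt_sq (norm_nonneg _)]
  rw [e] at h2
  refine h2.hasGradientAt_of_forall fun v => ?_
  rw [Real.sqrt_sq (norm_nonneg _), real_inner_smul_left, smul_apply, smul_apply,
    innerSL_apply_apply, smul_eq_mul, smul_eq_mul]
  field_simp

/-- Reduces derivatives in x to derivatives in y, at the price of changing the sign of W. -/
theorem twoPoint_swap (D τ μ : ℝ) (W w x y : 𝔼) :
    twoPoint D τ μ W w x y = twoPoint D τ μ (-W) w y x := by
  rw [twoPoint, twoPoint, norm_sub_rev, add_comm x y, ← neg_sub x y, inner_neg_right,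
    inner_neg_left]

theorem hasGradientAt_twoPoint_right {D : ℝ} (τ μ : ℝ) (W w : 𝔼) {x y : 𝔼} (hxy : x ≠ y) :
    HasGradientAt (fun y => twoPoint D τ μ W w x y)
      ((μ * (1 - ‖y - x‖ / (2 * D))) • (‖y - x‖⁻¹ • (y - x)) - τ • W
        - τ • (w - (1 / 2 : ℝ) • (x + y))) y := by
  have hne : ‖y - x‖ ≠ 0 := norm_ne_zero_iff.2 (sub_ne_zero.2 hxy.symm)
  have h1 := (hasGradientAt_norm_sub hxy).hasFDerivAt_innerSL
  have h2 := hasFDerivAt_norm_sub_sq x y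
  have h3 : HasFDerivAt (fun y => ⟪W, y - x⟫) (innerSL ℝ W) y :=
    (innerSL ℝ W).hasFDerivAt.comp y ((hasFDerivAt_id y).sub_const x)
  have h4 : HasFDerivAt (fun y => ‖w - (1 / 2 : ℝ) • (x + y)‖ ^ 2)
      (-innerSL ℝ (w - (1 / 2 : ℝ) • (x + y))) y := by
    have h : HasFDerivAt (fun y : 𝔼 => w - (1 / 2 : ℝ) • (x + y))
        (-((1 / 2 : ℝ) • ContinuousLinearMap.id ℝ 𝔼)) y :=
      (((hasFDerivAt_id y).const_add x).const_smul (1 / 2 : ℝ)).const_sub w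
    refine h.norm_sq.congr_fderiv ?_
    ext v
    simp only [nsmul_eq_mul, smul_apply, neg_apply, ContinuousLinearMap.comp_apply,
      ContinuousLinearMap.id_apply, innerSL_apply_apply, inner_neg_right, real_inner_smul_right]
    push_cast
    ring
  have h5 := (((h1.sub (h2.mul_const (1 / (4 * D)))).const_mul μ).sub (h3.const_mul τ)).add
    (h4.const_mul τ)
  refine (h5.congr_of_eventuallyEq (Eventually.of_forall fun z => ?_)).hasGradientAt_of_forall
    fun v => ?_
  · simp only [twoPoint, Pi.add_apply, Pi.sub_apply]
    ring
  · simp only [innerSL_apply_apply, real_inner_smul_left, smul_apply, sub_apply, add_apply,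
      neg_apply, inner_sub_left, smul_eq_mul]
    have e : 1 / (4 * D) * (2 * (⟪y, v⟫ - ⟪x, v⟫)) = (‖y - x‖ / (2 * D))
        * (‖y - x‖⁻¹ * (⟪y, v⟫ - ⟪x, v⟫)) := by
      have e0 : ∀ b : ℝ, ‖y - x‖ / (2 * D) * (‖y - x‖⁻¹ * b)
          = (‖y - x‖ * ‖y - x‖⁻¹) * (b / (2 * D)) := fun b => by ring
      rw [e0, mul_inv_cancel₀ hne, show 4 * D = 2 * (2 * D) by ring, one_div, mul_inv]
      ring
    rw [e]
    ring

theorem hasGradientAt_twoPoint_left {D : ℝ} (τ μ : ℝ) (W w : 𝔼) {x y : 𝔼} (hxy : x ≠ y) :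
    HasGradientAt (fun x => twoPoint D τ μ W w x y)
      (-((μ * (1 - ‖y - x‖ / (2 * D))) • (‖y - x‖⁻¹ • (y - x)) - τ • W
        + τ • (w - (1 / 2 : ℝ) • (x + y)))) x := by
  have h := hasGradientAt_twoPoint_right (D := D) τ μ (-W) w hxy.symm
  have e : (fun x => twoPoint D τ μ W w x y) = fun x => twoPoint D τ μ (-W) w y x := by
    ext x; rw [twoPoint_swap]
  rw [e]
  have e2 : ∀ a : ℝ, -(a • (‖y - x‖⁻¹ • (y - x)) - τ • W + τ • (w - (1 / 2 : ℝ) • (x + y)))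
      = a • (‖x - y‖⁻¹ • (x - y)) - τ • -W - τ • (w - (1 / 2 : ℝ) • (y + x)) := by
    intro a
    rw [norm_sub_rev y x, add_comm x y, ← neg_sub x y]
    module
  rw [e2, norm_sub_rev y x]
  exact h

theorem hasDerivAt_norm_line {h ζ : 𝔼} {t : ℝ} (hne : h + t • ζ ≠ 0) :
    HasDerivAt (fun t : ℝ => ‖h + t • ζ‖) (‖h + t • ζ‖⁻¹ * ⟪h + t • ζ, ζ⟫) t := by
  have hline : HasDerivAt (fun t : ℝ => h + t • ζ) ζ t := by
    simpa using ((hasDerivAt_id t).smul_const ζ).const_add h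
  have h1 := (hasGradientAt_norm_sub (x := 0) hne.symm).hasFDerivAt_innerSL
  have h2 := h1.comp_hasDerivAt t hline
  simp only [Function.comp_def, sub_zero, innerSL_apply_apply, real_inner_smul_left] at h2
  exact h2

/-- The W term is affine along the line, so only the distance profile and the penalty contribute to
the second derivative. -/
theorem twoPoint_line_derivs {D : ℝ} (hD : D ≠ 0) (τ μ : ℝ) (W w : 𝔼) {x y : 𝔼} (hxy : x ≠ y)
    (ξ η : 𝔼) : ∃ d : ℝ → ℝ,
      (∀ᶠ t in 𝓝 (0 : ℝ), HasDerivAt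
        (fun t : ℝ => twoPoint D τ μ W w (x + t • ξ) (y + t • η)) (d t) t) ∧
      HasDerivAt d (μ * ((‖η - ξ‖ ^ 2 - ⟪‖y - x‖⁻¹ • (y - x), η - ξ⟫ ^ 2) / ‖y - x‖
        - ‖η - ξ‖ ^ 2 / (2 * D)) + τ * ‖ξ + η‖ ^ 2 / 2) 0 := by
  have hh0 : y - x ≠ 0 := sub_ne_zero.2 hxy.symm
  have hs0 : ‖y - x‖ ≠ 0 := norm_ne_zero_iff.2 hh0
  set h := y - x with hh
  set ζ := η - ξ with hζ
  set k := w - (1 / 2 : ℝ) • (x + y) with hk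
  set l := -(1 / 2 : ℝ) • (ξ + η) with hl
  have hnsq : ∀ (a b : 𝔼) (t : ℝ), HasDerivAt (fun t : ℝ => ‖a + t • b‖ ^ 2)
      (2 * ⟪a, b⟫ + 2 * t * ‖b‖ ^ 2) t := by
    intro a b t
    have e : (fun t : ℝ => ‖a + t • b‖ ^ 2)
        = fun t => ‖a‖ ^ 2 + t * (2 * ⟪a, b⟫) + t ^ 2 * ‖b‖ ^ 2 := by
      ext t
      rw [norm_add_sq_real, real_inner_smul_right, norm_smul, mul_pow, Real.norm_eq_abs, sq_abs]
      ring
    rw [e]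
    have h1 : HasDerivAt (fun t : ℝ => t * (2 * ⟪a, b⟫)) (1 * (2 * ⟪a, b⟫)) t :=
      (hasDerivAt_id' t).mul_const _
    have h2 : HasDerivAt (fun t : ℝ => t ^ 2 * ‖b‖ ^ 2) (2 * t * ‖b‖ ^ 2) t := by
      simpa using (hasDerivAt_pow 2 t).mul_const (‖b‖ ^ 2)
    exact ((h1.const_add (‖a‖ ^ 2)).add h2).congr_deriv (by ring)
  have hform : (fun t : ℝ => twoPoint D τ μ W w (x + t • ξ) (y + t • η)) = fun t =>
      μ * (‖h + t • ζ‖ - ‖h + t • ζ‖ ^ 2 / (4 * D)) - (τ * ⟪W, h⟫ + t * (τ * ⟪W, ζ⟫))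
        + τ * ‖k + t • l‖ ^ 2 := by
    ext t
    have e1 : y + t • η - (x + t • ξ) = h + t • ζ := by rw [hh, hζ]; module
    have e2 : w - (1 / 2 : ℝ) • (x + t • ξ + (y + t • η)) = k + t • l := by
      rw [hk, hl]; module
    rw [twoPoint, e1, e2, inner_add_right, real_inner_smul_right]
    ring
  refine ⟨fun t => μ * (‖h + t • ζ‖⁻¹ * ⟪h + t • ζ, ζ⟫
    - (2 * ⟪h, ζ⟫ + 2 * t * ‖ζ‖ ^ 2) / (4 * D)) - (τ * ⟪W, ζ⟫)
    + τ * (2 * ⟪k, l⟫ + 2 * t * ‖l‖ ^ 2), ?_, ?_⟩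
  · rw [hform]
    have hev : ∀ᶠ t in 𝓝 (0 : ℝ), h + t • ζ ≠ 0 := by
      have hc : ContinuousAt (fun t : ℝ => h + t • ζ) 0 := by fun_prop
      exact hc.eventually_ne (by simpa using hh0)
    filter_upwards [hev] with t ht
    have h1 := hasDerivAt_norm_line ht
    have h2 := (hnsq h ζ t).div_const (4 * D)
    have h3 : HasDerivAt (fun t : ℝ => t * (τ * ⟪W, ζ⟫)) (1 * (τ * ⟪W, ζ⟫)) t :=
      (hasDerivAt_id' t).mul_const _
    have h4 := hnsq k l t
    exact ((((h1.sub h2).const_mul μ).sub (h3.const_add (τ * ⟪W, h⟫))).add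
      (h4.const_mul τ)).congr_deriv (by ring)
  · have h1 := (hasDerivAt_norm_line (h := h) (ζ := ζ) (t := 0) (by simpa using hh0)).inv
      (by simpa using hs0)
    have h2 : HasDerivAt (fun t : ℝ => ⟪h + t • ζ, ζ⟫) (‖ζ‖ ^ 2) 0 := by
      have e : (fun t : ℝ => ⟪h + t • ζ, ζ⟫) = fun t => ⟪h, ζ⟫ + t * ‖ζ‖ ^ 2 := by
        ext t
        rw [inner_add_left, real_inner_smul_left, real_inner_self_eq_norm_sq]
      rw [e]
      exact (((hasDerivAt_id' (0 : ℝ)).mul_const (‖ζ‖ ^ 2)).const_add _).congr_deriv (by ring)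
    have hlin : ∀ a b : ℝ, HasDerivAt (fun t : ℝ => 2 * a + 2 * t * b) (2 * b) 0 := by
      intro a b
      exact ((((hasDerivAt_id' (0 : ℝ)).const_mul 2).mul_const b).const_add (2 * a)).congr_deriv
        (by ring)
    have h3 := (hlin ⟪h, ζ⟫ (‖ζ‖ ^ 2)).div_const (4 * D)
    have h4 := hlin ⟪k, l⟫ (‖l‖ ^ 2)
    refine (((((h1.mul h2).sub h3).const_mul μ).sub_const (τ * ⟪W, ζ⟫)).add
      (h4.const_mul τ)).congr_deriv ?_
    have e1 : ‖l‖ ^ 2 = ‖ξ + η‖ ^ 2 / 4 := by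
      rw [hl, norm_smul, mul_pow]; norm_num; ring
    rw [e1]
    simp only [zero_smul, add_zero, real_inner_smul_left, Pi.inv_apply]
    field_simp
    ring

end Calculus

/-! ### Optimality conditions, the expanded equation and its scaling. -/

section Equation

variable {n : ℕ}

local notation "𝔼" => EuclideanSpace ℝ (Fin n)

/-- Second-order condition at an interior maximum of `w(y) - w(x) - m ψ(x, y)`. -/
theorem IsLocalMax.twoPoint_hessian_le {D m : ℝ} (hD : D ≠ 0) {τ μ : ℝ} {W z x y : 𝔼}
    (hxy : x ≠ y) {w : 𝔼 → ℝ} (hx : ContDiffAt ℝ 2 w x) (hy : ContDiffAt ℝ 2 w y)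
    (hmax : IsLocalMax (fun q : 𝔼 × 𝔼 => w q.2 - w q.1 - m * twoPoint D τ μ W z q.1 q.2) (x, y))
    (ξ η : 𝔼) :
    fderiv ℝ (fderiv ℝ w) y η η - fderiv ℝ (fderiv ℝ w) x ξ ξ ≤
      m * (μ * ((‖η - ξ‖ ^ 2 - ⟪‖y - x‖⁻¹ • (y - x), η - ξ⟫ ^ 2) / ‖y - x‖
        - ‖η - ξ‖ ^ 2 / (2 * D)) + τ * ‖ξ + η‖ ^ 2 / 2) := by
  obtain ⟨d, hd, hd2⟩ := twoPoint_line_derivs hD τ μ W z hxy ξ η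
  obtain ⟨hx1, hx2⟩ := hx.line_derivs ξ
  obtain ⟨hy1, hy2⟩ := hy.line_derivs η
  have hc : ContinuousAt (fun t : ℝ => ((x + t • ξ, y + t • η) : 𝔼 × 𝔼)) 0 := by fun_prop
  have hmax' : IsLocalMax (fun t : ℝ => w (y + t • η) - w (x + t • ξ)
      - m * twoPoint D τ μ W z (x + t • ξ) (y + t • η)) 0 := by
    have h1 : Tendsto (fun t : ℝ => ((x + t • ξ, y + t • η) : 𝔼 × 𝔼)) (𝓝 0) (𝓝 (x, y)) := by
      have := hc.tendsto
      simpa using this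
    filter_upwards [h1.eventually hmax] with t ht
    simpa using ht
  have hlast := hmax'.second_deriv_nonpos
    (h' := fun t => fderiv ℝ w (y + t • η) η - fderiv ℝ w (x + t • ξ) ξ - m * d t)
    (by
      filter_upwards [hd, hx1, hy1] with t h1 h2 h3
      exact (h3.sub h2).sub (h1.const_mul m))
    ((hy2.sub hx2).sub (hd2.const_mul m))
  linarith

/-- Segments from x stay in the convex set, so y - x is an admissible direction even when x is a
boundary point. -/
theorem inner_le_of_isMaxOn {S : Set 𝔼} (hS : Convex ℝ S) {g : 𝔼 → ℝ} {ζ x y : 𝔼}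
    (hg : HasGradientWithinAt g ζ S x) (hmax : IsMaxOn g S x) (hx : x ∈ S) (hy : y ∈ S) :
    ⟪ζ, y - x⟫ ≤ 0 := by
  have h := hmax.localize.hasFDerivWithinAt_nonpos hg.hasFDerivWithinAt
    (sub_mem_posTangentConeAt_of_segment_subset (hS.segment_subset hx hy))
  rwa [InnerProductSpace.toDual_apply_apply] at h

theorem divergence_eq_flux {p ε : ℝ} (hε : 0 < ε) {w : 𝔼 → ℝ} {x : 𝔼} (hw : ContDiffAt ℝ 2 w x)
    {G : 𝔼 → 𝔼} (hG : G =ᶠ[𝓝 x] gradient w) :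
    divergence (fun y => regNorm ε (G y) ^ (p - 2) • G y) x
      = flux p ε (G x) (fderiv ℝ (fderiv ℝ w) x) := by
  set Y := fderiv ℝ (fderiv ℝ w) x with hY
  have hdd : HasFDerivAt (fderiv ℝ w) Y x :=
    ((hw.fderiv_right (m := 1) (by norm_num)).differentiableAt (by norm_num)).hasFDerivAt
  -- The inverse Riesz isomorphism, packaged as a real-linear map so that it composes with the
  -- second derivative.
  set T : (𝔼 →L[ℝ] ℝ) →L[ℝ] 𝔼 :=
    LinearMap.toContinuousLinearMap
      { toFun := fun L => (InnerProductSpace.toDual ℝ 𝔼).symm L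
        map_add' := fun L L' => map_add _ L L'
        map_smul' := fun r L => by simp } with hT
  have hTin : ∀ (L : 𝔼 →L[ℝ] ℝ) (v : 𝔼), ⟪T L, v⟫ = L v := fun L v =>
    by simp [hT]
  have hGd : HasFDerivAt G (T.comp Y) x := by
    have h1 : HasFDerivAt (gradient w) (T.comp Y) x := T.hasFDerivAt.comp x hdd
    exact h1.congr_of_eventuallyEq hG
  have hpos : 0 < ε ^ 2 + ‖G x‖ ^ 2 := by positivity
  have hreg : ∀ (ξ : 𝔼) (r : ℝ), regNorm ε ξ ^ r = (ε ^ 2 + ‖ξ‖ ^ 2) ^ (r / 2) := by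
    intro ξ r
    rw [regNorm, Real.sqrt_eq_rpow, ← Real.rpow_mul (by positivity)]
    congr 1
    ring
  have hN : HasFDerivAt (fun y => ε ^ 2 + ‖G y‖ ^ 2) (2 • (innerSL ℝ (G x)).comp (T.comp Y)) x :=
    hGd.norm_sq.const_add (ε ^ 2)
  have hP := hN.rpow_const (p := (p - 2) / 2) (Or.inl hpos.ne')
  have hX := hP.smul hGd
  have e : (fun y => regNorm ε (G y) ^ (p - 2) • G y)
      = fun y => (ε ^ 2 + ‖G y‖ ^ 2) ^ ((p - 2) / 2) • G y := by
    ext1 y; rw [hreg]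
  have hXe : fderiv ℝ (fun y => (ε ^ 2 + ‖G y‖ ^ 2) ^ ((p - 2) / 2) • G y) x = _ := hX.fderiv
  have happ : ∀ v, fderiv ℝ (fun y => (ε ^ 2 + ‖G y‖ ^ 2) ^ ((p - 2) / 2) • G y) x v
      = (ε ^ 2 + ‖G x‖ ^ 2) ^ ((p - 2) / 2) • T (Y v)
        + (((p - 2) / 2 * (ε ^ 2 + ‖G x‖ ^ 2) ^ ((p - 2) / 2 - 1)) * (2 * Y v (G x))) • G x := by
    intro v
    rw [hXe, ← hTin (Y v) (G x), real_inner_comm]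
    simp only [add_apply, smul_apply, ContinuousLinearMap.comp_apply,
      ContinuousLinearMap.smulRight_apply, innerSL_apply_apply, smul_eq_mul, nsmul_eq_mul,
      Nat.cast_ofNat]
  have hcoord : ∀ (v : 𝔼) (i : Fin n), v i = ⟪v, EuclideanSpace.single i (1 : ℝ)⟫ := by
    intro v i
    rw [EuclideanSpace.inner_single_right]; simp
  have hterm : ∀ i, (fderiv ℝ (fun y => (ε ^ 2 + ‖G y‖ ^ 2) ^ ((p - 2) / 2) • G y) x
      (EuclideanSpace.single i (1 : ℝ))) i
      = regNorm ε (G x) ^ (p - 2) * Y (EuclideanSpace.single i 1) (EuclideanSpace.single i 1)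
        + (p - 2) * regNorm ε (G x) ^ (p - 4) * (G x i * Y (EuclideanSpace.single i 1) (G x)) := by
    intro i
    rw [happ, hreg, hreg, PiLp.add_apply, PiLp.smul_apply, PiLp.smul_apply,
      hcoord (T (Y (EuclideanSpace.single i 1))) i, hTin,
      show (p - 2) / 2 - 1 = (p - 4) / 2 by ring, smul_eq_mul, smul_eq_mul]
    ring
  rw [divergence, e]
  have hsum : ∑ i, G x i * Y (EuclideanSpace.single i 1) (G x) = Y (G x) (G x) := by
    have : ∑ i, G x i * Y (EuclideanSpace.single i 1) (G x)
        = Y (∑ i, G x i • EuclideanSpace.single i (1 : ℝ)) (G x) := by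
      simp only [map_sum, sum_apply, map_smul, smul_apply, smul_eq_mul]
    rw [this, sum_smul_single]
  rw [Finset.sum_congr rfl fun i _ => hterm i, Finset.sum_add_distrib, ← Finset.mul_sum,
    ← Finset.mul_sum, hsum, flux, bilinTrace]

theorem regNorm_smul {m : ℝ} (hm : 0 < m) (ε : ℝ) (P : 𝔼) :
    regNorm ε (m • P) = m * regNorm (ε / m) P := by
  rw [regNorm, regNorm, norm_smul, Real.norm_of_nonneg hm.le]
  have e : ε ^ 2 + (m * ‖P‖) ^ 2 = m ^ 2 * ((ε / m) ^ 2 + ‖P‖ ^ 2) := by field_simp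
  rw [e, Real.sqrt_mul (sq_nonneg m), Real.sqrt_sq hm.le]

/-- Dividing u by m replaces ε by ε/m and extracts the factor m^(p-1) that eventually dominates the
source. -/
theorem flux_smul {m : ℝ} (hm : 0 < m) (p ε : ℝ) (P : 𝔼) (Y : 𝔼 →L[ℝ] 𝔼 →L[ℝ] ℝ) :
    flux p ε (m • P) Y = m ^ (p - 1) * flux p (ε / m) P (m⁻¹ • Y) := by
  have hv : 0 ≤ regNorm (ε / m) P := Real.sqrt_nonneg _
  have e1 : m ^ (p - 2) = m ^ (p - 1) * m⁻¹ := by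
    rw [← Real.rpow_neg_one m, ← Real.rpow_add hm]; congr 1; ring
  have e2 : m ^ (p - 4) * m ^ 2 = m ^ (p - 1) * m⁻¹ := by
    rw [← e1, ← Real.rpow_natCast m 2, ← Real.rpow_add hm]; congr 1; push_cast; ring
  rw [flux, flux, regNorm_smul hm, Real.mul_rpow hm.le hv, Real.mul_rpow hm.le hv, e1]
  simp only [bilinTrace, map_smul, smul_apply, smul_eq_mul, ← Finset.mul_sum]
  linear_combination ((p - 2) * regNorm (ε / m) P ^ (p - 4) * Y P P) * e2

end Equation

/-! ### Space and time slices of a solution. -/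

section Slices

variable {n : ℕ} {Ω : Set (EuclideanSpace ℝ (Fin n))} {u : EuclideanSpace ℝ (Fin n) → ℝ → ℝ}
  {σ : ℝ}

theorem spatialGradient_eq_gradient {x : EuclideanSpace ℝ (Fin n)} (hx : closure Ω ∈ 𝓝 x) (t : ℝ) :
    spatialGradient Ω u x t = gradient (fun y => u y t) x := by
  rw [spatialGradient, gradientWithin, gradient, fderivWithin_of_mem_nhds hx]

theorem IsParabolicC2Holder.contDiffAt (hu : IsParabolicC2Holder σ Ω u) (hΩ : IsOpen Ω)
    {x : EuclideanSpace ℝ (Fin n)} (hx : x ∈ Ω) {t : ℝ} (ht : 0 ≤ t) :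
    ContDiffAt ℝ 2 (fun y => u y t) x :=
  (hu.contDiffOn_space t ht).contDiffAt
    (mem_of_superset (hΩ.mem_nhds hx) subset_closure)

theorem IsParabolicC2Holder.hasGradientWithinAt (hu : IsParabolicC2Holder σ Ω u)
    {x : EuclideanSpace ℝ (Fin n)} (hx : x ∈ closure Ω) {t : ℝ} (ht : 0 ≤ t) :
    HasGradientWithinAt (fun y => u y t) (spatialGradient Ω u x t) (closure Ω) x :=
  ((hu.contDiffOn_space t ht).differentiableOn (by norm_num) x hx).hasGradientWithinAt

theorem IsParabolicC2Holder.hasDerivAt_time (hu : IsParabolicC2Holder σ Ω u)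
    {x : EuclideanSpace ℝ (Fin n)} (hx : x ∈ closure Ω) {t : ℝ} (ht : 0 < t) :
    HasDerivAt (u x) (timeDeriv u x t) t :=
  ((hu.differentiableOn_time x hx t ht.le).hasDerivWithinAt).hasDerivAt (Ici_mem_nhds ht)

theorem IsRegularizedSolution.timeDeriv_eq_flux {p q ε : ℝ} {f : EuclideanSpace ℝ (Fin n) → ℝ → ℝ}
    {φ u₀ : EuclideanSpace ℝ (Fin n) → ℝ} (h : IsRegularizedSolution Ω p q ε f φ u₀ u)
    (hu : IsParabolicC2Holder σ Ω u)
    (hΩ : IsOpen Ω) (hε : 0 < ε) {x : EuclideanSpace ℝ (Fin n)} (hx : x ∈ Ω) {t : ℝ} (ht : 0 ≤ t) :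
    timeDeriv u x t = flux p ε (spatialGradient Ω u x t)
      (fderiv ℝ (fderiv ℝ fun y => u y t) x) + f x (u x t) := by
  rw [h.equation x hx t ht, divergence_eq_flux hε (hu.contDiffAt hΩ hx ht)
    (G := fun y => spatialGradient Ω u y t)]
  filter_upwards [hΩ.mem_nhds hx] with y hy
  exact spatialGradient_eq_gradient (mem_of_superset (hΩ.mem_nhds hy) subset_closure) t

/-- The maximum may occur at the final time T, so only comparison with earlier times is used. -/
theorem nonneg_deriv_of_isMaxOn_Icc {g : ℝ → ℝ} {a t T : ℝ} (hg : HasDerivAt g a t) (ht : 0 < t)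
    (htT : t ≤ T) (hmax : ∀ s ∈ Icc 0 T, g s ≤ g t) : 0 ≤ a := by
  have hm : IsMaxOn g (Icc 0 t) t := fun s hs => hmax s ⟨hs.1, hs.2.trans htT⟩
  have h := hm.localize.hasFDerivWithinAt_nonpos hg.hasFDerivAt.hasFDerivWithinAt
    (sub_mem_posTangentConeAt_of_segment_subset
      ((convex_Icc 0 t).segment_subset (right_mem_Icc.2 ht.le) (left_mem_Icc.2 ht.le)))
  simp only [zero_sub, ContinuousLinearMap.toSpanSingleton_apply, smul_eq_mul] at h
  nlinarith

end Slices

/-! ### Extension of the boundary data. -/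

section BoundaryField

variable {n : ℕ} {β : ℝ} {Ω : Set (EuclideanSpace ℝ (Fin n))}

/-- The infimum need not be attained; the extra 1 makes the inequality strict and so yields an
actual extension. -/
theorem exists_extension_of_boundaryC2Norm_le {L : ℝ} {φ : EuclideanSpace ℝ (Fin n) → ℝ}
    (hφ : boundaryC2Norm Ω φ ≤ ENNReal.ofReal L) :
    ∃ Φ : EuclideanSpace ℝ (Fin n) → ℝ, ContDiff ℝ 2 Φ ∧ EqOn Φ φ (frontier Ω) ∧
      (∀ x ∈ closure Ω, ‖Φ x‖ ≤ max L 0 + 1) ∧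
      ∀ x ∈ closure Ω, ‖fderiv ℝ Φ x‖ ≤ max L 0 + 1 := by
  have hA : ENNReal.ofReal L < ENNReal.ofReal (max L 0 + 1) := by
    rw [ENNReal.ofReal_lt_ofReal_iff (by positivity)]
    linarith [le_max_left L 0]
  have h := hφ.trans_lt hA
  rw [boundaryC2Norm] at h
  simp only [iInf_lt_iff] at h
  obtain ⟨Φ, hC, he, h⟩ := h
  have key : ∀ {F : Type} [NormedAddCommGroup F] (g : EuclideanSpace ℝ (Fin n) → F),
      (⨆ x ∈ closure Ω, ‖g x‖ₑ) ≤ ENNReal.ofReal (max L 0 + 1) →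
      ∀ x ∈ closure Ω, ‖g x‖ ≤ max L 0 + 1 := by
    intro F _ g hg x hx
    have h1 : ‖g x‖ₑ ≤ ENNReal.ofReal (max L 0 + 1) :=
      (le_iSup₂ (f := fun x (_ : x ∈ closure Ω) => ‖g x‖ₑ) x hx).trans hg
    rw [← ofReal_norm, ENNReal.ofReal_le_ofReal_iff (by positivity)] at h1
    exact h1
  refine ⟨Φ, hC, he, key Φ ?_, key (fderiv ℝ Φ) ?_⟩
  · exact (le_self_add.trans le_self_add).trans h.le
  · exact (le_add_self.trans le_self_add).trans h.le

/-- The boundary data times the normal extends to a Lipschitz field on the closure. -/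
theorem IsStrictlyConvexDomain.exists_boundary_field (hΩ : IsStrictlyConvexDomain β Ω) (L : ℝ) :
    ∃ Λ : ℝ, 0 ≤ Λ ∧ ∀ φ : EuclideanSpace ℝ (Fin n) → ℝ,
      boundaryC2Norm Ω φ ≤ ENNReal.ofReal L →
      ∃ W : EuclideanSpace ℝ (Fin n) → EuclideanSpace ℝ (Fin n),
        (∀ w ∈ closure Ω, ‖W w‖ ≤ Λ) ∧
        (∀ w ∈ closure Ω, ∀ w' ∈ closure Ω, ‖W w - W w'‖ ≤ Λ * ‖w - w'‖) ∧
        ∀ x ∈ frontier Ω, |φ x| ≤ Λ ∧ ∃ ν, IsInwardUnitNormal Ω x ν ∧ W x = φ x • ν := by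
  obtain ⟨K, N, hN, hNν⟩ := hΩ.exists_lipschitz_normal
  obtain ⟨B, hB⟩ := hΩ.isCompact_closure.exists_bound_of_continuousOn hN.continuous.continuousOn
  set A := max L 0 + 1 with hA
  have hA0 : 0 ≤ A := by positivity
  have hB' : ∀ w ∈ closure Ω, ‖N w‖ ≤ max B 0 := fun w hw => (hB w hw).trans (le_max_left _ _)
  have hB0 : 0 ≤ max B 0 := le_max_right _ _
  refine ⟨A * (max B 0 + K) + A, by positivity, fun φ hφ => ?_⟩
  obtain ⟨Φ, hC, he, hΦ, hdΦ⟩ := exists_extension_of_boundaryC2Norm_le hφ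
  refine ⟨fun w => Φ w • N w, ?_, ?_, ?_⟩
  · intro w hw
    rw [norm_smul]
    have := mul_le_mul (hΦ w hw) (hB' w hw) (norm_nonneg _) hA0
    nlinarith [mul_nonneg hA0 K.coe_nonneg]
  · intro w hw w' hw'
    have h1 : ‖Φ w - Φ w'‖ ≤ A * ‖w - w'‖ :=
      hΩ.convex.closure.norm_image_sub_le_of_norm_fderiv_le
        (fun x _ => (hC.differentiable (by norm_num)) x) hdΦ hw' hw
    have h2 : ‖N w - N w'‖ ≤ K * ‖w - w'‖ := hN.norm_sub_le w w'
    have e : Φ w • N w - Φ w' • N w' = Φ w • (N w - N w') + (Φ w - Φ w') • N w' := by module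
    simp only [e]
    refine (norm_add_le _ _).trans ?_
    rw [norm_smul, norm_smul]
    have h3 := mul_le_mul (hΦ w hw) h2 (norm_nonneg _) hA0
    have h4 := mul_le_mul h1 (hB' w' hw') (norm_nonneg _) (by positivity)
    nlinarith [mul_nonneg hA0 (norm_nonneg (w - w'))]
  · intro x hx
    refine ⟨?_, N x, hNν x hx, ?_⟩
    · rw [← he hx, ← Real.norm_eq_abs]
      have := hΦ x hx.1
      have : 0 ≤ A * (max B 0 + K) := by positivity
      linarith
    · simp only [he hx]

end BoundaryField

/-! ### The amplitude, the auxiliary point, and the rescaled boundary condition. -/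

section Contradiction

variable {n : ℕ}

local notation "𝔼" => EuclideanSpace ℝ (Fin n)

/-- The amplitude of the principal part of the test function. -/
def amplitude (δ τ : ℝ) (V : EuclideanSpace ℝ (Fin n)) : ℝ := √(1 - δ ^ 2 - τ ^ 2 * ‖V‖ ^ 2)

section Amplitude

variable {δ τ Λ : ℝ} {V V' : EuclideanSpace ℝ (Fin n)}

theorem amplitude_arg_ge (hδ : δ ∈ Icc (0 : ℝ) (1 / 2)) (hτ : 0 ≤ τ) (hτΛ : τ * Λ ≤ 1 / 100)
    (hV : ‖V‖ ≤ Λ) : 1 / 4 ≤ 1 - δ ^ 2 - τ ^ 2 * ‖V‖ ^ 2 := by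
  have h1 : δ ^ 2 ≤ (1 / 2) ^ 2 := pow_le_pow_left₀ hδ.1 hδ.2 2
  have h2 : (τ * ‖V‖) ^ 2 ≤ (1 / 100) ^ 2 :=
    pow_le_pow_left₀ (by positivity) ((mul_le_mul_of_nonneg_left hV hτ).trans hτΛ) 2
  rw [mul_pow] at h2
  linarith

theorem sq_amplitude (hδ : δ ∈ Icc (0 : ℝ) (1 / 2)) (hτ : 0 ≤ τ) (hτΛ : τ * Λ ≤ 1 / 100)
    (hV : ‖V‖ ≤ Λ) : δ ^ 2 + amplitude δ τ V ^ 2 + τ ^ 2 * ‖V‖ ^ 2 = 1 := by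
  rw [amplitude, Real.sq_sqrt (by linarith [amplitude_arg_ge hδ hτ hτΛ hV])]
  ring

theorem amplitude_mem_Icc (hδ : δ ∈ Icc (0 : ℝ) (1 / 2)) (hτ : 0 ≤ τ) (hτΛ : τ * Λ ≤ 1 / 100)
    (hV : ‖V‖ ≤ Λ) : amplitude δ τ V ∈ Icc (1 / 2 : ℝ) 1 := by
  constructor
  · exact Real.le_sqrt_of_sq_le (by linarith [amplitude_arg_ge hδ hτ hτΛ hV])
  · rw [amplitude, Real.sqrt_le_left (by norm_num)]
    have : 0 ≤ τ ^ 2 * ‖V‖ ^ 2 := by positivity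
    linarith [sq_nonneg δ]

/-- Both amplitudes are at least 1/2, so their difference is at most the difference of their
squares, which is τ² times that of the |V|². -/
theorem abs_amplitude_sub_le (hδ : δ ∈ Icc (0 : ℝ) (1 / 2)) (hτ : 0 ≤ τ) (hτΛ : τ * Λ ≤ 1 / 100)
    (hV : ‖V‖ ≤ Λ) (hV' : ‖V'‖ ≤ Λ) :
    |amplitude δ τ V - amplitude δ τ V'| ≤ τ * ‖V - V'‖ := by
  have h1 := sq_amplitude hδ hτ hτΛ hV
  have h2 := sq_amplitude hδ hτ hτΛ hV'
  have h3 := (amplitude_mem_Icc hδ hτ hτΛ hV).1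
  have h4 := (amplitude_mem_Icc hδ hτ hτΛ hV').1
  set a := amplitude δ τ V
  set a' := amplitude δ τ V'
  have h5 : |a - a'| * (a + a') = τ ^ 2 * (|‖V'‖ - ‖V‖| * (‖V'‖ + ‖V‖)) := by
    have e : (a - a') * (a + a') = τ ^ 2 * ((‖V'‖ - ‖V‖) * (‖V'‖ + ‖V‖)) := by
      linear_combination h1 - h2
    have := congrArg abs e
    rwa [abs_mul, abs_mul, abs_mul, abs_of_nonneg (sq_nonneg τ),
      abs_of_nonneg (show 0 ≤ a + a' by linarith),
      abs_of_nonneg (show 0 ≤ ‖V'‖ + ‖V‖ by positivity)] at this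
  have h6 : |‖V'‖ - ‖V‖| ≤ ‖V - V'‖ := by
    rw [abs_sub_comm]; exact abs_norm_sub_norm_le V V'
  have h7 : τ * (‖V'‖ + ‖V‖) ≤ 1 := by
    have := mul_le_mul_of_nonneg_left (add_le_add hV' hV) hτ
    linarith
  calc |a - a'| ≤ |a - a'| * (a + a') := le_mul_of_one_le_right (abs_nonneg _) (by linarith)
    _ = τ * |‖V'‖ - ‖V‖| * (τ * (‖V'‖ + ‖V‖)) := by rw [h5]; ring
    _ ≤ τ * ‖V - V'‖ * 1 := by gcongr
    _ = τ * ‖V - V'‖ := mul_one _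

end Amplitude

/-- Moving w to the midpoint saves τN² and changes the amplitude and W terms by at most τΛNs each.
The common factor τ cancels, so the bound on N does not degenerate as τ → 0. -/
theorem norm_sub_midpoint_le {D δ τ Λ : ℝ} (hD : 0 < D) (hδ : δ ∈ Icc (0 : ℝ) (1 / 2))
    (hτ : 0 < τ) (hτΛ : τ * Λ ≤ 1 / 100) {V V' w x y : 𝔼} (hV : ‖V‖ ≤ Λ) (hV' : ‖V'‖ ≤ Λ)
    (hVV : ‖V - V'‖ ≤ Λ * ‖w - (1 / 2 : ℝ) • (x + y)‖) (hs : ‖y - x‖ ≤ D)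
    (hmin : twoPoint D τ (amplitude δ τ V) V w x y
      ≤ twoPoint D τ (amplitude δ τ V') V' ((1 / 2 : ℝ) • (x + y)) x y) :
    ‖w - (1 / 2 : ℝ) • (x + y)‖ ≤ 2 * Λ * ‖y - x‖ := by
  have ha := abs_amplitude_sub_le hδ hτ.le hτΛ hV hV'
  simp only [twoPoint, sub_self, norm_zero] at hmin
  set a := amplitude δ τ V
  set a' := amplitude δ τ V'
  set N := ‖w - (1 / 2 : ℝ) • (x + y)‖ with hN
  set s := ‖y - x‖ with hsdef
  have hs0 : 0 ≤ s := norm_nonneg _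
  have hN0 : 0 ≤ N := norm_nonneg _
  have hω : s - s ^ 2 / (4 * D) ≤ s := by
    have : 0 ≤ s ^ 2 / (4 * D) := by positivity
    linarith
  have hω0 : 0 ≤ s - s ^ 2 / (4 * D) := by
    have : s ^ 2 / (4 * D) ≤ s := by
      rw [div_le_iff₀ (by positivity)]
      nlinarith
    linarith
  have h1 : (a' - a) * (s - s ^ 2 / (4 * D)) ≤ τ * (Λ * N) * s := by
    have : a' - a ≤ τ * (Λ * N) := by
      have h1 := abs_le.1 ha
      have h2 := mul_le_mul_of_nonneg_left hVV hτ.le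
      linarith
    have h0 : 0 ≤ τ * (Λ * N) := by
      have := (norm_nonneg _).trans hVV
      positivity
    calc _ ≤ τ * (Λ * N) * (s - s ^ 2 / (4 * D)) := mul_le_mul_of_nonneg_right this hω0
      _ ≤ _ := mul_le_mul_of_nonneg_left hω h0
  have h2 : τ * ⟪V - V', y - x⟫ ≤ τ * (Λ * N * s) := by
    have := real_inner_le_norm (V - V') (y - x)
    have h3 := mul_le_mul_of_nonneg_right hVV hs0
    exact mul_le_mul_of_nonneg_left (this.trans h3) hτ.le
  rw [inner_sub_left] at h2
  have h3 : τ * (N * N) ≤ τ * (2 * Λ * s * N) := by nlinarith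
  have h4 := le_of_mul_le_mul_left h3 hτ
  rcases hN0.eq_or_lt with h | h
  · rw [← h]
    have : 0 ≤ Λ := (norm_nonneg V).trans hV
    positivity
  · exact le_of_mul_le_mul_right h4 h

/-- The first-order condition identifies P with m times the test gradient plus a nonnegative
multiple of ν. Dividing by m and using m^(1-q) = m · m^(-q) turns φ into τφ. -/
theorem oblique_contradiction {β q c D Λ C₁ C₂ m ε : ℝ} {Ω : Set 𝔼}
    (hΩ : IsStrictlyConvexDomain β Ω) (hm : 0 < m)
    (hob : ObliqueIncompatible n q c D Λ C₁ C₂ (m ^ (-q)))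
    {x y ν P W k : 𝔼} {μ φ : ℝ} (hx : x ∈ frontier Ω) (hν : IsInwardUnitNormal Ω x ν)
    (hxy : x ≠ y) (hD : ‖y - x‖ ≤ D) (hc : c * ‖y - x‖ ^ 2 ≤ ⟪ν, y - x⟫)
    (hμ : μ ∈ Icc (1 / 2 : ℝ) 1) (hk : ‖k‖ ≤ C₁ * ‖y - x‖) (hW : ‖W - φ • ν‖ ≤ C₂ * ‖y - x‖)
    (hφ : |φ| ≤ Λ) (hWΛ : ‖W‖ ≤ Λ)
    (hone : (ε / m) ^ 2 + μ ^ 2 + (m ^ (-q)) ^ 2 * ‖W‖ ^ 2 = 1)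
    (hcone : ∀ z ∈ closure Ω, 0 ≤ ⟪P - m • ((μ * (1 - ‖y - x‖ / (2 * D))) •
      (‖y - x‖⁻¹ • (y - x)) - m ^ (-q) • W - m ^ (-q) • k), z - x⟫)
    (hbc : ⟪P, ν⟫ = -φ * regNorm ε P ^ (1 - q)) : False := by
  obtain ⟨r, hr, hP⟩ := hν.eq_smul_of_forall_inner_nonneg hΩ.isOpen hx hcone
  have hs : 0 < ‖y - x‖ := norm_pos_iff.2 (sub_ne_zero.2 hxy.symm)
  set Q := (μ * (1 - ‖y - x‖ / (2 * D))) •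
      (‖y - x‖⁻¹ • (y - x)) - m ^ (-q) • W - m ^ (-q) • k + (r / m) • ν with hQ
  have hPQ : P = m • Q := by
    have e : m • (r / m) • ν = r • ν := by rw [smul_smul, mul_div_cancel₀ _ hm.ne']
    rw [hQ, smul_add, e, ← hP]
    abel
  refine hob ‖y - x‖ μ (ε / m) (r / m) φ ν (‖y - x‖⁻¹ • (y - x)) W (φ • ν) k hν.norm_eq_one
    (by rw [norm_smul, norm_inv, norm_norm, inv_mul_cancel₀ hs.ne']) ⟨hs, hD⟩ ?_ hμ
    (by positivity) hk hW rfl hφ hWΛ hone Q hQ ?_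
  · rw [real_inner_smul_left, real_inner_comm, inv_mul_eq_div, le_div_iff₀ hs]
    linarith [show c * ‖y - x‖ ^ 2 = c * ‖y - x‖ * ‖y - x‖ by ring]
  · have hv : 0 ≤ regNorm (ε / m) Q := Real.sqrt_nonneg _
    have e : m ^ (1 - q) = m * m ^ (-q) := by
      rw [sub_eq_add_neg, Real.rpow_add hm, Real.rpow_one]
    rw [hPQ, regNorm_smul hm, Real.mul_rpow hm.le hv, real_inner_smul_left, e] at hbc
    apply mul_left_cancel₀ hm.ne'
    rw [hbc]
    ring

theorem regNorm_mem_Icc_of_near {δ a b : ℝ} {e P : 𝔼} (he : ‖e‖ = 1) (hδ : δ ∈ Icc (0 : ℝ) (1 / 2))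
    (ha : a ∈ Icc (1 / 4 : ℝ) 1) (hb : b ≤ 1 / 100) (hP : ‖P - a • e‖ ≤ b) :
    regNorm δ P ∈ Icc (1 / 5 : ℝ) 5 := by
  have hae : ‖a • e‖ = a := by rw [norm_smul, he, mul_one, Real.norm_of_nonneg (by linarith [ha.1])]
  have h1 := abs_le.1 ((abs_norm_sub_norm_le P (a • e)).trans hP)
  rw [hae] at h1
  constructor
  · exact le_trans (by linarith [ha.1]) (norm_le_regNorm δ P)
  · rw [regNorm, Real.sqrt_le_left (by norm_num)]
    have h2 : ‖P‖ ^ 2 ≤ 2 ^ 2 := pow_le_pow_left₀ (norm_nonneg P) (by linarith [ha.2]) 2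
    have h3 : δ ^ 2 ≤ (1 / 2) ^ 2 := pow_le_pow_left₀ hδ.1 hδ.2 2
    linarith

end Contradiction

/-! ### Excluding a maximum off the diagonal at positive time. -/

section TwoPointMaximum

variable {n : ℕ}

local notation "𝔼" => EuclideanSpace ℝ (Fin n)

theorem HasGradientWithinAt.sub_const_mul {w ψ : 𝔼 → ℝ} {g g' y : 𝔼} {S : Set 𝔼}
    (hw : HasGradientWithinAt w g S y) (hψ : HasGradientAt ψ g' y) (m : ℝ) :
    HasGradientWithinAt (fun y => w y - m * ψ y) (g - m • g') S y := by
  have h := hw.hasFDerivWithinAt.sub (hψ.hasFDerivAt.hasFDerivWithinAt.const_mul m)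
  have e : InnerProductSpace.toDual ℝ 𝔼 (g - m • g')
      = InnerProductSpace.toDual ℝ 𝔼 g - m • InnerProductSpace.toDual ℝ 𝔼 g' := by
    simp
  rw [hasGradientWithinAt_iff_hasFDerivWithinAt, e]
  exact h

theorem HasGradientWithinAt.neg_fun {w : 𝔼 → ℝ} {g y : 𝔼} {S : Set 𝔼}
    (hw : HasGradientWithinAt w g S y) : HasGradientWithinAt (fun y => -w y) (-g) S y := by
  have h := hw.hasFDerivWithinAt.neg
  rw [hasGradientWithinAt_iff_hasFDerivWithinAt, map_neg]
  exact h

theorem eq_zero_of_forall_inner_nonpos {Ω : Set 𝔼} (hΩ : IsOpen Ω) {x ζ : 𝔼} (hx : x ∈ Ω)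
    (h : ∀ y ∈ closure Ω, ⟪ζ, y - x⟫ ≤ 0) : ζ = 0 := by
  have hc : ContinuousAt (fun t : ℝ => x + t • ζ) 0 := by fun_prop
  have h1 : ∀ᶠ t in 𝓝[>] (0 : ℝ), x + t • ζ ∈ Ω :=
    (hc.eventually (by simpa using hΩ.mem_nhds hx)).filter_mono nhdsWithin_le_nhds
  obtain ⟨t, ht, ht0⟩ := (h1.and self_mem_nhdsWithin).exists
  have h2 := h _ (subset_closure ht)
  rw [add_sub_cancel_left, real_inner_smul_right, real_inner_self_eq_norm_sq] at h2
  have h3 : ‖ζ‖ ^ 2 ≤ 0 := by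
    by_contra! h4
    exact absurd h2 (not_le.2 (mul_pos ht0 h4))
  rw [← norm_eq_zero]
  exact pow_eq_zero_iff two_ne_zero |>.1 (le_antisymm h3 (sq_nonneg _))

theorem regNorm_neg (ε : ℝ) (P : 𝔼) : regNorm ε (-P) = regNorm ε P := by
  rw [regNorm, regNorm, norm_neg]

/-- The test function attached to a Lipschitz field `W`. -/
def testFunction (D δ τ : ℝ) (W : EuclideanSpace ℝ (Fin n) → EuclideanSpace ℝ (Fin n))
    (z x y : EuclideanSpace ℝ (Fin n)) : ℝ :=
  twoPoint D τ (amplitude δ τ (W z)) (W z) z x y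

set_option maxHeartbeats 1000000 in
/-- The two-point function of a solution has no maximum off the diagonal at a positive time. -/
theorem IsRegularizedSolution.not_isMax {β p q ε L D c c₀ Λ m δ σ : ℝ} {Ω : Set 𝔼}
    {f : 𝔼 → ℝ → ℝ} {φ u₀ : 𝔼 → ℝ} {u : 𝔼 → ℝ → ℝ} {W : 𝔼 → 𝔼}
    (hsol : IsRegularizedSolution Ω p q ε f φ u₀ u) (hu : IsParabolicC2Holder σ Ω u)
    (hΩ : IsStrictlyConvexDomain β Ω) (hD0 : 0 < D)
    (hD : ∀ x ∈ closure Ω, ∀ y ∈ closure Ω, ‖y - x‖ ≤ D)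
    (hc : ∀ x ∈ frontier Ω, ∀ ν, IsInwardUnitNormal Ω x ν →
      ∀ y ∈ closure Ω, c * ‖y - x‖ ^ 2 ≤ ⟪ν, y - x⟫)
    (hWΛ : ∀ w ∈ closure Ω, ‖W w‖ ≤ Λ)
    (hWL : ∀ w ∈ closure Ω, ∀ w' ∈ closure Ω, ‖W w - W w'‖ ≤ Λ * ‖w - w'‖)
    (hWφ : ∀ x ∈ frontier Ω, |φ x| ≤ Λ ∧ ∃ ν, IsInwardUnitNormal Ω x ν ∧ W x = φ x • ν)
    (hf : ∀ x ∈ Ω, ∀ z, |f x z| ≤ L) (hε : ε ∈ Ioc (0 : ℝ) 1) (hm : 2 ≤ m)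
    (hτ : m ^ (-q) * (Λ + 2 * Λ * D) ≤ 1 / 100)
    (hob : ObliqueIncompatible n q c D Λ (2 * Λ) (Λ * (2 * Λ + 1 / 2)) (m ^ (-q)))
    (hfl : FluxDecrease n p D (4 * Λ) c₀ (m ^ (-q))) (hmL : 2 * L < c₀ * m ^ (p - 1))
    (hδ : 0 < δ) {x y z : 𝔼} {t T : ℝ} (hx : x ∈ closure Ω) (hy : y ∈ closure Ω)
    (hz : z ∈ closure Ω) (ht : 0 < t) (htT : t ≤ T) (hxy : x ≠ y)
    (hmax : ∀ x' ∈ closure Ω, ∀ y' ∈ closure Ω, ∀ z' ∈ closure Ω, ∀ t' ∈ Icc 0 T,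
      u y' t' - u x' t' - m * testFunction D (ε / m) (m ^ (-q)) W z' x' y' - δ * t'
        ≤ u y t - u x t - m * testFunction D (ε / m) (m ^ (-q)) W z x y - δ * t) : False := by
  have hm0 : 0 < m := by linarith
  have hτ0 : 0 < m ^ (-q) := Real.rpow_pos_of_pos hm0 _
  set τ := m ^ (-q) with hτdef
  have htI : t ∈ Icc 0 T := ⟨ht.le, htT⟩
  have hΛ : 0 ≤ Λ := (norm_nonneg _).trans (hWΛ x hx)
  have hτΛ : τ * Λ ≤ 1 / 100 := by
    have : 0 ≤ τ * (2 * Λ * D) := by positivity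
    linarith [mul_add τ Λ (2 * Λ * D)]
  have hεm : ε / m ∈ Icc (0 : ℝ) (1 / 2) := by
    refine ⟨div_nonneg hε.1.le hm0.le, ?_⟩
    rw [div_le_iff₀ hm0]
    linarith [hε.2]
  have hs : 0 < ‖y - x‖ := norm_pos_iff.2 (sub_ne_zero.2 hxy.symm)
  have hsD := hD x hx y hy
  have hmid : (1 / 2 : ℝ) • (x + y) ∈ closure Ω := by
    have := hΩ.convex.closure.add_smul_sub_mem hx hy (t := 1 / 2) ⟨by norm_num, by norm_num⟩
    convert this using 1
    module
  -- the auxiliary point stays close to the midpoint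
  have hzmid : ‖z - (1 / 2 : ℝ) • (x + y)‖ ≤ 2 * Λ * ‖y - x‖ := by
    refine norm_sub_midpoint_le hD0 hεm hτ0 hτΛ (hWΛ z hz) (hWΛ _ hmid) (hWL z hz _ hmid) hsD ?_
    have := hmax x hx y hy _ hmid t htI
    exact le_of_mul_le_mul_left (by simp only [testFunction] at this; linarith) hm0
  have hμ := amplitude_mem_Icc hεm hτ0.le hτΛ (hWΛ z hz)
  have hone := sq_amplitude hεm hτ0.le hτΛ (hWΛ z hz)
  simp only [testFunction] at hmax
  set μ := amplitude (ε / m) τ (W z) with hμdef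
  set z₀ := (1 / 2 : ℝ) • (x + y) with hz₀
  set e := ‖y - x‖⁻¹ • (y - x) with he
  have he1 : ‖e‖ = 1 := by rw [he, norm_smul, norm_inv, norm_norm, inv_mul_cancel₀ hs.ne']
  have hzz : ‖z₀ - z‖ ≤ 2 * Λ * ‖y - x‖ := by rwa [norm_sub_rev]
  -- first-order conditions
  have hFy : ∀ y' ∈ closure Ω, ⟪spatialGradient Ω u y t - m •
      ((μ * (1 - ‖y - x‖ / (2 * D))) • e - τ • W z - τ • (z - z₀)), y' - y⟫ ≤ 0 := by
    intro y' hy'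
    refine inner_le_of_isMaxOn hΩ.convex.closure ((hu.hasGradientWithinAt hy ht.le).sub_const_mul
      (hasGradientAt_twoPoint_right (D := D) τ μ (W z) z hxy) m) (fun y'' hy'' => ?_) hy hy'
    have := hmax x hx y'' hy'' z hz t htI
    simp only [mem_ofPred_eq]
    linarith
  have hFx : ∀ x' ∈ closure Ω, ⟪-spatialGradient Ω u x t - m •
      -((μ * (1 - ‖y - x‖ / (2 * D))) • e - τ • W z + τ • (z - z₀)), x' - x⟫ ≤ 0 := by
    intro x' hx'
    refine inner_le_of_isMaxOn hΩ.convex.closure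
      ((hu.hasGradientWithinAt hx ht.le).neg_fun.sub_const_mul
      (hasGradientAt_twoPoint_left (D := D) τ μ (W z) z hxy) m) (fun x'' hx'' => ?_) hx hx'
    have := hmax x'' hx'' y hy z hz t htI
    simp only [mem_ofPred_eq]
    linarith
  -- The distance from z to an endpoint is at most 2Λs to the midpoint plus s/2 beyond it.
  have hWdiff : ∀ a : 𝔼, a ∈ closure Ω → ‖z₀ - a‖ = 1 / 2 * ‖y - x‖ →
      ‖W z - W a‖ ≤ Λ * (2 * Λ + 1 / 2) * ‖y - x‖ := by
    intro a ha haz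
    refine (hWL z hz a ha).trans ?_
    rw [mul_assoc]
    refine mul_le_mul_of_nonneg_left ?_ hΛ
    have : ‖z - a‖ ≤ ‖z - z₀‖ + ‖z₀ - a‖ := norm_sub_le_norm_sub_add_norm_sub z z₀ a
    linarith
  by_cases hxf : x ∈ frontier Ω
  · obtain ⟨hφΛ, ν, hν, hWν⟩ := hWφ x hxf
    refine oblique_contradiction hΩ hm0 hob (P := spatialGradient Ω u x t) (W := W z)
      (φ := φ x) (k := z₀ - z) hxf hν hxy hsD (hc x hxf ν hν y hy) hμ hzz ?_ hφΛ (hWΛ z hz) hone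
      ?_ (hsol.boundary x hxf ν hν t ht.le)
    · rw [← hWν]
      refine hWdiff x hx ?_
      have : z₀ - x = (1 / 2 : ℝ) • (y - x) := by rw [hz₀]; module
      rw [this, norm_smul]; norm_num
    · intro a ha
      have h := hFx a ha
      rw [← neg_nonneg, ← inner_neg_left] at h
      convert h using 2
      module
  -- Exchanging the points and changing the signs of the gradient, W and φ reduces this to the same
  -- boundary contradiction.
  by_cases hyf : y ∈ frontier Ω
  · obtain ⟨hφΛ, ν, hν, hWν⟩ := hWφ y hyf
    have hsx : ‖x - y‖ = ‖y - x‖ := norm_sub_rev x y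
    refine oblique_contradiction hΩ hm0 hob (P := -spatialGradient Ω u y t) (W := -W z)
      (φ := -φ y) (k := z₀ - z) hyf hν hxy.symm (by rwa [hsx]) (hc y hyf ν hν x hx) hμ
      (by rwa [hsx]) ?_ (by rwa [abs_neg]) (by rw [norm_neg]; exact hWΛ z hz)
      (by rw [norm_neg]; exact hone) ?_ ?_
    · rw [neg_smul, ← hWν, hsx, ← norm_neg]
      have e1 : -(-W z - -W y) = W z - W y := by abel
      rw [e1]
      refine hWdiff y hy ?_
      have : z₀ - y = (-(1 / 2) : ℝ) • (y - x) := by rw [hz₀]; module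
      rw [this, norm_smul]; norm_num
    · intro a ha
      have h := hFy a ha
      rw [← neg_nonneg, ← inner_neg_left] at h
      have e1 : ‖x - y‖⁻¹ • (x - y) = -e := by rw [hsx, he, ← smul_neg, neg_sub]
      rw [e1, hsx]
      convert h using 2
      module
    · rw [inner_neg_left, hsol.boundary y hyf ν hν t ht.le, regNorm_neg]
      ring
  -- interior maximum
  have hint : ∀ a ∈ closure Ω, a ∉ frontier Ω → a ∈ Ω := by
    intro a ha haf
    by_contra h
    exact haf ⟨ha, by rwa [hΩ.isOpen.interior_eq]⟩
  have hxΩ := hint x hx hxf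
  have hyΩ := hint y hy hyf
  have hGy := sub_eq_zero.1 (eq_zero_of_forall_inner_nonpos hΩ.isOpen hyΩ hFy)
  have hGx := sub_eq_zero.1 (eq_zero_of_forall_inner_nonpos hΩ.isOpen hxΩ hFx)
  rw [smul_neg, neg_inj] at hGx
  set a := μ * (1 - ‖y - x‖ / (2 * D)) with ha
  set Py := a • e - τ • W z - τ • (z - z₀) with hPy
  set Px := a • e - τ • W z + τ • (z - z₀) with hPx
  set Y := fderiv ℝ (fderiv ℝ fun y => u y t) y with hY
  set X := fderiv ℝ (fderiv ℝ fun y => u y t) x with hX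
  have hoI : 1 - ‖y - x‖ / (2 * D) ∈ Icc (1 / 2 : ℝ) 1 := by
    have h1 : ‖y - x‖ / (2 * D) ≤ 1 / 2 := by
      rw [div_le_iff₀ (by positivity)]; linarith
    have h2 : 0 ≤ ‖y - x‖ / (2 * D) := by positivity
    constructor <;> linarith
  have haI : a ∈ Icc (1 / 4 : ℝ) 1 := by
    have h1 : (1 / 2 : ℝ) * (1 / 2) ≤ a :=
      mul_le_mul hμ.1 hoI.1 (by norm_num) (by linarith [hμ.1])
    exact ⟨by linarith, mul_le_one₀ hμ.2 (by linarith [hoI.1]) hoI.2⟩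
  have hnear : ∀ P : 𝔼, (‖P - a • e‖ ≤ ‖τ • W z‖ + ‖τ • (z - z₀)‖) →
      regNorm (ε / m) P ∈ Icc (1 / 5 : ℝ) 5 := by
    intro P hP
    refine regNorm_mem_Icc_of_near he1 hεm haI hτ (hP.trans ?_)
    rw [norm_smul, norm_smul, Real.norm_of_nonneg hτ0.le, mul_add]
    have h1 := mul_le_mul_of_nonneg_left (hWΛ z hz) hτ0.le
    have h2 : ‖z - z₀‖ ≤ 2 * Λ * D := hzmid.trans (by gcongr)
    have h3 := mul_le_mul_of_nonneg_left h2 hτ0.le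
    linarith
  -- The two rescaled gradients differ only by the penalty, by -2τ(z - z₀), whence the constant 4Λ.
  have hdec := hfl ‖y - x‖ μ (ε / m) e Py Px (m⁻¹ • X) (m⁻¹ • Y) he1 ⟨hs, hsD⟩ hμ hεm.1
    (hnear Py (by
      have : Py - a • e = -(τ • W z) - τ • (z - z₀) := by rw [hPy]; abel
      rw [this]
      exact (norm_sub_le _ _).trans (by rw [norm_neg])))
    (hnear Px (by
      have : Px - a • e = -(τ • W z) + τ • (z - z₀) := by rw [hPx]; abel
      rw [this]
      exact (norm_add_le _ _).trans (by rw [norm_neg])))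
    (by
      have : Py - Px = (-2 * τ) • (z - z₀) := by rw [hPy, hPx]; module
      rw [this, norm_smul, Real.norm_eq_abs, abs_mul, abs_of_pos hτ0]
      have := mul_le_mul_of_nonneg_left hzmid hτ0.le
      norm_num
      linarith)
    (by
      intro ξ η
      have hloc : IsLocalMax (fun b : 𝔼 × 𝔼 => u b.2 t - u b.1 t
          - m * twoPoint D τ μ (W z) z b.1 b.2) (x, y) := by
        have hn : Ω ×ˢ Ω ∈ 𝓝 (x, y) :=
          prod_mem_nhds (hΩ.isOpen.mem_nhds hxΩ) (hΩ.isOpen.mem_nhds hyΩ)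
        filter_upwards [hn] with b hb
        have := hmax b.1 (subset_closure hb.1) b.2 (subset_closure hb.2) z hz t htI
        linarith
      have h := hloc.twoPoint_hessian_le hD0.ne' hxy (w := fun y => u y t)
        (hu.contDiffAt hΩ.isOpen hxΩ ht.le)
        (hu.contDiffAt hΩ.isOpen hyΩ ht.le) ξ η
      rw [← hY, ← hX, ← he] at h
      simp only [smul_apply, smul_eq_mul, ← mul_sub]
      rw [inv_mul_le_iff₀ hm0]
      exact h)
  have hty := hsol.timeDeriv_eq_flux hu hΩ.isOpen hε.1 hyΩ ht.le
  have htx := hsol.timeDeriv_eq_flux hu hΩ.isOpen hε.1 hxΩ ht.le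
  rw [hGy, flux_smul hm0, ← hY] at hty
  rw [hGx, flux_smul hm0, ← hX] at htx
  have hfy := (abs_le.1 (hf y hyΩ (u y t))).2
  have hfx := (abs_le.1 (hf x hxΩ (u x t))).1
  have htime := nonneg_deriv_of_isMaxOn_Icc
    (((hu.hasDerivAt_time hy ht).sub (hu.hasDerivAt_time hx ht)).sub
      ((hasDerivAt_id' t).const_mul δ)) ht htT (fun s hs => by
      have := hmax x hx y hy z hz s hs
      simp only [Pi.sub_apply]
      linarith)
  -- At the maximum u_t(y) - u_t(x) ≥ δ > 0, while the equation bounds this difference by 2L - c₀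
  -- m^(p-1) < 0.
  have hmp : 0 < m ^ (p - 1) := Real.rpow_pos_of_pos hm0 _
  have hdec' := mul_le_mul_of_nonneg_left hdec hmp.le
  rw [mul_sub] at hdec'
  linarith

end TwoPointMaximum

/-! ### From the comparison to the gradient. -/

section GradientEstimate

variable {n : ℕ} {Ω : Set (EuclideanSpace ℝ (Fin n))} {u : EuclideanSpace ℝ (Fin n) → ℝ → ℝ}
  {σ : ℝ}

theorem IsParabolicC2Holder.norm_spatialGradient_le (hu : IsParabolicC2Holder σ Ω u) {t M : ℝ}
    (ht : 0 ≤ t) (h : ∀ x ∈ Ω, ‖spatialGradient Ω u x t‖ ≤ M) :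
    ∀ x ∈ closure Ω, ‖spatialGradient Ω u x t‖ ≤ M := by
  have hc : ContinuousOn (fun x => ‖spatialGradient Ω u x t‖) (closure Ω) :=
    (hu.continuousOn_gradient.comp (f := fun x => (x, t)) (by fun_prop)
      fun x hx => ⟨hx, ht⟩).norm
  exact fun x hx => le_on_closure h hc continuousOn_const hx

theorem IsParabolicC2Holder.abs_sub_le (hu : IsParabolicC2Holder σ Ω u) (hΩ : Convex ℝ Ω)
    {t M : ℝ} (ht : 0 ≤ t) (h : ∀ x ∈ Ω, ‖spatialGradient Ω u x t‖ ≤ M)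
    {x y : EuclideanSpace ℝ (Fin n)} (hx : x ∈ closure Ω) (hy : y ∈ closure Ω) :
    |u y t - u x t| ≤ M * ‖y - x‖ :=
  hΩ.closure.norm_image_sub_le_of_norm_hasFDerivWithin_le (f := fun y => u y t)
    (fun x hx => (hu.hasGradientWithinAt hx ht).hasFDerivWithinAt)
    (fun x hx => by
      rw [LinearIsometryEquiv.norm_map]
      exact hu.norm_spatialGradient_le ht h x hx) hx hy

theorem IsRegularizedSolution.spatialGradient_zero {p q ε : ℝ}
    {f : EuclideanSpace ℝ (Fin n) → ℝ → ℝ} {φ u₀ : EuclideanSpace ℝ (Fin n) → ℝ}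
    (h : IsRegularizedSolution Ω p q ε f φ u₀ u) (hΩ : IsOpen Ω)
    {x : EuclideanSpace ℝ (Fin n)} (hx : x ∈ Ω) :
    spatialGradient Ω u x 0 = gradient u₀ x := by
  rw [spatialGradient_eq_gradient (mem_of_superset (hΩ.mem_nhds hx) subset_closure)]
  have : (fun y => u y 0) =ᶠ[𝓝 x] u₀ := by
    filter_upwards [hΩ.mem_nhds hx] with y hy using h.initial y hy
  rw [gradient, gradient, this.fderiv_eq]

theorem norm_spatialGradient_le_of_sub_le (hΩ : IsOpen Ω) {t M : ℝ} (hM : 0 ≤ M)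
    (h : ∀ x ∈ closure Ω, ∀ y ∈ closure Ω, u y t - u x t ≤ M * ‖y - x‖)
    {x : EuclideanSpace ℝ (Fin n)} (hx : x ∈ Ω) : ‖spatialGradient Ω u x t‖ ≤ M := by
  rw [spatialGradient_eq_gradient (mem_of_superset (hΩ.mem_nhds hx) subset_closure),
    norm_gradient_eq]
  refine norm_fderiv_le_of_lip' ℝ hM ?_
  filter_upwards [hΩ.mem_nhds hx] with y hy
  have h1 := h x (subset_closure hx) y (subset_closure hy)
  have h2 := h y (subset_closure hy) x (subset_closure hx)
  rw [norm_sub_rev x y] at h2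
  rw [Real.norm_eq_abs, abs_le]
  constructor <;> linarith

section TestFunction

variable {D δ τ Λ : ℝ} {W : EuclideanSpace ℝ (Fin n) → EuclideanSpace ℝ (Fin n)}
  {x y z : EuclideanSpace ℝ (Fin n)}

theorem testFunction_self_nonneg (hτ : 0 ≤ τ) : 0 ≤ testFunction D δ τ W z x x := by
  simp only [testFunction, twoPoint, sub_self, norm_zero, inner_zero_right]
  have : 0 ≤ τ * ‖z - (1 / 2 : ℝ) • (x + x)‖ ^ 2 := by positivity
  simpa using this

theorem le_testFunction (hD0 : 0 < D) (hD : ‖y - x‖ ≤ D) (hδ : δ ∈ Icc (0 : ℝ) (1 / 2))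
    (hτ : 0 ≤ τ) (hτΛ : τ * Λ ≤ 1 / 100) (hW : ‖W z‖ ≤ Λ) :
    ‖y - x‖ / 4 ≤ testFunction D δ τ W z x y := by
  have hμ := (amplitude_mem_Icc hδ hτ hτΛ hW).1
  rw [testFunction, twoPoint]
  set μ := amplitude δ τ (W z)
  set s := ‖y - x‖ with hs
  have hs0 : 0 ≤ s := norm_nonneg _
  have h1 : 3 / 4 * s ≤ s - s ^ 2 / (4 * D) := by
    have : s ^ 2 / (4 * D) ≤ s / 4 := by
      rw [div_le_iff₀ (by positivity)]
      nlinarith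
    linarith
  have h2 : 1 / 2 * (3 / 4 * s) ≤ μ * (s - s ^ 2 / (4 * D)) :=
    mul_le_mul hμ h1 (by positivity) (by linarith)
  have h3 : τ * ⟪W z, y - x⟫ ≤ 1 / 100 * s := by
    calc τ * ⟪W z, y - x⟫ ≤ τ * (Λ * s) := by
          refine mul_le_mul_of_nonneg_left ((real_inner_le_norm _ _).trans ?_) hτ
          gcongr
      _ = τ * Λ * s := by ring
      _ ≤ _ := by gcongr
  have h4 : 0 ≤ τ * ‖z - (1 / 2 : ℝ) • (x + y)‖ ^ 2 := by positivity
  linarith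

theorem testFunction_midpoint_le (hD0 : 0 < D) (hδ : δ ∈ Icc (0 : ℝ) (1 / 2))
    (hτ : 0 ≤ τ) (hτΛ : τ * Λ ≤ 1 / 100) (hW : ‖W ((1 / 2 : ℝ) • (x + y))‖ ≤ Λ) :
    testFunction D δ τ W ((1 / 2 : ℝ) • (x + y)) x y ≤ 2 * ‖y - x‖ := by
  have hμ := amplitude_mem_Icc hδ hτ hτΛ hW
  rw [testFunction, twoPoint, sub_self, norm_zero]
  set z := (1 / 2 : ℝ) • (x + y)
  set μ := amplitude δ τ (W z)
  set s := ‖y - x‖ with hs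
  have hs0 : 0 ≤ s := norm_nonneg _
  have h1 : s - s ^ 2 / (4 * D) ≤ s := by
    have : 0 ≤ s ^ 2 / (4 * D) := by positivity
    linarith
  have h2 : μ * (s - s ^ 2 / (4 * D)) ≤ s :=
    (mul_le_mul_of_nonneg_left h1 (by linarith [hμ.1])).trans
      (mul_le_of_le_one_left hs0 hμ.2)
  have h3 : -(τ * ⟪W z, y - x⟫) ≤ 1 / 100 * s := by
    calc -(τ * ⟪W z, y - x⟫) = τ * -⟪W z, y - x⟫ := by ring
      _ ≤ τ * (Λ * s) := by
          refine mul_le_mul_of_nonneg_left ?_ hτ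
          refine (neg_le_abs _).trans ((abs_real_inner_le_norm _ _).trans ?_)
          gcongr
      _ = τ * Λ * s := by ring
      _ ≤ _ := by gcongr
  linarith

end TestFunction

set_option maxHeartbeats 1000000 in
/-- The spatial oscillation of a solution is controlled by the two-point test function. -/
theorem IsRegularizedSolution.sub_le_testFunction {β p q ε L D c c₀ Λ m K : ℝ}
    {f : EuclideanSpace ℝ (Fin n) → ℝ → ℝ} {φ u₀ : EuclideanSpace ℝ (Fin n) → ℝ}
    {W : EuclideanSpace ℝ (Fin n) → EuclideanSpace ℝ (Fin n)}
    (hsol : IsRegularizedSolution Ω p q ε f φ u₀ u) (hu : IsParabolicC2Holder σ Ω u)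
    (hΩ : IsStrictlyConvexDomain β Ω) (hD0 : 0 < D)
    (hD : ∀ x ∈ closure Ω, ∀ y ∈ closure Ω, ‖y - x‖ ≤ D)
    (hc : ∀ x ∈ frontier Ω, ∀ ν, IsInwardUnitNormal Ω x ν →
      ∀ y ∈ closure Ω, c * ‖y - x‖ ^ 2 ≤ ⟪ν, y - x⟫)
    (hWΛ : ∀ w ∈ closure Ω, ‖W w‖ ≤ Λ)
    (hWL : ∀ w ∈ closure Ω, ∀ w' ∈ closure Ω, ‖W w - W w'‖ ≤ Λ * ‖w - w'‖)
    (hWφ : ∀ x ∈ frontier Ω, |φ x| ≤ Λ ∧ ∃ ν, IsInwardUnitNormal Ω x ν ∧ W x = φ x • ν)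
    (hf : ∀ x ∈ Ω, ∀ z, |f x z| ≤ L) (hε : ε ∈ Ioc (0 : ℝ) 1) (hm : 2 ≤ m)
    (hτ : m ^ (-q) * (Λ + 2 * Λ * D) ≤ 1 / 100)
    (hob : ObliqueIncompatible n q c D Λ (2 * Λ) (Λ * (2 * Λ + 1 / 2)) (m ^ (-q)))
    (hfl : FluxDecrease n p D (4 * Λ) c₀ (m ^ (-q))) (hmL : 2 * L < c₀ * m ^ (p - 1))
    (hK : ∀ x ∈ Ω, ‖gradient u₀ x‖ ≤ K) (hmK : 4 * K ≤ m)
    {x y z : EuclideanSpace ℝ (Fin n)} {t : ℝ} (hx : x ∈ closure Ω) (hy : y ∈ closure Ω)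
    (hz : z ∈ closure Ω) (ht : 0 ≤ t) :
    u y t - u x t ≤ m * testFunction D (ε / m) (m ^ (-q)) W z x y := by
  by_contra! hviol
  have hm0 : 0 < m := by linarith
  have hτ0 : 0 < m ^ (-q) := Real.rpow_pos_of_pos hm0 _
  have hΛ : 0 ≤ Λ := (norm_nonneg _).trans (hWΛ x hx)
  have hτΛ : m ^ (-q) * Λ ≤ 1 / 100 := by
    have : 0 ≤ m ^ (-q) * (2 * Λ * D) := by positivity
    linarith [mul_add (m ^ (-q)) Λ (2 * Λ * D)]
  have hεm : ε / m ∈ Icc (0 : ℝ) (1 / 2) := by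
    refine ⟨div_nonneg hε.1.le hm0.le, ?_⟩
    rw [div_le_iff₀ hm0]
    linarith [hε.2]
  set η := u y t - u x t - m * testFunction D (ε / m) (m ^ (-q)) W z x y with hη
  have hη0 : 0 < η := by linarith
  -- Small enough that the time penalty δt does not use up the violation η, so the penalised maximum
  -- stays positive.
  set δ := η / (2 * (t + 1)) with hδ
  have hδ0 : 0 < δ := by positivity
  have hδt : δ * t < η := by
    rw [hδ, div_mul_eq_mul_div, div_lt_iff₀ (by positivity)]
    nlinarith
  let F : EuclideanSpace ℝ (Fin n) × EuclideanSpace ℝ (Fin n) × EuclideanSpace ℝ (Fin n) × ℝ → ℝ :=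
    fun w => u w.2.1 w.2.2.2 - u w.1 w.2.2.2
      - m * testFunction D (ε / m) (m ^ (-q)) W w.2.2.1 w.1 w.2.1 - δ * w.2.2.2
  set S := closure Ω ×ˢ closure Ω ×ˢ closure Ω ×ˢ Icc 0 t with hS
  have hScomp : IsCompact S := hΩ.isCompact_closure.prod
    (hΩ.isCompact_closure.prod (hΩ.isCompact_closure.prod isCompact_Icc))
  have hWc : ContinuousOn W (closure Ω) :=
    (LipschitzOnWith.of_dist_le_mul (K := ⟨Λ, hΛ⟩) fun w hw w' hw' => by
      rw [dist_eq_norm, dist_eq_norm]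
      exact hWL w hw w' hw').continuousOn
  have hWz : ContinuousOn (fun w : EuclideanSpace ℝ (Fin n) × EuclideanSpace ℝ (Fin n) ×
      EuclideanSpace ℝ (Fin n) × ℝ => W w.2.2.1) S :=
    hWc.comp (by fun_prop) fun w hw => hw.2.2.1
  have hF : ContinuousOn F S := by
    have h1 : ContinuousOn (fun w : EuclideanSpace ℝ (Fin n) × EuclideanSpace ℝ (Fin n) ×
        EuclideanSpace ℝ (Fin n) × ℝ => u w.2.1 w.2.2.2) S :=
      hu.continuousOn.comp (f := fun w : EuclideanSpace ℝ (Fin n) × EuclideanSpace ℝ (Fin n) ×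
          EuclideanSpace ℝ (Fin n) × ℝ =>
          (w.2.1, w.2.2.2)) (by fun_prop)
        fun w hw => ⟨hw.2.1, hw.2.2.2.1⟩
    have h2 : ContinuousOn (fun w : EuclideanSpace ℝ (Fin n) × EuclideanSpace ℝ (Fin n) ×
        EuclideanSpace ℝ (Fin n) × ℝ => u w.1 w.2.2.2) S :=
      hu.continuousOn.comp (f := fun w : EuclideanSpace ℝ (Fin n) × EuclideanSpace ℝ (Fin n) ×
          EuclideanSpace ℝ (Fin n) × ℝ =>
          (w.1, w.2.2.2)) (by fun_prop)
        fun w hw => ⟨hw.1, hw.2.2.2.1⟩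
    refine ((h1.sub h2).sub (continuousOn_const.mul ?_)).sub (by fun_prop)
    simp only [testFunction, twoPoint, amplitude]
    exact (((continuousOn_const.sub (continuousOn_const.mul (hWz.norm.pow 2))).sqrt.mul
      (by fun_prop)).sub (continuousOn_const.mul (hWz.inner (by fun_prop)))).add (by fun_prop)
  obtain ⟨⟨x', y', z', t'⟩, ⟨hx', hy', hz', ht'⟩, hmax⟩ :=
    hScomp.exists_isMaxOn ⟨(x, y, z, t), hx, hy, hz, ht, le_rfl⟩ hF
  simp only at hx' hy' hz' ht'
  have hpos : 0 < u y' t' - u x' t' - m * testFunction D (ε / m) (m ^ (-q)) W z' x' y' - δ * t' := by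
    have h1 : F (x, y, z, t) ≤ F (x', y', z', t') := hmax ⟨hx, hy, hz, ht, le_rfl⟩
    simp only [F] at h1
    linarith
  have hδt' : 0 ≤ δ * t' := mul_nonneg hδ0.le ht'.1
  have hxy : x' ≠ y' := by
    rintro rfl
    have := mul_nonneg hm0.le (testFunction_self_nonneg (D := D) (δ := ε / m) (W := W) (x := x')
      (z := z') hτ0.le)
    linarith
  -- At time 0 the oscillation is at most K s, while mψ ≥ m s/4 ≥ K s.
  have ht0 : 0 < t' := by
    refine lt_of_le_of_ne ht'.1 fun h => ?_
    subst h
    have h1 := (abs_le.1 (hu.abs_sub_le hΩ.convex le_rfl (M := K) (fun a ha => by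
      rw [hsol.spatialGradient_zero hΩ.isOpen ha]
      exact hK a ha) hx' hy')).2
    have h2 := mul_le_mul_of_nonneg_left (le_testFunction hD0 (hD x' hx' y' hy') hεm hτ0.le hτΛ
      (hWΛ z' hz')) hm0.le
    have h3 := mul_le_mul_of_nonneg_right hmK (norm_nonneg (y' - x'))
    linarith
  exact hsol.not_isMax hu hΩ hD0 hD hc hWΛ hWL hWφ hf hε hm hτ hob hfl hmL hδ0 hx' hy' hz' ht0 ht'.2
    hxy fun a ha b hb d hd s hs => hmax (a := (a, b, d, s)) ⟨ha, hb, hd, hs⟩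

end GradientEstimate

end

/-! ### Choice of constants and conclusion. -/

theorem theorem3p2 (n : ℕ) (p q L β : ℝ) (hp : 1 < p) (hq : 0 < q) (hβ : β ∈ Set.Ioo (0 : ℝ) 1)
    (Ω : Set (EuclideanSpace ℝ (Fin n))) (hΩ : IsStrictlyConvexDomain β Ω) :
    ∃ C : ℝ, ∀ (f : EuclideanSpace ℝ (Fin n) → ℝ → ℝ) (φ : EuclideanSpace ℝ (Fin n) → ℝ),
      IsAdmissibleSource Ω L f → boundaryC2Norm Ω φ ≤ ENNReal.ofReal L →
      ∀ ε ∈ Set.Ioc (0 : ℝ) 1,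
      ∀ (u₀ : EuclideanSpace ℝ (Fin n) → ℝ) (u : EuclideanSpace ℝ (Fin n) → ℝ → ℝ),
        IsRegularizedSolution Ω p q ε f φ u₀ u →
        ∀ K : ℝ, (∀ x ∈ Ω, ‖gradient u₀ x‖ ≤ K) →
        ∀ T : ℝ, ∀ x ∈ closure Ω, ∀ t ∈ Set.Icc 0 T,
          ‖spatialGradient Ω u x t‖ ≤ C * (1 + K) := by
  obtain ⟨D, hD0, hD⟩ : ∃ D > 0, ∀ x ∈ closure Ω, ∀ y ∈ closure Ω, ‖y - x‖ ≤ D := by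
    obtain ⟨D, hD⟩ := Metric.isBounded_iff.1 hΩ.isBounded.closure
    refine ⟨max D 1, by positivity, fun x hx y hy => ?_⟩
    rw [← dist_eq_norm]
    exact (hD hy hx).trans (le_max_left _ _)
  obtain ⟨c, hc0, hc⟩ := hΩ.exists_inner_normal_ge
  obtain ⟨Λ, hΛ, hfield⟩ := hΩ.exists_boundary_field L
  obtain ⟨τ₁, hτ₁, c₀, hc₀, hfl⟩ := exists_flux_sub_le n hp hD0 (4 * Λ)
  obtain ⟨τ₂, hτ₂, hob⟩ := exists_oblique_ne n (C₁ := 2 * Λ) (C₂ := Λ * (2 * Λ + 1 / 2)) hq hc0 hD0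
    hΛ (by positivity) (by positivity)
  -- Here q > 0 makes τ = m^(-q) small and p > 1 makes m^(p-1) large; m₀ is fixed before f, φ, ε and
  -- u.
  obtain ⟨m₀, hm₀⟩ : ∃ m₀ : ℝ, ∀ m ≥ m₀, m ^ (-q) ≤ τ₁ ∧ m ^ (-q) ≤ τ₂ ∧
      m ^ (-q) * (Λ + 2 * Λ * D) ≤ 1 / 100 ∧ 2 * L < c₀ * m ^ (p - 1) := by
    have h1 := tendsto_rpow_neg_atTop hq
    have h2 : Filter.Tendsto (fun m : ℝ => m ^ (-q) * (Λ + 2 * Λ * D)) Filter.atTop (nhds 0) := by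
      simpa using h1.mul_const (Λ + 2 * Λ * D)
    have h3 : Filter.Tendsto (fun m : ℝ => c₀ * m ^ (p - 1)) Filter.atTop Filter.atTop :=
      (tendsto_rpow_atTop (sub_pos.2 hp)).const_mul_atTop hc₀
    exact Filter.eventually_atTop.1 ((h1.eventually_le_const hτ₁).and ((h1.eventually_le_const hτ₂).and
      ((h2.eventually_le_const (by norm_num)).and (h3.eventually_gt_atTop _))))
  -- The 2 comes from ψ ≤ 2s at the midpoint; the 4 gives m ≥ 4(1 + K), which covers both m ≥ 2 and
  -- m ≥ 4K.
  refine ⟨2 * max m₀ 4, fun f φ hf hφ ε hε u₀ u hsol K hK T x hx t ht => ?_⟩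
  obtain ⟨W, hWΛ, hWL, hWφ⟩ := hfield φ hφ
  obtain ⟨σ, -, hu⟩ := hsol.regular
  have hK0 : 0 ≤ K := (norm_nonneg _).trans (hK _ hΩ.nonempty.some_mem)
  set m := max m₀ 4 * (1 + K) with hm
  have h4 : 4 * (1 + K) ≤ m := mul_le_mul_of_nonneg_right (le_max_right _ _) (by linarith)
  have hmm : m₀ ≤ m :=
    (le_max_left _ _).trans (le_mul_of_one_le_right (by positivity) (by linarith))
  obtain ⟨hm1, hm2, hm3, hm4⟩ := hm₀ m hmm
  have hm0 : 0 < m := by linarith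
  have hτ0 : 0 < m ^ (-q) := Real.rpow_pos_of_pos hm0 _
  have hτΛ : m ^ (-q) * Λ ≤ 1 / 100 := by
    have : 0 ≤ m ^ (-q) * (2 * Λ * D) := by positivity
    linarith [mul_add (m ^ (-q)) Λ (2 * Λ * D)]
  have hεm : ε / m ∈ Icc (0 : ℝ) (1 / 2) := by
    refine ⟨div_nonneg hε.1.le hm0.le, ?_⟩
    rw [div_le_iff₀ hm0]
    linarith [hε.2]
  rw [mul_assoc, ← hm]
  refine hu.norm_spatialGradient_le ht.1 (fun a ha =>
    norm_spatialGradient_le_of_sub_le hΩ.isOpen (by positivity) (fun x hx y hy => ?_) ha) x hx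
  have hz : (1 / 2 : ℝ) • (x + y) ∈ closure Ω := by
    have := hΩ.convex.closure.add_smul_sub_mem hx hy (t := 1 / 2) ⟨by norm_num, by norm_num⟩
    convert this using 1
    module
  have h1 := hsol.sub_le_testFunction hu hΩ hD0 hD hc hWΛ hWL hWφ
    (fun x hx z => (le_add_of_nonneg_right (norm_nonneg _)).trans (hf.bound x hx z)) hε
    (by linarith) hm3 (hob _ ⟨hτ0, hm2⟩) (hfl _ ⟨hτ0, hm1⟩) hm4 hK (by linarith) hx hy hz ht.1
  have h2 := mul_le_mul_of_nonneg_left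
    (testFunction_midpoint_le hD0 hεm hτ0.le hτΛ (hWΛ _ hz)) hm0.le
  linarith
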